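/- **Setting.** Let $\phi:\mathbb R\to[0,\infty)$ and $\psi:\mathbb R^2\to[0,\infty)$ be smooth, $\phi$ supported in $[0,1]$, $\psi$ even and supported in $\{|y|\le 1/2\}$, and put $R(s,y)=(\phi\star\tilde\phi)(s)\,(\psi\star\psi)(y)$ with $\tilde\phi(s)=\phi(-s)$. Fix $\hat\beta\in\mathbb R$, $a\in\mathbb R$ and $\gamma\in(0,1)$, and put $\beta_\epsilon^2=\hat\beta^2/\log(1/\epsilon)$ for $\epsilon\in(0,1)$. Let $\Omega_1=\{x\in C([0,1],\mathbb R^2):x(0)=0\}$, let $W_1$ be the Wiener measure on $\Omega_1$, and set $$\hat{\mathbb P}^{(\epsilon)}(dx)=\exp\Big(\tfrac{\beta_\epsilon^2}{2}\int_{[0,1]^2}R(s-u,x(s)-x(u))\,ds\,du-\zeta^{(\epsilon)}\Big)W_1(dx),$$ $$I^{(\epsilon)}(x,y)=\beta_\epsilon^2\int_{[0,1]^2}R(a+s-u,\,y(s)+x(1)-x(u))\,ds\,du,$$ where $\zeta^{(\epsilon)}$ normalizes $\hat{\mathbb P}^{(\epsilon)}$ to a probability measure. Let $(\rho^{(\epsilon)},\Psi^{(\epsilon)})$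 be the principal eigenpair of $f\mapsto\int e^{I^{(\epsilon)}(\cdot,y)}f(y)\,\hat{\mathbb P}^{(\epsilon)}(dy)$: $\rho^{(\epsilon)}>0$ is the largest eigenvalue, and $\Psi^{(\epsilon)}$ is the eigenfunction that lies between two positive constants and has $\int\Psi^{(\epsilon)}d\hat{\mathbb P}^{(\epsilon)}=1$. Put $$\hat\pi^{(\epsilon)}(x,dy)=\frac{e^{I^{(\epsilon)}(x,y)}\Psi^{(\epsilon)}(y)}{\rho^{(\epsilon)}\Psi^{(\epsilon)}(x)}\,\hat{\mathbb P}^{(\epsilon)}(dy),\qquad \hat{\boldsymbol\pi}^{(\epsilon)}=\hat\pi^{(\epsilon)}\times\hat\pi^{(\epsilon)}.$$ For all small $\epsilon$ one has $\hat{\boldsymbol\pi}^{(\epsilon)}(z,\cdot)\ge\gamma\,W_1\times W_1$ for every $z$. For such $\epsilon$, let $(\eta_j,X_j,Y_j)$ be the following Markov chain: $(X_0,Y_0)\sim W_1\times W_1$; at each step $j\ge1$, with probability $\gamma$ one sets $\eta_j=1$ and samples $(X_j,Y_j)$ from $W_1\times W_1$, and with probability $1-\gamma$ one sets $\eta_j=0$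 and samples $(X_j,Y_j)$ from $(1-\gamma)^{-1}\big(\hat{\boldsymbol\pi}^{(\epsilon)}((X_{j-1},Y_{j-1}),\cdot)-\gamma\,W_1\times W_1\big)$. Let $T_0=0$ and $T_{k+1}=\inf\{j>T_k:\eta_j=1\}$. Let $\omega_{X_0}$ be the path on $[0,\infty)$ glued from $X_0,X_1,\dots$, that is, $\omega_{X_0}(n+s)=\sum_{j<n}X_j(1)+X_n(s)$ for integers $n\ge0$ and $s\in[0,1]$, and let $\omega_{Y_0}$ be the path glued in the same way from $Y_0,Y_1,\dots$. **Proposition.** As $k\to\infty$ and $\epsilon\to0^+$ jointly, the random vector $$\frac1{\sqrt k}\big(\omega_{X_0}(T_k)-\omega_{Y_0}(T_k)\big)$$ converges in distribution to the centered Gaussian vector in $\mathbb R^2$ with covariance matrix $\frac2\gamma I_{2\times2}$. Furthermore, for all small $\epsilon$ and all $k\ge1$ the vector $\omega_{X_0}(T_k)-\omega_{Y_0}(T_k)$ has a density $F^{(\epsilon)}_k$ with respect to Lebesgue measure, which for $k\ge2$ can be taken continuous, and with this choice $$\sup_{x\in\mathbb R^2}\Big|kF_k^{(\epsilon)}(x)-\frac{\gamma}{4\pi}e^{-\gamma|x|^2/(4k)}\Big|\longrightarrow0\qquad\text{as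 }k\to\infty\text{ and }\epsilon\to0^+\text{ jointly.}$$ -/

import Mathlib

open MeasureTheory ProbabilityTheory Filter Topology
open scoped NNReal ContDiff

noncomputable section

namespace SHE

/-- The plane `ℝ²` with its Euclidean norm. -/
abbrev Plane : Type := EuclideanSpace ℝ (Fin 2)

/-- The Borel `σ`-algebra of the sup-norm topology on `C([0,1], ℝ²)`. -/
instance instMeasurableSpaceContinuousMap : MeasurableSpace C(unitInterval, Plane) := borel _

instance instBorelSpaceContinuousMap : BorelSpace C(unitInterval, Plane) := ⟨rfl⟩

/-- The path space `Ω₁` of continuous maps `x : [0,1] → ℝ²` with `x(0) = 0`, with the subspace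
topology and its Borel `σ`-algebra. -/
abbrev Path : Type := {x : C(unitInterval, Plane) // x 0 = 0}

/-- `W` is the Wiener measure `W₁` on `Ω₁`, the law of a standard planar Brownian motion on `[0,1]`:
under `W` the coordinate process has independent increments, and its increment from `s` to `t` is
a centered Gaussian vector with covariance `(t - s) I`. -/
structure IsWienerMeasure (W : Measure Path) : Prop where
  indep_increments : HasIndepIncrements (fun (t : unitInterval) (x : Path) => x.1 t) W
  law_increment : ∀ s t : unitInterval, s ≤ t →
    HasLaw (fun x : Path => x.1 t - x.1 s)
      (multivariateGaussian 0 (((t : ℝ) - (s : ℝ)) • (1 : Matrix (Fin 2) (Fin 2) ℝ))) W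

/-- The correlation function `R(s, y) = (φ ⋆ φ̃)(s) · (ψ ⋆ ψ)(y)` with `φ̃(s) = φ(-s)`. -/
def noiseCorr (φ : ℝ → ℝ) (ψ : Plane → ℝ) (s : ℝ) (y : Plane) : ℝ :=
  MeasureTheory.convolution φ (fun u => φ (-u)) (ContinuousLinearMap.mul ℝ ℝ) volume s *
    MeasureTheory.convolution ψ ψ (ContinuousLinearMap.mul ℝ ℝ) volume y

section Chain

/- `W` is the Wiener measure, `R` the correlation function, `a` the time lag in the interaction of
two consecutive segments, `b` the squared coupling constant `β_ε²`, and `γ` the success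
probability. -/
variable (W : Measure Path) (R : ℝ → Plane → ℝ) (a b γ : ℝ)

/-- The self-interaction `∫_{[0,1]²} R(s - u, x(s) - x(u)) ds du` of a segment. -/
def selfInt (x : Path) : ℝ :=
  ∫ s : unitInterval, ∫ u : unitInterval, R ((s : ℝ) - (u : ℝ)) (x.1 s - x.1 u)

/-- The interaction `I(x, y) = b ∫_{[0,1]²} R(a + s - u, y(s) + x(1) - x(u)) ds du` of a segment `x`
with the segment `y` that follows it. -/
def crossInt (x y : Path) : ℝ :=
  b * ∫ s : unitInterval, ∫ u : unitInterval,
    R (a + (s : ℝ) - (u : ℝ)) (y.1 s + x.1 1 - x.1 u)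

/-- The normalization constant `ζ = log ∫ exp((b/2) ∫∫ R(s - u, x(s) - x(u)) ds du) W(dx)`. -/
def zeta : ℝ := Real.log (∫ x, Real.exp (b / 2 * selfInt R x) ∂W)

/-- The exponentially tilted probability measure
`P̂(dx) = exp((b/2) ∫∫ R(s - u, x(s) - x(u)) ds du - ζ) W(dx)` on `Ω₁`. -/
def tiltedWiener : Measure Path :=
  W.withDensity fun x => ENNReal.ofReal (Real.exp (b / 2 * selfInt R x - zeta W R b))

/-- `f` and `r` solve the eigenvalue equation `∫ exp(I(x, y)) f(y) P̂(dy) = r f(x)` for all `x`. -/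
def IsEigen (r : ℝ) (f : Path → ℝ) : Prop :=
  ∀ x, ∫ y, Real.exp (crossInt R a b x y) * f y ∂(tiltedWiener W R b) = r * f x

/-- `(ρ, Ψ)` is the principal eigenpair: `ρ` is positive and the largest eigenvalue, and `Ψ` is an
eigenfunction for `ρ` that lies between two positive constants and has total mass one under `P̂`.
The interaction being bounded, there is exactly one such pair. -/
structure IsPrincipalEigenpair (ρ : ℝ) (Ψ : Path → ℝ) : Prop where
  eigenvalue_pos : 0 < ρ
  measurable : Measurable Ψ
  bounds : ∃ c C : ℝ, 0 < c ∧ ∀ x, c ≤ Ψ x ∧ Ψ x ≤ C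
  mass_one : ∫ x, Ψ x ∂(tiltedWiener W R b) = 1
  eigen : IsEigen W R a b ρ Ψ
  largest : ∀ (r : ℝ) (f : Path → ℝ), Measurable f → (∃ C : ℝ, ∀ x, |f x| ≤ C) → f ≠ 0 →
    IsEigen W R a b r f → r ≤ ρ

/-- The principal eigenpair `(ρ, Ψ)`. -/
def eigenpair : ℝ × (Path → ℝ) :=
  Classical.epsilon fun p : ℝ × (Path → ℝ) => IsPrincipalEigenpair W R a b p.1 p.2

/-- The transition probability `π̂(x, dy) = exp(I(x, y)) Ψ(y) P̂(dy) / (ρ Ψ(x))` on `Ω₁`. -/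
def transition (x : Path) : Measure Path :=
  (tiltedWiener W R b).withDensity fun y => ENNReal.ofReal
    (Real.exp (crossInt R a b x y) * (eigenpair W R a b).2 y /
      ((eigenpair W R a b).1 * (eigenpair W R a b).2 x))

/-- The transition probability `π̂ × π̂` of a pair of independent trajectories. -/
def pairTransition (z : Path × Path) : Measure (Path × Path) :=
  (transition W R a b z.1).prod (transition W R a b z.2)

/-- The residual transition probability `(π̂ × π̂ (z, ·) - γ W × W) / (1 - γ)`. -/
def residual (z : Path × Path) : Measure (Path × Path) :=
  (ENNReal.ofReal (1 - γ))⁻¹ • (pairTransition W R a b z - ENNReal.ofReal γ • W.prod W)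

/-- The state `(η, (X, Y))` of the chain coupled with the Bernoulli variables; `η = true` is a
success. -/
abbrev State : Type := Bool × (Path × Path)

/-- The one-step law of the coupled chain: with probability `γ` there is a success and the new pair
of segments is sampled from `W × W`; with probability `1 - γ` there is a failure and the new pair
is sampled from the residual transition probability at the current pair. -/
def stepLaw (z : State) : Measure State :=
  ENNReal.ofReal γ • (Measure.dirac true).prod (W.prod W) +
    ENNReal.ofReal (1 - γ) • (Measure.dirac false).prod (residual W R a b γ z.2)

/-- The law of the state at time `0`: `(X₀, Y₀) ∼ W × W` (and `η₀ = true`, which is never used). -/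
def initLaw : Measure State := (Measure.dirac true).prod (W.prod W)

instance instIsProbabilityMeasureInitLaw [IsProbabilityMeasure W] :
    IsProbabilityMeasure (initLaw W) := by
  unfold initLaw; infer_instance

/-- The one-step law as a kernel from the history up to time `n` to the state at time `n + 1`. -/
def stepKernel (h : Measurable (stepLaw W R a b γ)) (n : ℕ) :
    Kernel ((i : Finset.Iic n) → (fun _ : ℕ => State) i) State where
  toFun history := stepLaw W R a b γ (history ⟨n, Finset.mem_Iic.2 le_rfl⟩)
  measurable' := h.comp (measurable_pi_apply _)

/-- The one-step law is a transition probability. For `0 < γ < 1` this is the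
case when `π̂ × π̂ (z, ·) ≥ γ W × W` for all `z`, hence for all small `b ≥ 0`. -/
structure IsTransitionProbability : Prop where
  measurable : Measurable (stepLaw W R a b γ)
  isProbabilityMeasure : ∀ z, IsProbabilityMeasure (stepLaw W R a b γ z)

open Classical in
/-- The law of the coupled Markov chain `(η_j, (X_j, Y_j))_{j ≥ 0}` on the space of trajectories.
If the one-step law is not a transition probability there is no such chain, and an irrelevant point
mass is returned. -/
def chainLaw [IsProbabilityMeasure W] : Measure (ℕ → State) :=
  if h : IsTransitionProbability W R a b γ then
    have : ∀ n, IsMarkovKernel (stepKernel W R a b γ h.measurable n) :=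
      fun _ => ⟨fun _ => h.isProbabilityMeasure _⟩
    Kernel.trajMeasure (X := fun _ : ℕ => State) (initLaw W) (stepKernel W R a b γ h.measurable)
  else
    Measure.dirac fun _ => (true, (⟨0, rfl⟩, ⟨0, rfl⟩))

instance instIsProbabilityMeasureChainLaw [IsProbabilityMeasure W] :
    IsProbabilityMeasure (chainLaw W R a b γ) := by
  unfold chainLaw
  split_ifs with h
  · have : ∀ n, IsMarkovKernel (stepKernel W R a b γ h.measurable n) :=
      fun _ => ⟨fun _ => h.isProbabilityMeasure _⟩
    infer_instance
  · infer_instance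

end Chain

/-- The regeneration times `T₀ = 0`, `T_{k+1} = inf {j > T_k : η_j = 1}`. -/
def regenTime (η : ℕ → Bool) : ℕ → ℕ
  | 0 => 0
  | k + 1 => sInf {j | regenTime η k < j ∧ η j = true}

/-- The path `ω : [0,∞) → ℝ²` glued from the segments `x₀, x₁, …`: `ω = x₀` on `[0,1]`, and
`ω(t) = ω(n) + x_n(t - n)` for `t ∈ [n, n + 1]`. -/
def gluedPath (x : ℕ → Path) (t : ℝ≥0) : Plane :=
  (∑ j ∈ Finset.range ⌊t⌋₊, (x j).1 1) +
    (x ⌊t⌋₊).1 ⟨Int.fract (t : ℝ), Int.fract_nonneg _, (Int.fract_lt_one _).le⟩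

/-- The random vector `ω_{X₀}(T_k) - ω_{Y₀}(T_k)`, as a function of the trajectory. -/
def regenDiff (k : ℕ) (τ : ℕ → State) : Plane :=
  gluedPath (fun j => (τ j).2.1) (regenTime (fun j => (τ j).1) k) -
    gluedPath (fun j => (τ j).2.2) (regenTime (fun j => (τ j).1) k)

/-- The law of the coupled chain at the parameter `ε`, where `β_ε² = β̂² / log(1/ε)`. -/
def chainLawEps (W : Measure Path) [IsProbabilityMeasure W] (φ : ℝ → ℝ) (ψ : Plane → ℝ)
    (βhat a γ ε : ℝ) : Measure (ℕ → State) :=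
  chainLaw W (noiseCorr φ ψ) a (βhat ^ 2 / Real.log (1 / ε)) γ

instance instIsProbabilityMeasureChainLawEps (W : Measure Path) [IsProbabilityMeasure W]
    (φ : ℝ → ℝ) (ψ : Plane → ℝ) (βhat a γ ε : ℝ) :
    IsProbabilityMeasure (chainLawEps W φ ψ βhat a γ ε) := by
  unfold chainLawEps; infer_instance

end SHE

end

/-! Only the increments $v_j=X_j(1)-Y_j(1)$ enter: the vector in question is $\sum_{j<T_k}v_j$. Each
success restarts the pair from $W_1\times W_1$, so the sums over successive blocks $[T_i,T_{i+1})$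
are independent with a common law $\mu$, and the vector has law $\mu^{*k}$
(`map_regenDiff_eq_convPow`). Both limit theorems concern convolution powers of a law
$\mu=\mu_\epsilon$ on the plane.

The law $\mu$ is compared with an explicit one. If $R$ is bounded by $M$ and
$\theta=\beta_\epsilon^2M$, the pair transition has a density with respect to $W_1\times W_1$
between $e^{-10\theta}$ and $e^{10\theta}$. The residual kernel therefore lies between
$c_1\,W_1\times W_1$ and $c_2\,W_1\times W_1$, with $c_1,c_2\to1-\gamma$. Under $W_1\times W_1$ the
increment is Gaussian with covariance $2I$; call this law $h$. A block with $n$ failures contributes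
a measure between $\gamma c_1^nh^{*(n+1)}$ and $\gamma c_2^nh^{*(n+1)}$. Exchanging $X$ and $Y$
makes $\hat\mu$ real, and $1-\hat\mu(\xi)=\int(1-\cos\langle x,\xi\rangle)\,d\mu$ is monotone in
$\mu$. It is thus squeezed between two geometric series, and $\hat\mu(\eta/\sqrt k)^k\to
e^{-|\eta|^2/\gamma}$ jointly in $k$ and $\epsilon$ (`tendsto_charFun_pow`). Lévy's theorem gives
convergence in distribution.

For the local theorem, blocks without failures split off a Gaussian piece, $\mu=\gamma h+r$, where
$r$ has mass $1-\gamma$ and a bounded density. Then $\mu^{*k}=\gamma h*\Lambda_k+r^{*k}$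
(`convPow_mixed`). The density of the last term is at most $K(1-\gamma)^{k-1}$, negligible even
after multiplication by $k$. The smooth term admits Fourier inversion, and its rescaled transform
$\hat\mu^k-\hat r^k$ has an integrable bound that depends neither on $k$ nor on $r$
(`exists_norm_charFun_pow_sub_pow_le`). Dominated convergence gives the uniform statement
(`abs_mixedDensity_sub_le`, `exists_density_tendsto`). -/

noncomputable section

namespace SHE

/-! ### The Gaussian law with covariance $2I$ and its Fourier transform -/

/-- The density of the centered Gaussian law on the plane with covariance `2 I`. -/
def heat (z : Plane) : ℝ := (4 * Real.pi)⁻¹ * Real.exp (-‖z‖ ^ 2 / 4)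

lemma heat_nonneg (z : Plane) : 0 ≤ heat z := by unfold heat; positivity

lemma heat_le (z : Plane) : heat z ≤ (4 * Real.pi)⁻¹ := by
  unfold heat
  refine mul_le_of_le_one_right (by positivity) (Real.exp_le_one_iff.2 ?_)
  have := sq_nonneg ‖z‖
  linarith

@[fun_prop]
lemma continuous_heat : Continuous heat := by unfold heat; fun_prop

lemma finrank_plane : Module.finrank ℝ Plane = 2 := by simp

/-- The Gaussian integral with an imaginary linear term; in dimension two the power of $\pi/c$ is
exactly one. It is used with $c=1$ to invert the transform of `heat`, with $c=1/4$ to compute that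
transform, and with $c=k/\gamma$ for the limiting profile. -/
lemma integral_gaussian_phase (c : ℝ) (hc : 0 < c) (z : Plane) :
    ∫ ξ : Plane, Complex.exp (-(c : ℂ) * (‖ξ‖ : ℂ) ^ 2) *
      Complex.exp (-(inner ℝ z ξ : ℝ) * Complex.I) =
      (Real.pi / c * Real.exp (-‖z‖ ^ 2 / (4 * c)) : ℝ) := by
  have h := GaussianFourier.integral_cexp_neg_mul_sq_norm_add (V := Plane) (b := (c : ℂ))
    (by simpa using hc) (-Complex.I) z
  rw [finrank_plane] at h
  have e : ∀ ξ : Plane, Complex.exp (-(c : ℂ) * (‖ξ‖ : ℂ) ^ 2) *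
      Complex.exp (-(inner ℝ z ξ : ℝ) * Complex.I) =
      Complex.exp (-(c : ℂ) * (‖ξ‖ : ℂ) ^ 2 + -Complex.I * ((inner ℝ z ξ : ℝ) : ℂ)) := by
    intro ξ
    rw [← Complex.exp_add]
    congr 1
    ring
  simp_rw [e]
  rw [h]
  simp [Complex.I_sq, neg_div]

lemma heat_eq_integral (z : Plane) :
    (heat z : ℂ) = ((4 * Real.pi ^ 2 : ℝ) : ℂ)⁻¹ * ∫ ξ : Plane, Complex.exp (-(‖ξ‖ : ℂ) ^ 2) *
      Complex.exp (-(inner ℝ z ξ : ℝ) * Complex.I) := by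
  have h := integral_gaussian_phase 1 one_pos z
  simp only [Complex.ofReal_one, neg_mul, one_mul] at h
  simp only [neg_mul]
  rw [h, heat, ← Complex.ofReal_inv, ← Complex.ofReal_mul]
  congr 1
  have := Real.pi_pos
  field_simp

/-- The centered Gaussian law on the plane with covariance `2 I`. -/
def heatMeasure : Measure Plane := volume.withDensity fun z => ENNReal.ofReal (heat z)

lemma integrable_heat : Integrable heat := by
  have h := GaussianFourier.integrable_cexp_neg_mul_sq_norm_add (V := Plane) (b := (1 / 4 : ℂ))
    (by simp) 0 0
  have h2 := (h.norm).const_mul ((4 * Real.pi)⁻¹)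
  refine h2.congr (ae_of_all _ fun z => ?_)
  simp only [heat, Complex.norm_exp]
  congr 2
  have : (-(1 / 4 : ℂ) * (‖z‖ : ℂ) ^ 2 + 0 * ((inner ℝ (0 : Plane) z : ℝ) : ℂ)) =
    ((-‖z‖ ^ 2 / 4 : ℝ) : ℂ) := by push_cast; ring
  rw [this, Complex.ofReal_re]

instance : IsFiniteMeasure heatMeasure := by
  unfold heatMeasure
  exact isFiniteMeasure_withDensity_ofReal integrable_heat.2

lemma charFun_heatMeasure (ξ : Plane) :
    charFun heatMeasure ξ = (Real.exp (-‖ξ‖ ^ 2) : ℝ) := by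
  rw [charFun_apply, heatMeasure, integral_withDensity_eq_integral_toReal_smul
    (by fun_prop) (by simp)]
  have h := integral_gaussian_phase (1 / 4) (by norm_num) (-ξ)
  have e : ∀ x : Plane, (ENNReal.ofReal (heat x)).toReal •
      Complex.exp ((inner ℝ x ξ : ℝ) * Complex.I) = ((4 * Real.pi)⁻¹ : ℝ) *
      (Complex.exp (-((1 / 4 : ℝ) : ℂ) * (‖x‖ : ℂ) ^ 2) *
      Complex.exp (-(inner ℝ (-ξ) x : ℝ) * Complex.I)) := by
    intro x
    rw [ENNReal.toReal_ofReal (heat_nonneg x), heat, Complex.real_smul, inner_neg_left,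
      real_inner_comm]
    push_cast
    rw [mul_assoc]
    congr 3
    · ring_nf
    · ring_nf
  simp_rw [e]
  rw [integral_const_mul, h, ← Complex.ofReal_mul]
  congr 1
  have := Real.pi_pos
  simp
  field_simp

instance : IsProbabilityMeasure heatMeasure := by
  constructor
  have h := charFun_heatMeasure 0
  rw [charFun_zero] at h
  have h2 : heatMeasure.real Set.univ = 1 := by
    have : ((heatMeasure.real Set.univ : ℝ) : ℂ) = ((1 : ℝ) : ℂ) := by rw [h]; simp
    exact_mod_cast this
  rw [← ofReal_measureReal, h2]; simp

lemma eq_heatMeasure {G : Measure Plane} [IsFiniteMeasure G]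
    (h : ∀ ξ, charFun G ξ = (Real.exp (-‖ξ‖ ^ 2) : ℝ)) : G = heatMeasure :=
  Measure.ext_of_charFun (funext fun ξ => by rw [h, charFun_heatMeasure])

/-! ### Convolution powers with a Gaussian component split off -/

/-- Convolution powers of a measure. -/
def convPow (μ : Measure Plane) : ℕ → Measure Plane
  | 0 => Measure.dirac 0
  | k + 1 => μ ∗ convPow μ k

instance instIsFiniteMeasureConvPow (μ : Measure Plane) [IsFiniteMeasure μ] (k : ℕ) :
    IsFiniteMeasure (convPow μ k) := by
  induction k with
  | zero => unfold convPow; infer_instance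
  | succ k ih => unfold convPow; infer_instance

instance instIsProbabilityMeasureConvPow (μ : Measure Plane) [IsProbabilityMeasure μ] (k : ℕ) :
    IsProbabilityMeasure (convPow μ k) := by
  induction k with
  | zero => unfold convPow; infer_instance
  | succ k ih => unfold convPow; infer_instance

lemma charFun_convPow (μ : Measure Plane) [IsFiniteMeasure μ] (k : ℕ) (ξ : Plane) :
    charFun (convPow μ k) ξ = charFun μ ξ ^ k := by
  induction k with
  | zero => simp [convPow, charFun_dirac]
  | succ k ih => rw [convPow, charFun_conv, ih, pow_succ']

lemma real_univ_convPow (μ : Measure Plane) [IsFiniteMeasure μ] (k : ℕ) :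
    (convPow μ k).real Set.univ = μ.real Set.univ ^ k := by
  have h := charFun_convPow μ k 0
  simp only [charFun_zero] at h
  exact_mod_cast h

/-- The mixture of the Gaussian law of mass `γ` with a further measure `r`. -/
def mixed (γ : ℝ) (r : Measure Plane) : Measure Plane := ENNReal.ofReal γ • heatMeasure + r

instance (γ : ℝ) (r : Measure Plane) [IsFiniteMeasure r] : IsFiniteMeasure (mixed γ r) := by
  have : IsFiniteMeasure (ENNReal.ofReal γ • heatMeasure) :=
    Measure.smul_finite _ ENNReal.ofReal_ne_top
  unfold mixed; infer_instance

/-- The measure `Λ` for which `convPow (mixed γ r) k = γ heatMeasure ∗ Λ + convPow r k`. -/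
def smoothPart (γ : ℝ) (r : Measure Plane) : ℕ → Measure Plane
  | 0 => 0
  | k + 1 => convPow (mixed γ r) k + r ∗ smoothPart γ r k

instance instIsFiniteMeasureSmoothPart (γ : ℝ) (r : Measure Plane) [IsFiniteMeasure r] (k : ℕ) :
    IsFiniteMeasure (smoothPart γ r k) := by
  induction k with
  | zero => unfold smoothPart; infer_instance
  | succ k ih => unfold smoothPart; infer_instance

/-- Expand only the first factor. Its Gaussian part multiplies the whole remaining power; its part
`r` multiplies a power that is already decomposed by induction. What never meets a Gaussian factor
is $r^{*k}$. -/
lemma convPow_mixed (γ : ℝ) (r : Measure Plane) [IsFiniteMeasure r] (k : ℕ) :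
    convPow (mixed γ r) k =
      ENNReal.ofReal γ • (heatMeasure ∗ smoothPart γ r k) + convPow r k := by
  have hγ : IsFiniteMeasure (ENNReal.ofReal γ • heatMeasure) :=
    Measure.smul_finite _ ENNReal.ofReal_ne_top
  induction k with
  | zero => simp [convPow, smoothPart]
  | succ k ih =>
    have h1 : r ∗ (ENNReal.ofReal γ • (heatMeasure ∗ smoothPart γ r k)) =
        ENNReal.ofReal γ • (heatMeasure ∗ (r ∗ smoothPart γ r k)) := by
      rw [Measure.conv_smul_right, ← Measure.conv_assoc, ← Measure.conv_assoc,
        Measure.conv_comm r heatMeasure]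
    have hf : IsFiniteMeasure (ENNReal.ofReal γ • (heatMeasure ∗ smoothPart γ r k)) :=
      Measure.smul_finite _ ENNReal.ofReal_ne_top
    calc mixed γ r ∗ convPow (mixed γ r) k
        = ENNReal.ofReal γ • (heatMeasure ∗ convPow (mixed γ r) k) +
            r ∗ convPow (mixed γ r) k := by
          conv_lhs => rw [mixed.eq_1 γ r, Measure.add_conv, Measure.conv_smul_left, ← mixed.eq_1 γ r]
      _ = ENNReal.ofReal γ • (heatMeasure ∗ convPow (mixed γ r) k) +
            r ∗ (ENNReal.ofReal γ • (heatMeasure ∗ smoothPart γ r k) + convPow r k) := by rw [← ih]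
      _ = _ := by
          rw [Measure.conv_add, h1, smoothPart, Measure.conv_add, smul_add, add_assoc]
          rfl

lemma charFun_add_measure (μ ν : Measure Plane) [IsFiniteMeasure μ] [IsFiniteMeasure ν]
    (ξ : Plane) : charFun (μ + ν) ξ = charFun μ ξ + charFun ν ξ := by
  simp only [charFun_apply]
  refine integral_add_measure ?_ ?_ <;>
  · refine Integrable.of_bound (by fun_prop) 1 (ae_of_all _ fun x => ?_)
    rw [Complex.norm_exp_ofReal_mul_I]

lemma charFun_smul_measure (c : ℝ) (hc : 0 ≤ c) (μ : Measure Plane) (ξ : Plane) :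
    charFun (ENNReal.ofReal c • μ) ξ = c * charFun μ ξ := by
  simp only [charFun_apply]
  rw [integral_smul_measure, ENNReal.toReal_ofReal hc, Complex.real_smul]

lemma charFun_mixed {γ : ℝ} (hγ : 0 ≤ γ) (r : Measure Plane) [IsFiniteMeasure r] (ξ : Plane) :
    charFun (mixed γ r) ξ = γ * (Real.exp (-‖ξ‖ ^ 2) : ℝ) + charFun r ξ := by
  have : IsFiniteMeasure (ENNReal.ofReal γ • heatMeasure) :=
    Measure.smul_finite _ ENNReal.ofReal_ne_top
  rw [mixed, charFun_add_measure, charFun_smul_measure γ hγ, charFun_heatMeasure]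

lemma charFun_smoothPart {γ : ℝ} (hγ : 0 ≤ γ) (r : Measure Plane) [IsFiniteMeasure r] (k : ℕ)
    (ξ : Plane) :
    γ * (Real.exp (-‖ξ‖ ^ 2) : ℝ) * charFun (smoothPart γ r k) ξ =
      charFun (mixed γ r) ξ ^ k - charFun r ξ ^ k := by
  have hf : IsFiniteMeasure (ENNReal.ofReal γ • (heatMeasure ∗ smoothPart γ r k)) :=
    Measure.smul_finite _ ENNReal.ofReal_ne_top
  have h := congrArg (fun m => charFun m ξ) (convPow_mixed γ r k)
  simp only [charFun_convPow, charFun_add_measure, charFun_smul_measure γ hγ, charFun_conv,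
    charFun_heatMeasure] at h
  rw [h]; ring

lemma norm_charFun_mixed_le {γ : ℝ} (hγ : 0 ≤ γ) (r : Measure Plane) [IsFiniteMeasure r]
    (hr : r.real Set.univ = 1 - γ) (ξ : Plane) :
    ‖charFun (mixed γ r) ξ‖ ≤ 1 - γ * (1 - Real.exp (-‖ξ‖ ^ 2)) := by
  rw [charFun_mixed hγ]
  refine (norm_add_le _ _).trans ?_
  have h := norm_charFun_le (μ := r) ξ
  rw [norm_mul, Complex.norm_real, Complex.norm_real, Real.norm_of_nonneg hγ,
    Real.norm_of_nonneg (Real.exp_nonneg _)]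
  linarith

/-- Dividing `charFun_smoothPart` by the Gaussian would lose everything at high frequency, so the
bound comes from the recursion instead: the transform is a sum of `k` products of `k - 1` factors,
each factor being the transform of `mixed γ r` or of `r`, both of modulus at most $\theta$. -/
lemma norm_charFun_smoothPart_le {γ : ℝ} (hγ : 0 ≤ γ) (r : Measure Plane) [IsFiniteMeasure r]
    (hr : r.real Set.univ = 1 - γ) (k : ℕ) (ξ : Plane) :
    ‖charFun (smoothPart γ r k) ξ‖ ≤ k * (1 - γ * (1 - Real.exp (-‖ξ‖ ^ 2))) ^ (k - 1) := by
  set θ := 1 - γ * (1 - Real.exp (-‖ξ‖ ^ 2)) with hθ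
  have hrθ : ‖charFun r ξ‖ ≤ θ := by
    refine (norm_charFun_le ξ).trans ?_
    rw [hr, hθ]
    nlinarith [Real.exp_nonneg (-‖ξ‖ ^ 2)]
  have h0 : 0 ≤ θ := (norm_nonneg _).trans hrθ
  induction k with
  | zero => simp [smoothPart, charFun_apply]
  | succ k ih =>
    rw [smoothPart, charFun_add_measure, charFun_conv, charFun_convPow]
    refine (norm_add_le _ _).trans ?_
    rw [norm_pow, norm_mul]
    have h1 : ‖charFun (mixed γ r) ξ‖ ^ k ≤ θ ^ k :=
      pow_le_pow_left₀ (norm_nonneg _) (norm_charFun_mixed_le hγ r hr ξ) k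
    have h2 : ‖charFun r ξ‖ * ‖charFun (smoothPart γ r k) ξ‖ ≤ θ * (k * θ ^ (k - 1)) :=
      mul_le_mul hrθ ih (norm_nonneg _) h0
    have h3 : θ * (k * θ ^ (k - 1)) = k * θ ^ k := by
      rcases k with _ | k
      · simp
      · simp only [Nat.add_sub_cancel]; ring
    simp only [Nat.add_sub_cancel]
    push_cast
    linarith

/-! ### Densities of the convolution powers -/

lemma integrable_comp_sub_of_bounded {f : Plane → ℝ} (hf : Measurable f) {K : ℝ}
    (hK : ∀ x, |f x| ≤ K) (ν : Measure Plane) [IsFiniteMeasure ν] (x : Plane) :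
    Integrable (fun y => f (x - y)) ν :=
  Integrable.of_bound (hf.comp (by fun_prop)).aestronglyMeasurable K (ae_of_all _ fun y => hK _)

lemma withDensity_conv {f : Plane → ℝ} (hf : Measurable f) (h0 : ∀ x, 0 ≤ f x) {K : ℝ}
    (hK : ∀ x, f x ≤ K) (ν : Measure Plane) [IsFiniteMeasure ν] :
    (volume.withDensity fun x => ENNReal.ofReal (f x)) ∗ ν =
      volume.withDensity fun x => ENNReal.ofReal (∫ y, f (x - y) ∂ν) := by
  have hm : Measurable fun p : Plane × Plane => ENNReal.ofReal (f (p.1 - p.2)) := by fun_prop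
  refine Measure.ext_of_lintegral _ fun g hg => ?_
  have e : ∀ x, ENNReal.ofReal (∫ y, f (x - y) ∂ν) = ∫⁻ y, ENNReal.ofReal (f (x - y)) ∂ν :=
    fun x => ofReal_integral_eq_lintegral_ofReal
      (integrable_comp_sub_of_bounded hf
        (fun x => abs_le.2 ⟨by linarith [h0 x, (h0 x).trans (hK x)], hK x⟩) ν x)
      (ae_of_all _ fun y => h0 _)
  simp_rw [e]
  have hm2 : Measurable fun x => ∫⁻ y, ENNReal.ofReal (f (x - y)) ∂ν := hm.lintegral_prod_right'
  rw [Measure.lintegral_conv hg, lintegral_withDensity_eq_lintegral_mul _ (by fun_prop)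
    (by exact (Measurable.lintegral_prod_right' (f := fun p : Plane × Plane => g (p.1 + p.2))
      (by fun_prop))), lintegral_withDensity_eq_lintegral_mul _ hm2 hg]
  simp only [Pi.mul_apply]
  calc _ = ∫⁻ x, ∫⁻ y, ENNReal.ofReal (f x) * g (x + y) ∂ν := by
        refine lintegral_congr fun x => ?_
        rw [lintegral_const_mul _ (by fun_prop)]
    _ = ∫⁻ y, ∫⁻ x, ENNReal.ofReal (f x) * g (x + y) ∂volume ∂ν := by
        refine lintegral_lintegral_swap (f := fun x y => ENNReal.ofReal (f x) * g (x + y)) ?_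
        exact Measurable.aemeasurable (by fun_prop)
    _ = ∫⁻ y, ∫⁻ x, ENNReal.ofReal (f (x - y)) * g x ∂volume ∂ν := by
        refine lintegral_congr fun y => ?_
        rw [← lintegral_sub_right_eq_self (fun x => ENNReal.ofReal (f x) * g (x + y)) y]
        simp
    _ = ∫⁻ x, ∫⁻ y, ENNReal.ofReal (f (x - y)) * g x ∂ν := by
        refine (lintegral_lintegral_swap (f := fun x y => ENNReal.ofReal (f (x - y)) * g x) ?_).symm
        exact Measurable.aemeasurable (by fun_prop)
    _ = _ := by
        refine lintegral_congr fun x => ?_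
        rw [lintegral_mul_const _ (by fun_prop)]

/-- The Radon–Nikodym derivative is bounded only almost everywhere; truncating it at `max K 0`
changes it on a null set and gives a bound at every point, as the pointwise estimates on
convolutions need. -/
lemma exists_bounded_density {r : Measure Plane} [IsFiniteMeasure r] {K : ℝ}
    (h : r ≤ ENNReal.ofReal K • volume) :
    ∃ f : Plane → ℝ, Measurable f ∧ (∀ x, 0 ≤ f x) ∧ (∀ x, f x ≤ max K 0) ∧
      r = volume.withDensity fun x => ENNReal.ofReal (f x) := by
  have hac : r ≪ volume := (Measure.absolutelyContinuous_of_le h).trans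
    Measure.smul_absolutelyContinuous
  have hle : r.rnDeriv volume ≤ᵐ[volume] fun _ => ENNReal.ofReal K := by
    refine ae_le_of_forall_setLIntegral_le_of_sigmaFinite
      (Measure.measurable_rnDeriv _ _) fun s hs _ => ?_
    rw [← withDensity_apply _ hs, Measure.withDensity_rnDeriv_eq _ _ hac, setLIntegral_const]
    exact h s
  refine ⟨fun x => min (r.rnDeriv volume x).toReal (max K 0), by fun_prop,
    fun x => le_min ENNReal.toReal_nonneg (le_max_right _ _), fun x => min_le_right _ _, ?_⟩
  rw [← Measure.withDensity_rnDeriv_eq r volume hac]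
  refine (withDensity_congr_ae ?_)
  rw [Measure.withDensity_rnDeriv_eq r volume hac]
  filter_upwards [hle] with x hx
  have hfin : r.rnDeriv volume x ≠ ⊤ := ne_top_of_le_ne_top ENNReal.ofReal_ne_top hx
  have : (r.rnDeriv volume x).toReal ≤ max K 0 := by
    refine (ENNReal.toReal_mono ENNReal.ofReal_ne_top hx).trans ?_
    rw [ENNReal.toReal_ofReal']
  rw [min_eq_left this, ENNReal.ofReal_toReal hfin]

/-- Write $\nu=h\,dx$ with $h\in L^1$. Approximating $h$ in $L^1$ by continuous compactly supported
$g$ makes $g*f$ approximate $h*f$ uniformly, because $f$ is bounded, and each $g*f$ is continuous.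
-/
lemma continuous_integral_comp_sub_of_bounded {f : Plane → ℝ} (hf : Measurable f) {K : ℝ}
    (hK : ∀ x, |f x| ≤ K) (ν : Measure Plane) [IsFiniteMeasure ν] (hν : ν ≪ volume) :
    Continuous fun x => ∫ y, f (x - y) ∂ν := by
  have hK0 : 0 ≤ K := (abs_nonneg _).trans (hK 0)
  set h : Plane → ℝ := fun y => (ν.rnDeriv volume y).toReal with hh
  have hint : Integrable h := Measure.integrable_toReal_rnDeriv
  have hfl : LocallyIntegrable f volume := by
    refine (locallyIntegrable_const K).mono hf.aestronglyMeasurable (ae_of_all _ fun x => ?_)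
    rw [Real.norm_eq_abs, Real.norm_of_nonneg hK0]
    exact hK x
  have hmul : ∀ (g : Plane → ℝ), Integrable g → ∀ x, Integrable fun y => g y * f (x - y) := by
    intro g hg x
    refine hg.mul_bdd (c := K) (hf.comp (by fun_prop)).aestronglyMeasurable
      (ae_of_all _ fun y => hK _)
  have e : ∀ x, ∫ y, f (x - y) ∂ν = ∫ y, h y * f (x - y) := by
    intro x
    conv_lhs => rw [← Measure.withDensity_rnDeriv_eq ν volume hν]
    rw [integral_withDensity_eq_integral_toReal_smul (Measure.measurable_rnDeriv _ _)
      (Measure.rnDeriv_lt_top _ _)]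
    rfl
  simp_rw [e]
  rw [continuous_iff_continuousAt]
  refine fun x₀ => Metric.continuousAt_iff'.2 fun ε hε => ?_
  obtain ⟨g, hgs, hgε, hgc, hgi⟩ := hint.exists_hasCompactSupport_integral_sub_le
    -- An $L^1$ error of this size costs at most ε/4 after multiplication by the bound `K`; the `+
    -- 1` covers `K = 0`.
    (ε := ε / (4 * (K + 1))) (by positivity)
  have hconv : Continuous fun x => ∫ y, g y * f (x - y) :=
    HasCompactSupport.continuous_convolution_left (μ := volume) (ContinuousLinearMap.mul ℝ ℝ)
      hgs hgc hfl
  have happ : ∀ x, |(∫ y, h y * f (x - y)) - ∫ y, g y * f (x - y)| ≤ ε / 4 := by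
    intro x
    rw [← integral_sub (hmul h hint x) (hmul g hgi x)]
    rw [← Real.norm_eq_abs]
    refine (norm_integral_le_integral_norm _).trans ?_
    have hb : ∀ y, ‖h y * f (x - y) - g y * f (x - y)‖ ≤ ‖h y - g y‖ * K := by
      intro y
      rw [← sub_mul, norm_mul]
      exact mul_le_mul_of_nonneg_left (hK _) (norm_nonneg _)
    refine (integral_mono ((hmul h hint x).sub (hmul g hgi x)).norm
      ((hint.sub hgi).norm.mul_const K) hb).trans ?_
    rw [integral_mul_const]
    refine (mul_le_mul_of_nonneg_right hgε hK0).trans ?_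
    rw [div_mul_eq_mul_div, div_le_div_iff₀ (by positivity) (by norm_num)]
    nlinarith
  filter_upwards [Metric.continuousAt_iff'.1 hconv.continuousAt (ε / 4) (by positivity)] with x hx
  rw [Real.dist_eq] at hx ⊢
  have h1 := abs_le.1 (happ x)
  have h2 := abs_le.1 (happ x₀)
  have h3 := abs_lt.1 hx
  rw [abs_lt]
  constructor <;> linarith

/-- The density of `convPow (mixed γ r) k` when `r` has density `f`. -/
def mixedDensity (γ : ℝ) (r : Measure Plane) (f : Plane → ℝ) (k : ℕ) (x : Plane) : ℝ :=
  γ * (∫ y, heat (x - y) ∂(smoothPart γ r k)) + ∫ y, f (x - y) ∂(convPow r (k - 1))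

lemma abs_heat_le (x : Plane) : |heat x| ≤ (4 * Real.pi)⁻¹ := by
  rw [abs_of_nonneg (heat_nonneg x)]; exact heat_le x

lemma continuous_integral_heat (ν : Measure Plane) [IsFiniteMeasure ν] :
    Continuous fun x => ∫ y, heat (x - y) ∂ν :=
  continuous_of_dominated (bound := fun _ => (4 * Real.pi)⁻¹)
    (fun x => by fun_prop) (fun x => ae_of_all _ fun y => abs_heat_le _) (integrable_const _)
    (ae_of_all _ fun y => by fun_prop)

lemma measurable_integral_comp_sub {f : Plane → ℝ} (hf : Measurable f) (ν : Measure Plane)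
    [SFinite ν] : Measurable fun x => ∫ y, f (x - y) ∂ν :=
  (StronglyMeasurable.integral_prod_right (f := fun x y => f (x - y))
    (Measurable.stronglyMeasurable (by fun_prop))).measurable

lemma mixedDensity_nonneg {γ : ℝ} (r : Measure Plane) {f : Plane → ℝ} (hγ : 0 ≤ γ) (h0 : ∀ x, 0 ≤ f x)
    (k : ℕ) (x : Plane) :
    0 ≤ mixedDensity γ r f k x :=
  add_nonneg (mul_nonneg hγ (integral_nonneg fun _ => heat_nonneg _))
    (integral_nonneg fun _ => h0 _)

section Density

variable {γ K : ℝ} {r : Measure Plane} [IsFiniteMeasure r] {f : Plane → ℝ}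

lemma measurable_mixedDensity (hf : Measurable f) (k : ℕ) : Measurable (mixedDensity γ r f k) :=
  ((measurable_integral_comp_sub continuous_heat.measurable _).const_mul _).add
    (measurable_integral_comp_sub hf _)

/-- For `k ≥ 2` the measure `convPow r (k - 1)` is absolutely continuous. For `k = 1` it is the
Dirac mass at the origin and the second summand of the density is `f` itself, which is merely
measurable. -/
lemma continuous_mixedDensity (hf : Measurable f) (h0 : ∀ x, 0 ≤ f x) (hK : ∀ x, f x ≤ K)
    (hr : r = volume.withDensity fun x => ENNReal.ofReal (f x)) {k : ℕ} (hk : 2 ≤ k) :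
    Continuous (mixedDensity γ r f k) := by
  refine ((continuous_integral_heat _).const_mul γ).add ?_
  refine continuous_integral_comp_sub_of_bounded hf (K := K)
    (fun x => by rw [abs_of_nonneg (h0 x)]; exact hK x) _ ?_
  obtain ⟨j, rfl⟩ := Nat.exists_eq_add_of_le hk
  have h := withDensity_conv hf h0 hK (convPow r j)
  rw [← hr] at h
  rw [show 2 + j - 1 = j + 1 by omega, convPow, h]
  exact withDensity_absolutelyContinuous _ _

lemma convPow_mixed_eq_withDensity (hγ : 0 ≤ γ) (hf : Measurable f) (h0 : ∀ x, 0 ≤ f x)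
    (hK : ∀ x, f x ≤ K) (hr : r = volume.withDensity fun x => ENNReal.ofReal (f x))
    {k : ℕ} (hk : 1 ≤ k) :
    convPow (mixed γ r) k = volume.withDensity fun x => ENNReal.ofReal (mixedDensity γ r f k x) := by
  have h1 : convPow r k =
      volume.withDensity fun x => ENNReal.ofReal (∫ y, f (x - y) ∂(convPow r (k - 1))) := by
    rw [← withDensity_conv hf h0 hK, ← hr]
    obtain ⟨j, rfl⟩ := Nat.exists_eq_add_of_le' hk
    rfl
  have h2 : heatMeasure ∗ smoothPart γ r k =
      volume.withDensity fun x => ENNReal.ofReal (∫ y, heat (x - y) ∂(smoothPart γ r k)) :=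
    withDensity_conv continuous_heat.measurable heat_nonneg heat_le _
  have hm : Measurable fun x => ∫ y, heat (x - y) ∂(smoothPart γ r k) :=
    measurable_integral_comp_sub continuous_heat.measurable _
  rw [convPow_mixed, h1, h2, ← withDensity_smul _ hm.ennreal_ofReal,
    ← withDensity_add_left (hm.ennreal_ofReal.const_smul _)]
  congr 1
  funext x
  simp only [Pi.add_apply, Pi.smul_apply, smul_eq_mul, mixedDensity]
  rw [ENNReal.ofReal_add (mul_nonneg hγ (integral_nonneg fun _ => heat_nonneg _))
    (integral_nonneg fun _ => h0 _), ENNReal.ofReal_mul hγ]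

/-! ### Fourier inversion and distance to the Gaussian profile -/

lemma integral_heat_eq (ν : Measure Plane) [IsFiniteMeasure ν] (x : Plane) :
    ((∫ y, heat (x - y) ∂ν : ℝ) : ℂ) = ((4 * Real.pi ^ 2 : ℝ) : ℂ)⁻¹ *
      ∫ ξ : Plane, Complex.exp (-(‖ξ‖ : ℂ) ^ 2) * charFun ν ξ *
        Complex.exp (-(inner ℝ x ξ : ℝ) * Complex.I) := by
  rw [← integral_complex_ofReal]
  simp_rw [heat_eq_integral]
  rw [integral_const_mul]
  congr 1
  have hg : Integrable fun ξ : Plane => Complex.exp (-(‖ξ‖ : ℂ) ^ 2) := by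
    have := GaussianFourier.integrable_cexp_neg_mul_sq_norm_add (V := Plane) (b := (1 : ℂ))
      (by simp) 0 0
    simpa using this
  rw [integral_integral_swap]
  · refine integral_congr_ae (ae_of_all _ fun ξ => ?_)
    simp only
    rw [charFun_apply, integral_const_mul, mul_assoc, ← integral_mul_const]
    congr 2
    funext y
    rw [← Complex.exp_add]
    congr 1
    rw [inner_sub_left]
    push_cast
    ring
  · have h1 : Integrable (fun p : Plane × Plane => (1 : ℂ) * Complex.exp (-(‖p.2‖ : ℂ) ^ 2))
        (ν.prod volume) := (integrable_const (1 : ℂ)).mul_prod hg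
    refine h1.mono (by unfold Function.uncurry; fun_prop) (ae_of_all _ fun p => ?_)
    simp only [Function.uncurry, norm_mul, one_mul]
    have : -((inner ℝ (x - p.1) p.2 : ℝ) : ℂ) * Complex.I =
      ((-inner ℝ (x - p.1) p.2 : ℝ) : ℂ) * Complex.I := by push_cast; ring
    rw [this, Complex.norm_exp_ofReal_mul_I, mul_one]

lemma integrable_gaussian {c : ℝ} (hc : 0 < c) :
    Integrable fun ξ : Plane => Complex.exp (-(c : ℂ) * (‖ξ‖ : ℂ) ^ 2) := by
  have := GaussianFourier.integrable_cexp_neg_mul_sq_norm_add (V := Plane) (b := (c : ℂ))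
      (by simpa using hc) 0 0
  simpa using this

lemma norm_exp_neg_ofReal_mul_I (t : ℝ) : ‖Complex.exp (-(t : ℂ) * Complex.I)‖ = 1 := by
  have : -(t : ℂ) * Complex.I = ((-t : ℝ) : ℂ) * Complex.I := by push_cast; ring
  rw [this, Complex.norm_exp_ofReal_mul_I]

/-- The smooth part and the Gaussian profile are both inverse Fourier integrals. Their difference is
bounded by the $L^1$ norm of the difference of the transforms, since the phase, the only place where
`x` enters, has modulus one. The rest is an average of `f ≤ K` against a measure of mass
$(1-\gamma)^{k-1}$. -/
lemma abs_mixedDensity_sub_le (hγ : 0 < γ) (hr1 : r.real Set.univ = 1 - γ)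
    (h0 : ∀ x, 0 ≤ f x) (hK : ∀ x, f x ≤ K) {k : ℕ} (hk : 1 ≤ k) (x : Plane) :
    |k * mixedDensity γ r f k x - γ / (4 * Real.pi) * Real.exp (-γ * ‖x‖ ^ 2 / (4 * k))| ≤
      (4 * Real.pi ^ 2)⁻¹ * (∫ η : Plane, ‖charFun (mixed γ r) ((√(k : ℝ))⁻¹ • η) ^ k -
        charFun r ((√(k : ℝ))⁻¹ • η) ^ k - (Real.exp (-‖η‖ ^ 2 / γ) : ℝ)‖) +
      k * (K * (1 - γ) ^ (k - 1)) := by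
  have hk0 : (0 : ℝ) < k := by exact_mod_cast hk
  have hpi := Real.pi_pos
  -- The profile is the inverse transform of $e^{-c|\xi|^2}$, which becomes $e^{-|\eta|^2/\gamma}$
  -- at $\xi=\eta/\sqrt k$.
  set c : ℝ := k / γ with hc
  have hc0 : 0 < c := by positivity
  set Φ : Plane → ℂ := fun ξ => charFun (mixed γ r) ξ ^ k - charFun r ξ ^ k with hΦ
  have hΦ' : ∀ ξ, Φ ξ = γ * (Complex.exp (-(‖ξ‖ : ℂ) ^ 2) * charFun (smoothPart γ r k) ξ) := by
    intro ξ
    rw [hΦ]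
    simp only
    rw [← charFun_smoothPart hγ.le r k ξ, ← mul_assoc]
    congr 2
    push_cast
    rfl
  have hΦi : Integrable Φ := by
    have h1 : Integrable fun ξ : Plane => Complex.exp (-(‖ξ‖ : ℂ) ^ 2) *
        charFun (smoothPart γ r k) ξ := by
      have hg := integrable_gaussian one_pos
      simp only [Complex.ofReal_one, neg_mul, one_mul] at hg
      exact hg.mul_bdd measurable_charFun.aestronglyMeasurable
        (ae_of_all _ fun ξ => norm_charFun_le ξ)
    exact (h1.const_mul (γ : ℂ)).congr (ae_of_all _ fun ξ => (hΦ' ξ).symm)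
  have hGi : Integrable fun ξ : Plane => Complex.exp (-(c : ℂ) * (‖ξ‖ : ℂ) ^ 2) :=
    integrable_gaussian hc0
  have hphase : ∀ {g : Plane → ℂ}, Integrable g →
      Integrable fun ξ : Plane => g ξ * Complex.exp (-(inner ℝ x ξ : ℝ) * Complex.I) := by
    intro g hg
    exact hg.mul_bdd (c := 1) (by fun_prop)
      (ae_of_all _ fun ξ => (norm_exp_neg_ofReal_mul_I _).le)
  have hmain : ((k * (γ * ∫ y, heat (x - y) ∂(smoothPart γ r k)) -
      γ / (4 * Real.pi) * Real.exp (-γ * ‖x‖ ^ 2 / (4 * k)) : ℝ) : ℂ) =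
      (((4 * Real.pi ^ 2)⁻¹ * k : ℝ) : ℂ) *
        ∫ ξ : Plane, (Φ ξ - Complex.exp (-(c : ℂ) * (‖ξ‖ : ℂ) ^ 2)) *
          Complex.exp (-(inner ℝ x ξ : ℝ) * Complex.I) := by
    simp_rw [sub_mul]
    rw [integral_sub (hphase hΦi) (hphase hGi), integral_gaussian_phase c hc0 x]
    simp_rw [hΦ', mul_assoc]
    rw [integral_const_mul]
    simp_rw [← mul_assoc]
    rw [mul_sub, ← Complex.ofReal_mul, Complex.ofReal_sub]
    congr 1
    · rw [Complex.ofReal_mul, Complex.ofReal_mul, integral_heat_eq]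
      push_cast
      ring
    · congr 1
      rw [hc]
      have : -‖x‖ ^ 2 / (4 * (k / γ)) = -γ * ‖x‖ ^ 2 / (4 * k) := by field_simp
      rw [this]
      field_simp
  have hscale : ∫ η : Plane, ‖charFun (mixed γ r) ((√(k : ℝ))⁻¹ • η) ^ k -
        charFun r ((√(k : ℝ))⁻¹ • η) ^ k - (Real.exp (-‖η‖ ^ 2 / γ) : ℝ)‖ =
      k * ∫ ξ : Plane, ‖Φ ξ - Complex.exp (-(c : ℂ) * (‖ξ‖ : ℂ) ^ 2)‖ := by
    -- The Jacobian of $\eta=\sqrt k\,\xi$ in the plane is $k$, which absorbs the factor $k$ in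
    -- front of the density.
    have h := Measure.integral_comp_inv_smul_of_nonneg (volume : Measure Plane)
      (fun ξ : Plane => ‖Φ ξ - Complex.exp (-(c : ℂ) * (‖ξ‖ : ℂ) ^ 2)‖) (Real.sqrt_nonneg (k : ℝ))
    rw [finrank_plane, Real.sq_sqrt hk0.le, smul_eq_mul] at h
    rw [← h]
    refine integral_congr_ae (ae_of_all _ fun η => ?_)
    simp only [hΦ]
    congr 2
    rw [norm_smul, norm_inv, Real.norm_of_nonneg (Real.sqrt_nonneg _)]
    push_cast
    congr 1
    have h2 : ((√(k : ℝ) : ℝ) : ℂ) ^ 2 = (k : ℂ) := by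
      rw [← Complex.ofReal_pow, Real.sq_sqrt hk0.le]; simp
    rw [mul_pow, inv_pow, h2, hc]
    have hk1 : (k : ℂ) ≠ 0 := by exact_mod_cast hk0.ne'
    push_cast
    field_simp
  have h1 : |k * (γ * ∫ y, heat (x - y) ∂(smoothPart γ r k)) -
      γ / (4 * Real.pi) * Real.exp (-γ * ‖x‖ ^ 2 / (4 * k))| ≤
      (4 * Real.pi ^ 2)⁻¹ * (k * ∫ ξ : Plane, ‖Φ ξ - Complex.exp (-(c : ℂ) * (‖ξ‖ : ℂ) ^ 2)‖) := by
    rw [← Real.norm_eq_abs, ← Complex.norm_real, hmain, norm_mul, Complex.norm_real,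
      Real.norm_of_nonneg (by positivity), mul_assoc]
    refine mul_le_mul_of_nonneg_left (mul_le_mul_of_nonneg_left ?_ hk0.le) (by positivity)
    refine (norm_integral_le_integral_norm _).trans (le_of_eq ?_)
    congr 1
    funext ξ
    rw [norm_mul, norm_exp_neg_ofReal_mul_I, mul_one]
  have h2 : 0 ≤ ∫ y, f (x - y) ∂(convPow r (k - 1)) := integral_nonneg fun _ => h0 _
  have h3 : ∫ y, f (x - y) ∂(convPow r (k - 1)) ≤ K * (1 - γ) ^ (k - 1) := by
    rw [← hr1, ← real_univ_convPow]
    refine (Real.le_norm_self _).trans ?_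
    refine (norm_integral_le_of_norm_le_const (ae_of_all _ fun y => ?_))
    rw [Real.norm_of_nonneg (h0 _)]
    exact hK _
  rw [hscale, mixedDensity]
  have h4 := abs_le.1 h1
  have h5 := mul_le_mul_of_nonneg_left h3 hk0.le
  have h6 := mul_nonneg hk0.le h2
  rw [abs_le]
  constructor <;> nlinarith

end Density

/-! ### Pointwise limits of the characteristic functions -/

/-- Take logarithms and squeeze with $1-1/x\le\log x\le x-1$ at $x=1-q$. That $q\to0$ follows from
$kq\to t$ and $k\to\infty$. -/
lemma tendsto_one_sub_pow {ι : Type*} {l : Filter ι} {k : ι → ℕ} {q : ι → ℝ} {t : ℝ}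
    (hk : Tendsto k l atTop) (h : Tendsto (fun i => k i * q i) l (𝓝 t)) :
    Tendsto (fun i => (1 - q i) ^ k i) l (𝓝 (Real.exp (-t))) := by
  have hkr : Tendsto (fun i => (k i : ℝ)) l atTop := tendsto_natCast_atTop_atTop.comp hk
  have hq : Tendsto q l (𝓝 0) := by
    have h1 := h.mul hkr.inv_tendsto_atTop
    rw [mul_zero] at h1
    refine h1.congr' ?_
    filter_upwards [hkr.eventually_gt_atTop 0] with i hi
    simp only [Pi.inv_apply]
    field_simp
  have hlt : ∀ᶠ i in l, q i < 1 := hq.eventually_lt_const one_pos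
  have hlog : Tendsto (fun i => k i * Real.log (1 - q i)) l (𝓝 (-t)) := by
    have hlow : Tendsto (fun i => -(k i * q i) / (1 - q i)) l (𝓝 (-t)) := by
      have := h.neg.div (tendsto_const_nhds.sub hq : Tendsto (fun i => (1 : ℝ) - q i) l (𝓝 (1 - 0)))
        (by norm_num)
      simpa [Pi.div_def] using this
    refine tendsto_of_tendsto_of_tendsto_of_le_of_le' hlow h.neg ?_ ?_
    · filter_upwards [hlt] with i hi
      have hpos : 0 < 1 - q i := by linarith
      have h1 := Real.one_sub_inv_le_log_of_pos hpos
      have h2 : -(k i * q i) / (1 - q i) = k i * (1 - (1 - q i)⁻¹) := by field_simp; ring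
      rw [h2]
      exact mul_le_mul_of_nonneg_left h1 (Nat.cast_nonneg _)
    · filter_upwards [hlt] with i hi
      have h1 := Real.log_le_sub_one_of_pos (show 0 < 1 - q i by linarith)
      have h2 : -(k i * q i) = k i * (1 - q i - 1) := by ring
      rw [h2]
      exact mul_le_mul_of_nonneg_left h1 (Nat.cast_nonneg _)
  refine (Real.continuous_exp.continuousAt.tendsto.comp hlog).congr' ?_
  filter_upwards [hlt] with i hi
  simp only [Function.comp]
  rw [mul_comm, Real.exp_mul, Real.exp_log (by linarith), Real.rpow_natCast]

lemma div_one_add_le_one_sub_exp {s : ℝ} (hs : 0 ≤ s) : s / (1 + s) ≤ 1 - Real.exp (-s) := by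
  have h1 : Real.exp (-s) ≤ (1 + s)⁻¹ := by
    rw [Real.exp_neg]
    exact inv_anti₀ (by linarith) (by linarith [Real.add_one_le_exp s])
  have h2 : s / (1 + s) = 1 - (1 + s)⁻¹ := by field_simp; ring
  linarith

lemma one_sub_exp_le (s : ℝ) : 1 - Real.exp (-s) ≤ s := by
  linarith [Real.add_one_le_exp (-s)]

lemma tendsto_mul_one_sub_exp {ι : Type*} {l : Filter ι} {k : ι → ℝ} (hk : Tendsto k l atTop)
    {t : ℝ} (ht : 0 ≤ t) :
    Tendsto (fun i => k i * (1 - Real.exp (-(t / k i)))) l (𝓝 t) := by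
  have h0 : Tendsto (fun i => t / k i) l (𝓝 0) := hk.const_div_atTop t
  have hlow : Tendsto (fun i => t / (1 + t / k i)) l (𝓝 t) := by
    have := (tendsto_const_nhds (x := t)).div
      ((tendsto_const_nhds (x := (1 : ℝ))).add h0) (by norm_num)
    simpa [Pi.div_def] using this
  refine tendsto_of_tendsto_of_tendsto_of_le_of_le' hlow tendsto_const_nhds ?_ ?_
  · filter_upwards [hk.eventually_gt_atTop 0] with i hi
    have h1 := mul_le_mul_of_nonneg_left
      (div_one_add_le_one_sub_exp (show 0 ≤ t / k i by positivity)) hi.le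
    refine le_trans (le_of_eq ?_) h1
    field_simp
  · filter_upwards [hk.eventually_gt_atTop 0] with i hi
    have h1 := mul_le_mul_of_nonneg_left (one_sub_exp_le (t / k i)) hi.le
    refine h1.trans (le_of_eq ?_)
    field_simp

/-- The sum `∑ γ cⁿ (1 - e^{-(n+1)s})`, in closed form: the deficit at frequency `s = ‖ξ‖²` of a
geometric mixture of heat kernels. -/
def deficit (γ c s : ℝ) : ℝ := γ * (1 - Real.exp (-s)) / ((1 - c) * (1 - c * Real.exp (-s)))

/-- `mixed γ r` is a probability measure whose part `r` has a bounded density, and whose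
characteristic function lies between two explicit bounds. -/
structure IsSplit (γ K c₁ c₂ : ℝ) (r : Measure Plane) : Prop where
  finite : IsFiniteMeasure r
  mass : r.real Set.univ = 1 - γ
  le : r ≤ ENNReal.ofReal K • volume
  charFun_eq : ∀ ξ, ∃ q : ℝ, charFun (mixed γ r) ξ = ((1 - q : ℝ) : ℂ) ∧
    deficit γ c₁ (‖ξ‖ ^ 2) ≤ q ∧ q ≤ deficit γ c₂ (‖ξ‖ ^ 2)

/-- The numerator times `k` tends to $\gamma t$ and the denominator to $\gamma^2$. The quotient
$t/\gamma$ reflects the mean block length $1/\gamma$. -/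
lemma tendsto_mul_deficit {ι : Type*} {l : Filter ι} {k c : ι → ℝ} {γ : ℝ} (hγ : 0 < γ)
    (hk : Tendsto k l atTop) (hc : Tendsto c l (𝓝 (1 - γ))) {t : ℝ} (ht : 0 ≤ t) :
    Tendsto (fun i => k i * deficit γ (c i) (t / k i)) l (𝓝 (t / γ)) := by
  have h0 : Tendsto (fun i => Real.exp (-(t / k i))) l (𝓝 1) := by
    have := Real.continuous_exp.continuousAt.tendsto.comp (hk.const_div_atTop t).neg
    simpa [Function.comp_def] using this
  have h1 := (tendsto_mul_one_sub_exp hk ht).const_mul γ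
  have h2 : Tendsto (fun i => (1 - c i) * (1 - c i * Real.exp (-(t / k i)))) l (𝓝 (γ * γ)) := by
    have := (hc.const_sub 1).mul ((hc.mul h0).const_sub 1)
    simpa using this
  have h3 := h1.div h2 (by positivity)
  have e : γ * t / (γ * γ) = t / γ := by field_simp
  rw [e] at h3
  refine h3.congr fun i => ?_
  rw [deficit, Pi.div_apply]
  ring

lemma norm_inv_sqrt_smul_sq (k : ℕ) (η : Plane) :
    ‖(√(k : ℝ))⁻¹ • η‖ ^ 2 = ‖η‖ ^ 2 / k := by
  rw [norm_smul, norm_inv, Real.norm_of_nonneg (Real.sqrt_nonneg _), mul_pow, inv_pow,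
    Real.sq_sqrt (Nat.cast_nonneg _)]
  ring

section Limit

variable {γ K : ℝ} {c₁ c₂ : ℝ → ℝ} {r : ℝ → Measure Plane} {l : Filter ℝ}

/-- The deficit of the characteristic function is squeezed between two closed forms that depend on ε
only through `c₁ ε` and `c₂ ε`, so no relation between the rates of `k` and ε is needed. -/
lemma tendsto_charFun_pow (hγ : 0 < γ) (hc₁ : Tendsto c₁ l (𝓝 (1 - γ)))
    (hc₂ : Tendsto c₂ l (𝓝 (1 - γ))) (h : ∀ᶠ ε in l, IsSplit γ K (c₁ ε) (c₂ ε) (r ε)) (η : Plane) :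
    Tendsto (fun p : ℕ × ℝ => charFun (mixed γ (r p.2)) ((√(p.1 : ℝ))⁻¹ • η) ^ p.1)
      (atTop ×ˢ l) (𝓝 ((Real.exp (-‖η‖ ^ 2 / γ) : ℝ) : ℂ)) := by
  have hk : Tendsto (fun p : ℕ × ℝ => p.1) (atTop ×ˢ l) atTop := tendsto_fst
  have hkr : Tendsto (fun p : ℕ × ℝ => (p.1 : ℝ)) (atTop ×ˢ l) atTop :=
    tendsto_natCast_atTop_atTop.comp hk
  have h' := (tendsto_snd (f := (atTop : Filter ℕ)) (g := l)).eventually h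
  set q : ℕ × ℝ → ℝ := fun p => 1 - (charFun (mixed γ (r p.2)) ((√(p.1 : ℝ))⁻¹ • η)).re with hq
  have hq' : ∀ᶠ p in atTop ×ˢ l,
      charFun (mixed γ (r p.2)) ((√(p.1 : ℝ))⁻¹ • η) = ((1 - q p : ℝ) : ℂ) ∧
      deficit γ (c₁ p.2) (‖η‖ ^ 2 / p.1) ≤ q p ∧ q p ≤ deficit γ (c₂ p.2) (‖η‖ ^ 2 / p.1) := by
    filter_upwards [h'] with p hp
    obtain ⟨q', h1, h2, h3⟩ := hp.charFun_eq ((√(p.1 : ℝ))⁻¹ • η)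
    rw [norm_inv_sqrt_smul_sq] at h2 h3
    have : q p = q' := by simp only [hq]; rw [h1, Complex.ofReal_re]; ring
    rw [this]
    exact ⟨h1, h2, h3⟩
  have hlim : Tendsto (fun p : ℕ × ℝ => p.1 * q p) (atTop ×ˢ l) (𝓝 (‖η‖ ^ 2 / γ)) := by
    refine tendsto_of_tendsto_of_tendsto_of_le_of_le'
      (tendsto_mul_deficit hγ hkr (hc₁.comp tendsto_snd) (sq_nonneg _))
      (tendsto_mul_deficit hγ hkr (hc₂.comp tendsto_snd) (sq_nonneg _)) ?_ ?_
    · filter_upwards [hq'] with p hp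
      exact mul_le_mul_of_nonneg_left hp.2.1 (Nat.cast_nonneg _)
    · filter_upwards [hq'] with p hp
      exact mul_le_mul_of_nonneg_left hp.2.2 (Nat.cast_nonneg _)
  have h1 := (Complex.continuous_ofReal.tendsto _).comp (tendsto_one_sub_pow hk hlim)
  rw [neg_div]
  refine h1.congr' ?_
  filter_upwards [hq'] with p hp
  rw [hp.1]
  simp

lemma tendsto_charFun_rest_pow (hγ : 0 < γ) (hγ1 : γ < 1)
    (h : ∀ᶠ ε in l, IsSplit γ K (c₁ ε) (c₂ ε) (r ε)) (η : Plane) :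
    Tendsto (fun p : ℕ × ℝ => charFun (r p.2) ((√(p.1 : ℝ))⁻¹ • η) ^ p.1)
      (atTop ×ˢ l) (𝓝 0) := by
  have h' := (tendsto_snd (f := (atTop : Filter ℕ)) (g := l)).eventually h
  have h1 : Tendsto (fun p : ℕ × ℝ => (1 - γ) ^ p.1) (atTop ×ˢ l) (𝓝 0) :=
    (tendsto_pow_atTop_nhds_zero_of_lt_one (by linarith) (by linarith)).comp tendsto_fst
  refine squeeze_zero_norm' ?_ h1
  filter_upwards [h'] with p hp
  rw [norm_pow]
  refine pow_le_pow_left₀ (norm_nonneg _) ?_ _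
  exact (norm_charFun_le _).trans hp.mass.le

end Limit

/-! ### Uniform domination and the local limit theorem -/

lemma pow_le_exp_neg {x : ℝ} (hx : x ≤ 1) (k : ℕ) : (1 - x) ^ k ≤ Real.exp (-(k * x)) := by
  rw [show -(k * x) = (k : ℝ) * (-x) by ring, Real.exp_nat_mul]
  exact pow_le_pow_left₀ (by linarith) (by linarith [Real.add_one_le_exp (-x)]) k

lemma sq_mul_exp_le {a x : ℝ} (ha : 0 < a) (hx : 0 ≤ x) :
    (1 + x) ^ 2 * Real.exp (-(a * x)) ≤ 2 * Real.exp a / a ^ 2 := by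
  have h := Real.pow_div_factorial_le_exp (a * (1 + x)) (by positivity) 2
  have e : Real.exp (a * (1 + x)) * Real.exp (-(a * x)) = Real.exp a := by
    rw [← Real.exp_add]; ring_nf
  have h2 := mul_le_mul_of_nonneg_right h (Real.exp_nonneg (-(a * x)))
  rw [e] at h2
  rw [le_div_iff₀ (by positivity)]
  simp [Nat.factorial] at h2
  nlinarith

lemma cube_mul_exp_le {a x : ℝ} (ha : 0 < a) (hx : 0 ≤ x) :
    (1 + x) ^ 3 * Real.exp (-(a * x)) ≤ 6 * Real.exp a / a ^ 3 := by
  have h := Real.pow_div_factorial_le_exp (a * (1 + x)) (by positivity) 3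
  have e : Real.exp (a * (1 + x)) * Real.exp (-(a * x)) = Real.exp a := by
    rw [← Real.exp_add]; ring_nf
  have h2 := mul_le_mul_of_nonneg_right h (Real.exp_nonneg (-(a * x)))
  rw [e] at h2
  rw [le_div_iff₀ (by positivity)]
  simp [Nat.factorial] at h2
  nlinarith

/-- The characteristic functions of the smooth parts, rescaled, are dominated by a single integrable
function. -/
lemma exists_norm_charFun_pow_sub_pow_le {γ : ℝ} (hγ : 0 < γ) (hγ1 : γ < 1) :
    ∃ C : ℝ, ∀ r : Measure Plane, IsFiniteMeasure r → r.real Set.univ = 1 - γ →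
      ∀ k : ℕ, 1 ≤ k → ∀ η : Plane,
      ‖charFun (mixed γ r) ((√(k : ℝ))⁻¹ • η) ^ k - charFun r ((√(k : ℝ))⁻¹ • η) ^ k‖ ≤
        C * (1 + ‖η‖ ^ 2) ^ (-(4 : ℝ) / 2) := by
  set a : ℝ := γ / 2 with ha
  have ha0 : 0 < a := by positivity
  set C₁ : ℝ := 2 * (2 * Real.exp a / a ^ 2) with hC₁
  set C₂ : ℝ := Real.exp a * (2 * Real.exp 1 / 1 ^ 2 * (6 * Real.exp a / a ^ 3)) with hC₂
  have hC₁0 : 0 ≤ C₁ := by positivity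
  have hC₂0 : 0 ≤ C₂ := by positivity
  refine ⟨C₁ + C₂, fun r _ hr k hk η => ?_⟩
  have hk0 : (0 : ℝ) < k := by exact_mod_cast hk
  set t : ℝ := ‖η‖ ^ 2 with ht
  have ht0 : 0 ≤ t := sq_nonneg _
  set ξ := (√(k : ℝ))⁻¹ • η with hξ
  have hs : ‖ξ‖ ^ 2 = t / k := norm_inv_sqrt_smul_sq k η
  set s : ℝ := t / k with hsdef
  have hs0 : 0 ≤ s := by positivity
  have hks : k * s = t := by rw [hsdef]; field_simp
  have hrpow : (1 + t) ^ (-(4 : ℝ) / 2) = ((1 + t) ^ 2)⁻¹ := by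
    rw [show -(4 : ℝ) / 2 = -((2 : ℕ) : ℝ) by norm_num, Real.rpow_neg (by positivity),
      Real.rpow_natCast]
  rw [hrpow, ← div_eq_mul_inv, le_div_iff₀ (by positivity)]
  have hexp1 : Real.exp (-s) ≤ 1 := Real.exp_le_one_iff.2 (by linarith)
  -- Low and high frequencies, $s=|\xi|^2$ at most or above 1. For $s\le1$ one has $1-e^{-s}\ge
  -- s/2$, hence $a=\gamma/2$, and both powers are at most $e^{-aks}=e^{-at}$.
  rcases le_or_gt s 1 with hs1 | hs1
  · have h1 : ‖charFun (mixed γ r) ξ ^ k‖ ≤ Real.exp (-(a * t)) := by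
      rw [norm_pow]
      have h2 := norm_charFun_mixed_le hγ.le r hr ξ
      rw [hs] at h2
      have h3 : s / 2 ≤ 1 - Real.exp (-s) := by
        refine le_trans ?_ (div_one_add_le_one_sub_exp hs0)
        exact div_le_div_of_nonneg_left hs0 (by linarith) (by linarith)
      have h4 : ‖charFun (mixed γ r) ξ‖ ≤ 1 - a * s := by
        rw [ha]; nlinarith
      refine (pow_le_pow_left₀ (norm_nonneg _) h4 k).trans ?_
      refine (pow_le_exp_neg (by rw [ha]; nlinarith) k).trans (le_of_eq ?_)
      rw [← hks]; ring_nf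
    have h2 : ‖charFun r ξ ^ k‖ ≤ Real.exp (-(a * t)) := by
      rw [norm_pow]
      have h3 : ‖charFun r ξ‖ ≤ 1 - a * s := by
        refine (norm_charFun_le _).trans ?_
        rw [hr, ha]; nlinarith
      refine (pow_le_pow_left₀ (norm_nonneg _) h3 k).trans ?_
      refine (pow_le_exp_neg (by rw [ha]; nlinarith) k).trans (le_of_eq ?_)
      rw [← hks]; ring_nf
    have h3 := sq_mul_exp_le ha0 ht0
    have h4 := (norm_sub_le (charFun (mixed γ r) ξ ^ k) (charFun r ξ ^ k)).trans (add_le_add h1 h2)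
    calc _ ≤ (Real.exp (-(a * t)) + Real.exp (-(a * t))) * (1 + t) ^ 2 :=
          mul_le_mul_of_nonneg_right h4 (by positivity)
      _ ≤ C₁ := by rw [hC₁]; linarith
      _ ≤ C₁ + C₂ := by linarith
  -- For $s>1$ the separate powers need not decay in $\xi$; their difference does, through the
  -- factor $e^{-s}$. The factor $k\,e^{-ak}$ from the smooth part then pays for the powers of $1+k$
  -- that come from $1+t\le(1+k)(1+s)$.
  · rw [← charFun_smoothPart hγ.le, norm_mul, norm_mul, Complex.norm_real, Complex.norm_real,
      Real.norm_of_nonneg hγ.le, Real.norm_of_nonneg (Real.exp_nonneg _), hs]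
    have h1 := norm_charFun_smoothPart_le hγ.le r hr k ξ
    rw [hs] at h1
    have h2 : 1 / 2 ≤ 1 - Real.exp (-s) := by
      refine le_trans ?_ (div_one_add_le_one_sub_exp hs0)
      rw [div_le_div_iff₀ (by norm_num) (by linarith)]
      linarith
    have h3 : (1 - γ * (1 - Real.exp (-s))) ^ (k - 1) ≤ Real.exp a * Real.exp (-(a * k)) := by
      have h4 : (1 - γ * (1 - Real.exp (-s))) ^ (k - 1) ≤ (1 - a) ^ (k - 1) :=
        pow_le_pow_left₀ (by nlinarith [Real.exp_nonneg (-s)]) (by rw [ha]; nlinarith) _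
      refine h4.trans ((pow_le_exp_neg (by rw [ha]; linarith) _).trans (le_of_eq ?_))
      rw [← Real.exp_add, Nat.cast_sub hk]
      congr 1
      push_cast
      ring
    have h5 := sq_mul_exp_le one_pos hs0
    rw [one_mul] at h5
    have h6 := cube_mul_exp_le ha0 hk0.le
    have h7 : 1 + t ≤ (1 + k) * (1 + s) := by nlinarith
    have h8 : (1 + t) ^ 2 ≤ ((1 + k) * (1 + s)) ^ 2 := pow_le_pow_left₀ (by positivity) h7 2
    have e0 := Real.exp_nonneg (-s)
    have ek := Real.exp_nonneg (-(a * k))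
    calc _ ≤ (1 * Real.exp (-s) * (k * (Real.exp a * Real.exp (-(a * k))))) *
          ((1 + k) * (1 + s)) ^ 2 := by
          refine mul_le_mul ?_ h8 (by positivity) (by positivity)
          refine mul_le_mul (mul_le_mul_of_nonneg_right hγ1.le e0)
            (h1.trans (mul_le_mul_of_nonneg_left h3 hk0.le)) (norm_nonneg _) (by positivity)
      _ ≤ (1 * Real.exp (-s) * ((1 + k) * (Real.exp a * Real.exp (-(a * k))))) *
          ((1 + k) * (1 + s)) ^ 2 := by
          gcongr
          linarith
      _ = Real.exp a * (((1 + s) ^ 2 * Real.exp (-s)) * ((1 + k) ^ 3 * Real.exp (-(a * k)))) := by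
          ring
      _ ≤ C₂ := by
          rw [hC₂]
          gcongr
      _ ≤ C₁ + C₂ := by linarith

section Limit

variable {γ K : ℝ} {c₁ c₂ : ℝ → ℝ} {r : ℝ → Measure Plane} {l : Filter ℝ}

/-- Dominated convergence along the joint filter, which is possible because that filter is countably
generated and the dominating function depends on neither `k` nor ε. -/
lemma tendsto_integral_charFun_pow_sub [l.IsCountablyGenerated] (hγ : 0 < γ) (hγ1 : γ < 1)
    (hc₁ : Tendsto c₁ l (𝓝 (1 - γ))) (hc₂ : Tendsto c₂ l (𝓝 (1 - γ)))
    (h : ∀ᶠ ε in l, IsSplit γ K (c₁ ε) (c₂ ε) (r ε)) :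
    Tendsto (fun p : ℕ × ℝ => ∫ η : Plane,
      ‖charFun (mixed γ (r p.2)) ((√(p.1 : ℝ))⁻¹ • η) ^ p.1 -
        charFun (r p.2) ((√(p.1 : ℝ))⁻¹ • η) ^ p.1 - (Real.exp (-‖η‖ ^ 2 / γ) : ℝ)‖)
      (atTop ×ˢ l) (𝓝 0) := by
  obtain ⟨C, hC⟩ := exists_norm_charFun_pow_sub_pow_le hγ hγ1
  have h' := (tendsto_snd (f := (atTop : Filter ℕ)) (g := l)).eventually h
  have hk : ∀ᶠ p : ℕ × ℝ in atTop ×ˢ l, 1 ≤ p.1 := tendsto_fst.eventually (eventually_ge_atTop 1)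
  have hgi : Integrable fun η : Plane => Real.exp (-‖η‖ ^ 2 / γ) := by
    refine (integrable_gaussian (inv_pos.2 hγ)).norm.congr (ae_of_all _ fun η => ?_)
    simp only [Complex.norm_exp]
    congr 1
    have : -((γ⁻¹ : ℝ) : ℂ) * (‖η‖ : ℂ) ^ 2 = ((-‖η‖ ^ 2 / γ : ℝ) : ℂ) := by push_cast; ring
    rw [this, Complex.ofReal_re]
  -- The exponent 4 exceeds the dimension 2.
  have hbi : Integrable fun η : Plane => C * (1 + ‖η‖ ^ 2) ^ (-(4 : ℝ) / 2) :=
    (integrable_rpow_neg_one_add_norm_sq (by rw [finrank_plane]; norm_num)).const_mul C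
  rw [show (0 : ℝ) = ∫ _ : Plane, (0 : ℝ) by simp]
  refine tendsto_integral_filter_of_dominated_convergence _ ?_ ?_ (hbi.add hgi) ?_
  · filter_upwards [h'] with p hp
    have := hp.finite
    have m1 : Measurable (charFun (mixed γ (r p.2))) := measurable_charFun
    have m2 : Measurable (charFun (r p.2)) := measurable_charFun
    exact Measurable.aestronglyMeasurable (by fun_prop)
  · filter_upwards [h', hk] with p hp hpk
    refine ae_of_all _ fun η => ?_
    rw [norm_norm]
    refine (norm_sub_le _ _).trans (add_le_add (hC _ hp.finite hp.mass _ hpk η) ?_)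
    rw [Complex.norm_real, Real.norm_of_nonneg (Real.exp_nonneg _)]
  · refine ae_of_all _ fun η => ?_
    have := ((tendsto_charFun_pow hγ hc₁ hc₂ h η).sub
      (tendsto_charFun_rest_pow hγ hγ1 h η)).sub_const ((Real.exp (-‖η‖ ^ 2 / γ) : ℝ) : ℂ)
    simpa using this.norm

/-- The local central limit theorem for the convolution powers of `mixed γ (r ε)`, uniformly in
`ε`. -/
theorem exists_density_tendsto [l.IsCountablyGenerated] (hγ : 0 < γ) (hγ1 : γ < 1)
    (hc₁ : Tendsto c₁ l (𝓝 (1 - γ))) (hc₂ : Tendsto c₂ l (𝓝 (1 - γ)))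
    (h : ∀ᶠ ε in l, IsSplit γ K (c₁ ε) (c₂ ε) (r ε)) :
    ∃ F : ℕ → ℝ → Plane → ℝ,
      (∀ᶠ ε in l, ∀ k : ℕ, 1 ≤ k →
        Measurable (F k ε) ∧ (∀ x, 0 ≤ F k ε x) ∧ (2 ≤ k → Continuous (F k ε)) ∧
        convPow (mixed γ (r ε)) k = volume.withDensity (fun x => ENNReal.ofReal (F k ε x))) ∧
      Tendsto
        (fun p : ℕ × ℝ => ⨆ x : Plane, ENNReal.ofReal
          |(p.1 : ℝ) * F p.1 p.2 x -
            γ / (4 * Real.pi) * Real.exp (-γ * ‖x‖ ^ 2 / (4 * (p.1 : ℝ)))|)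
        (atTop ×ˢ l) (𝓝 0) := by
  -- One density is chosen for every ε; where the splitting fails the choice is irrelevant.
  have hex : ∀ ε, ∃ f : Plane → ℝ, IsSplit γ K (c₁ ε) (c₂ ε) (r ε) →
      Measurable f ∧ (∀ x, 0 ≤ f x) ∧ (∀ x, f x ≤ max K 0) ∧
      r ε = volume.withDensity fun x => ENNReal.ofReal (f x) := by
    intro ε
    by_cases hε : IsSplit γ K (c₁ ε) (c₂ ε) (r ε)
    · have := hε.finite
      obtain ⟨f, hf⟩ := exists_bounded_density hε.le
      exact ⟨f, fun _ => hf⟩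
    · exact ⟨0, fun h => absurd h hε⟩
  choose f hf using hex
  refine ⟨fun k ε => mixedDensity γ (r ε) (f ε) k, ?_, ?_⟩
  · filter_upwards [h] with ε hε k hk
    have := hε.finite
    obtain ⟨h1, h2, h3, h4⟩ := hf ε hε
    exact ⟨measurable_mixedDensity h1 k, mixedDensity_nonneg _ hγ.le h2 k,
      continuous_mixedDensity h1 h2 h3 h4, convPow_mixed_eq_withDensity hγ.le h1 h2 h3 h4 hk⟩
  · have h' := (tendsto_snd (f := (atTop : Filter ℕ)) (g := l)).eventually h
    have hk : ∀ᶠ p : ℕ × ℝ in atTop ×ˢ l, 1 ≤ p.1 := tendsto_fst.eventually (eventually_ge_atTop 1)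
    have hgeom : Tendsto (fun k : ℕ => (k : ℝ) * (max K 0 * (1 - γ) ^ (k - 1))) atTop (𝓝 0) := by
      rw [← tendsto_add_atTop_iff_nat 1]
      have h1 := tendsto_self_mul_const_pow_of_lt_one (r := 1 - γ) (by linarith) (by linarith)
      have h2 := tendsto_pow_atTop_nhds_zero_of_lt_one (r := 1 - γ) (by linarith) (by linarith)
      have h3 := (h1.add h2).const_mul (max K 0)
      simp only [add_zero, mul_zero] at h3
      refine h3.congr fun k => ?_
      simp only [Nat.add_sub_cancel]
      push_cast
      ring
    have hB := ((tendsto_integral_charFun_pow_sub hγ hγ1 hc₁ hc₂ h).const_mul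
      ((4 * Real.pi ^ 2)⁻¹)).add (hgeom.comp (tendsto_fst (f := (atTop : Filter ℕ)) (g := l)))
    rw [mul_zero, add_zero] at hB
    have hB' := ENNReal.tendsto_ofReal hB
    rw [ENNReal.ofReal_zero] at hB'
    refine tendsto_of_tendsto_of_tendsto_of_le_of_le' tendsto_const_nhds hB'
      (Eventually.of_forall fun _ => zero_le) ?_
    filter_upwards [h', hk] with p hp hpk
    have := hp.finite
    obtain ⟨h1, h2, h3, h4⟩ := hf p.2 hp
    refine iSup_le fun x => ENNReal.ofReal_le_ofReal ?_
    exact abs_mixedDensity_sub_le hγ hp.mass h2 h3 hpk x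

end Limit

/-! ### Regeneration times -/

/-- The number of successes among the times `1, …, n`. -/
def successes (η : ℕ → Bool) : ℕ → ℕ
  | 0 => 0
  | n + 1 => successes η n + if η (n + 1) then 1 else 0

/-- The third clause is what is used later: a success at `n + 1` is the next regeneration after
those counted up to `n`. Proving it inductively requires knowing that the last regeneration is at
most `n` and that only failures follow it. The set under `sInf` is nonempty here, so the convention
`sInf ∅ = 0` does not interfere. -/
lemma regenTime_successes (η : ℕ → Bool) (n : ℕ) :
    regenTime η (successes η n) ≤ n ∧
      (∀ j, regenTime η (successes η n) < j → j ≤ n → η j = false) ∧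
      (η (n + 1) = true → regenTime η (successes η n + 1) = n + 1) := by
  have hnext : ∀ n, regenTime η (successes η n) ≤ n →
      (∀ j, regenTime η (successes η n) < j → j ≤ n → η j = false) →
      η (n + 1) = true → regenTime η (successes η n + 1) = n + 1 := by
    intro n h1 h2 h3
    rw [regenTime]
    refine le_antisymm (Nat.sInf_le ⟨by omega, h3⟩) ?_
    refine le_csInf ⟨n + 1, by omega, h3⟩ fun j hj => ?_
    by_contra hlt
    have := h2 j hj.1 (by omega)
    simp [hj.2] at this
  induction n with
  | zero =>
    have h1 : regenTime η (successes η 0) ≤ 0 := le_refl 0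
    have h2 : ∀ j, regenTime η (successes η 0) < j → j ≤ 0 → η j = false := by
      intro j hj hj0; omega
    exact ⟨h1, h2, hnext 0 h1 h2⟩
  | succ n ih =>
    obtain ⟨i1, i2, i3⟩ := ih
    by_cases hη : η (n + 1) = true
    · have hs : successes η (n + 1) = successes η n + 1 := by simp [successes, hη]
      have h0 := i3 hη
      rw [← hs] at h0
      have h1 : regenTime η (successes η (n + 1)) ≤ n + 1 := h0.le
      have h2 : ∀ j, regenTime η (successes η (n + 1)) < j → j ≤ n + 1 → η j = false := by
        intro j hj hj0; omega
      exact ⟨h1, h2, hnext _ h1 h2⟩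
    · have hs : successes η (n + 1) = successes η n := by simp [successes, hη]
      have h1 : regenTime η (successes η (n + 1)) ≤ n + 1 := by rw [hs]; omega
      have h2 : ∀ j, regenTime η (successes η (n + 1)) < j → j ≤ n + 1 → η j = false := by
        intro j hj hj0
        rw [hs] at hj
        rcases Nat.lt_or_ge j (n + 1) with hlt | hge
        · exact i2 j hj (by omega)
        · obtain rfl : j = n + 1 := by omega
          simpa using hη
      exact ⟨h1, h2, hnext _ h1 h2⟩

/-- The term `n = 0` is an empty sum, and the term `n + 1` runs over the pairs with `j + i = n`. -/
lemma tsum_sum_range_eq {F : ℕ → ℕ → ENNReal} :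
    ∑' n, ∑ i ∈ Finset.range n, F (n - 1 - i) i = ∑' j, ∑' i, F j i := by
  rw [tsum_eq_zero_add' ENNReal.summable, ← ENNReal.tsum_prod (f := F),
    ← Finset.HasAntidiagonal.sigmaAntidiagonalEquivProd.tsum_eq, ENNReal.tsum_sigma']
  simp only [Finset.range_zero, Finset.sum_empty, zero_add]
  refine tsum_congr fun n => ?_
  rw [show (∑' p : Finset.HasAntidiagonal.antidiagonal n, (fun p : ℕ × ℕ => F p.1 p.2)
    (Finset.HasAntidiagonal.sigmaAntidiagonalEquivProd ⟨n, p⟩)) =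
    ∑ p ∈ Finset.HasAntidiagonal.antidiagonal n, F p.1 p.2 from
    Finset.tsum_subtype (Finset.HasAntidiagonal.antidiagonal n) (fun p : ℕ × ℕ => F p.1 p.2),
    ← Finset.Nat.sum_antidiagonal_swap, Finset.Nat.sum_antidiagonal_eq_sum_range_succ_mk]
  rfl

/-! ### Decomposition of the walk into independent blocks -/

variable {E : Type*}

/-- The walk with increments `v (z_j)`, at the end of the segment `n`. -/
def walk (v : E → Plane) (τ : ℕ → Bool × E) (n : ℕ) : Plane :=
  ∑ j ∈ Finset.range (n + 1), v (τ j).2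

/-- The number of successes of a trajectory up to time `n`. -/
def count (τ : ℕ → Bool × E) (n : ℕ) : ℕ := successes (fun j => (τ j).1) n

lemma walk_succ (v : E → Plane) (τ : ℕ → Bool × E) (n : ℕ) :
    walk v τ (n + 1) = walk v τ n + v (τ (n + 1)).2 := Finset.sum_range_succ _ _

lemma count_succ (τ : ℕ → Bool × E) (n : ℕ) :
    count τ (n + 1) = count τ n + if (τ (n + 1)).1 then 1 else 0 := rfl

variable [MeasurableSpace E]

lemma measurable_walk {v : E → Plane} (hv : Measurable v) (n : ℕ) :
    Measurable fun τ => walk v τ n := by unfold walk; fun_prop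

lemma measurable_count (n : ℕ) : Measurable fun τ : ℕ → Bool × E => count τ n := by
  induction n with
  | zero => exact measurable_const
  | succ n ih =>
    simp only [count_succ]
    refine ih.add (Measurable.ite ?_ measurable_const measurable_const)
    exact (measurable_fst.comp (measurable_pi_apply (n + 1))) (measurableSet_singleton true)

/-- Under `P` the trajectory starts from `m`; at each step, with probability `γ` there is a success
and the new state is sampled from `m`, and otherwise the new state is sampled from the residual
kernel `R`, of total mass `1 - γ`, at the present state. -/
structure IsRegenChain (γ : ℝ) (m : Measure E) (R : Kernel E E) (v : E → Plane)
    (P : Measure (ℕ → Bool × E)) : Prop where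
  init : P.map (fun τ => (τ 0).2) = m
  step : ∀ (n : ℕ) (g : (ℕ × Plane) × Bool × E → ENNReal), Measurable g →
    ∫⁻ τ, g ((count τ n, walk v τ n), τ (n + 1)) ∂P =
      ∫⁻ τ, (ENNReal.ofReal γ * ∫⁻ w, g ((count τ n, walk v τ n), true, w) ∂m +
        ∫⁻ w, g ((count τ n, walk v τ n), false, w) ∂(R (τ n).2)) ∂P

/-- The sub-probability law of the state and of the walk after `n` failures that follow a fresh
start. -/
def blockLaw (m : Measure E) (R : Kernel E E) (v : E → Plane) : ℕ → Measure (E × Plane)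
  | 0 => m.map fun w => (w, v w)
  | n + 1 => (blockLaw m R v n ⊗ₘ R.comap Prod.fst measurable_fst).map
      fun p => (p.2, p.1.2 + v p.2)

/-- The law of the walk over one block, including its last step. -/
def blockSum (m : Measure E) (R : Kernel E E) (v : E → Plane) : Measure Plane :=
  Measure.sum fun n => (blockLaw m R v n).snd

/-- The law of the state and of the walk at time `n` on the event of `k` successes. -/
def stateLaw (P : Measure (ℕ → Bool × E)) (v : E → Plane) (n k : ℕ) : Measure (E × Plane) :=
  (P.restrict {τ | count τ n = k}).map fun τ => ((τ n).2, walk v τ n)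

section Block

variable {γ : ℝ} {m : Measure E} {R : Kernel E E} {v : E → Plane}

instance instIsFiniteMeasureBlockLaw [IsFiniteMeasure m] [IsFiniteKernel R] (n : ℕ) :
    IsFiniteMeasure (blockLaw m R v n) := by
  induction n with
  | zero => unfold blockLaw; infer_instance
  | succ n ih => unfold blockLaw; infer_instance

lemma lintegral_blockLaw_zero (hv : Measurable v) {g : E × Plane → ENNReal} (hg : Measurable g) :
    ∫⁻ p, g p ∂(blockLaw m R v 0) = ∫⁻ w, g (w, v w) ∂m := by
  rw [blockLaw, lintegral_map hg (by fun_prop)]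

lemma lintegral_blockLaw_succ [IsFiniteMeasure m] [IsFiniteKernel R] (hv : Measurable v) (n : ℕ)
    {g : E × Plane → ENNReal} (hg : Measurable g) :
    ∫⁻ p, g p ∂(blockLaw m R v (n + 1)) =
      ∫⁻ p, ∫⁻ w, g (w, p.2 + v w) ∂(R p.1) ∂(blockLaw m R v n) := by
  rw [blockLaw, lintegral_map hg (by fun_prop), Measure.lintegral_compProd (by fun_prop)]
  simp only [Kernel.comap_apply]

lemma measurable_lintegral_kernel [IsFiniteKernel R] (hv : Measurable v)
    {g : E × Plane → ENNReal} (hg : Measurable g) :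
    Measurable fun p : E × Plane => ∫⁻ w, g (w, p.2 + v w) ∂(R p.1) := by
  have := Measurable.lintegral_kernel_prod_right' (κ := R.comap Prod.fst measurable_fst)
    (f := fun q : (E × Plane) × E => g (q.2, q.1.2 + v q.2)) (by fun_prop)
  simpa only [Kernel.comap_apply] using this

end Block

section Chain

variable {γ : ℝ} {m : Measure E} {R : Kernel E E} {v : E → Plane} {P : Measure (ℕ → Bool × E)}

lemma measurableSet_count_eq (n k : ℕ) : MeasurableSet {τ : ℕ → Bool × E | count τ n = k} :=
  measurable_count n (measurableSet_singleton k)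

lemma measurable_count_add :
    Measurable fun q : (ℕ × Plane) × Bool × E => q.1.1 + (if q.2.1 then 1 else 0) :=
  (measurable_fst.comp measurable_fst).add
    ((measurable_of_countable fun b : Bool => if b then 1 else 0).comp
      (measurable_fst.comp measurable_snd))

lemma lintegral_stateLaw (hv : Measurable v) (n k : ℕ) {g : E × Plane → ENNReal}
    (hg : Measurable g) :
    ∫⁻ p, g p ∂(stateLaw P v n k) =
      ∫⁻ τ, (if count τ n = k then g ((τ n).2, walk v τ n) else 0) ∂P := by
  have hw := measurable_walk hv n
  rw [stateLaw, lintegral_map hg (by fun_prop), ← lintegral_indicator (measurableSet_count_eq n k)]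
  simp only [Set.indicator_apply, Set.mem_ofPred_eq]

instance [IsFiniteMeasure P] (n k : ℕ) : IsFiniteMeasure (stateLaw P v n k) := by
  unfold stateLaw; infer_instance

lemma lintegral_stateLaw_zero (h : IsRegenChain γ m R v P) (hv : Measurable v)
    {g : E × Plane → ENNReal} (hg : Measurable g) :
    ∫⁻ p, g p ∂(stateLaw P v 0 0) = ∫⁻ w, g (w, v w) ∂m := by
  rw [lintegral_stateLaw hv _ _ hg, ← h.init, lintegral_map (by fun_prop) (by fun_prop)]
  refine lintegral_congr fun τ => ?_
  simp [count, successes, walk]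

lemma lintegral_stateLaw_zero_succ (hv : Measurable v) (k : ℕ)
    {g : E × Plane → ENNReal} (hg : Measurable g) :
    ∫⁻ p, g p ∂(stateLaw P v 0 (k + 1)) = 0 := by
  rw [lintegral_stateLaw hv _ _ hg]
  simp [count, successes]

lemma lintegral_stateLaw_succ_zero [IsFiniteKernel R] (h : IsRegenChain γ m R v P)
    (hv : Measurable v) (n : ℕ) {g : E × Plane → ENNReal} (hg : Measurable g) :
    ∫⁻ p, g p ∂(stateLaw P v (n + 1) 0) =
      ∫⁻ p, ∫⁻ w, g (w, p.2 + v w) ∂(R p.1) ∂(stateLaw P v n 0) := by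
  rw [lintegral_stateLaw hv _ _ hg, lintegral_stateLaw hv _ _ (measurable_lintegral_kernel hv hg)]
  have h1 := h.step n (fun q => if q.1.1 + (if q.2.1 then 1 else 0) = 0 then
    g (q.2.2, q.1.2 + v q.2.2) else 0) (by
      exact Measurable.ite (measurable_count_add (measurableSet_singleton 0)) (by fun_prop)
        measurable_const)
  simp only [count_succ, walk_succ]
  rw [h1]
  refine lintegral_congr fun τ => ?_
  by_cases hc : count τ n = 0 <;> simp [hc]

lemma lintegral_stateLaw_succ_succ [IsFiniteKernel R] [SFinite m] (h : IsRegenChain γ m R v P)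
    (hv : Measurable v) (n k : ℕ) {g : E × Plane → ENNReal} (hg : Measurable g) :
    ∫⁻ p, g p ∂(stateLaw P v (n + 1) (k + 1)) =
      ENNReal.ofReal γ * ∫⁻ p, ∫⁻ w, g (w, p.2 + v w) ∂m ∂(stateLaw P v n k) +
      ∫⁻ p, ∫⁻ w, g (w, p.2 + v w) ∂(R p.1) ∂(stateLaw P v n (k + 1)) := by
  have hgm : Measurable fun p : E × Plane => ∫⁻ w, g (w, p.2 + v w) ∂m :=
    Measurable.lintegral_prod_right' (f := fun q : (E × Plane) × E => g (q.2, q.1.2 + v q.2))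
      (by fun_prop)
  have hgk := measurable_lintegral_kernel (R := R) hv hg
  rw [lintegral_stateLaw hv _ _ hg, lintegral_stateLaw hv _ _ hgk, lintegral_stateLaw hv _ _ hgm]
  have h1 := h.step n (fun q => if q.1.1 + (if q.2.1 then 1 else 0) = k + 1 then
    g (q.2.2, q.1.2 + v q.2.2) else 0) (by
      exact Measurable.ite (measurable_count_add (measurableSet_singleton (k + 1))) (by fun_prop)
        measurable_const)
  simp only [count_succ, walk_succ]
  have hw := measurable_walk hv n
  have hma : Measurable fun τ : ℕ → Bool × E => if count τ n = k then
      ∫⁻ w, g (w, walk v τ n + v w) ∂m else 0 := by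
    refine Measurable.ite (measurableSet_count_eq n k) ?_ measurable_const
    exact hgm.comp (g := fun p : E × Plane => ∫⁻ w, g (w, p.2 + v w) ∂m)
      (f := fun τ : ℕ → Bool × E => ((τ n).2, walk v τ n)) (by fun_prop)
  rw [h1, ← lintegral_const_mul _ hma, ← lintegral_add_left (hma.const_mul _)]
  refine lintegral_congr fun τ => ?_
  by_cases hc : count τ n = k
  · simp [hc]
  · by_cases hc' : count τ n = k + 1 <;> simp [hc, hc']

/-- The initial state is sampled from `m`, exactly as after a success, so the first block needs no
separate treatment. -/
lemma stateLaw_zero_right [IsFiniteMeasure m] [IsFiniteKernel R] (h : IsRegenChain γ m R v P)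
    (hv : Measurable v) (n : ℕ) : stateLaw P v n 0 = blockLaw m R v n := by
  induction n with
  | zero =>
    refine Measure.ext_of_lintegral _ fun g hg => ?_
    rw [lintegral_stateLaw_zero h hv hg, lintegral_blockLaw_zero hv hg]
  | succ n ih =>
    refine Measure.ext_of_lintegral _ fun g hg => ?_
    rw [lintegral_stateLaw_succ_zero h hv n hg, lintegral_blockLaw_succ hv n hg, ih]

/-- Decomposition at the last success. If it occurs at time `i + 1`, then `k` successes precede it,
a fresh sample is drawn there, and `n - 1 - i` failures follow. -/
lemma lintegral_stateLaw_eq_sum [IsFiniteMeasure m] [IsFiniteKernel R]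
    (h : IsRegenChain γ m R v P) (hv : Measurable v) (n k : ℕ) {g : E × Plane → ENNReal}
    (hg : Measurable g) :
    ∫⁻ p, g p ∂(stateLaw P v n (k + 1)) = ∑ i ∈ Finset.range n,
      ENNReal.ofReal γ * ∫⁻ p, ∫⁻ q, g (q.1, p.2 + q.2) ∂(blockLaw m R v (n - 1 - i))
        ∂(stateLaw P v i k) := by
  induction n generalizing g with
  | zero => rw [lintegral_stateLaw_zero_succ hv k hg]; simp
  | succ n ih =>
    rw [lintegral_stateLaw_succ_succ h hv n k hg, ih (measurable_lintegral_kernel hv hg),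
      Finset.sum_range_succ, add_comm]
    congr 1
    · refine Finset.sum_congr rfl fun i hi => ?_
      have hi' : i < n := Finset.mem_range.1 hi
      congr 1
      refine lintegral_congr fun p => ?_
      rw [show n + 1 - 1 - i = (n - 1 - i) + 1 by omega,
        lintegral_blockLaw_succ hv _ (g := fun q => g (q.1, p.2 + q.2)) (by fun_prop)]
      simp only [add_assoc]
    · congr 1
      refine lintegral_congr fun p => ?_
      rw [show n + 1 - 1 - n = 0 by omega,
        lintegral_blockLaw_zero hv (g := fun q => g (q.1, p.2 + q.2)) (by fun_prop)]

/-- Summing over all times turns the convolution in time into a product, leaving only a convolution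
in space: a renewal equation. -/
lemma sum_stateLaw_succ [IsFiniteMeasure m] [IsFiniteKernel R] [IsFiniteMeasure P]
    (h : IsRegenChain γ m R v P) (hv : Measurable v) (k : ℕ) :
    (Measure.sum fun n => (stateLaw P v n (k + 1)).snd) =
      ENNReal.ofReal γ • (blockSum m R v ∗ Measure.sum fun n => (stateLaw P v n k).snd) := by
  have hsf : SFinite (blockSum m R v) := by unfold blockSum; infer_instance
  refine Measure.ext_of_lintegral _ fun f hf => ?_
  have hm2 : ∀ ν : Measure Plane, SFinite ν → Measurable fun x => ∫⁻ y, f (x + y) ∂ν := by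
    intro ν _
    exact Measurable.lintegral_prod_right' (f := fun q : Plane × Plane => f (q.1 + q.2))
      (by fun_prop)
  rw [Measure.conv_comm, lintegral_smul_measure, Measure.lintegral_conv hf,
    lintegral_sum_measure, lintegral_sum_measure, smul_eq_mul]
  have e1 : ∀ n, ∫⁻ a, f a ∂(stateLaw P v n (k + 1)).snd = ∑ i ∈ Finset.range n,
      ENNReal.ofReal γ * ∫⁻ x, ∫⁻ y, f (x + y) ∂(blockLaw m R v (n - 1 - i)).snd
        ∂(stateLaw P v i k).snd := by
    intro n
    rw [Measure.snd, lintegral_map hf measurable_snd,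
      lintegral_stateLaw_eq_sum h hv n k (g := fun p => f p.2) (by fun_prop)]
    refine Finset.sum_congr rfl fun i _ => ?_
    rw [Measure.snd, lintegral_map (hm2 _ inferInstance) measurable_snd]
    congr 1
    refine lintegral_congr fun p => ?_
    rw [Measure.snd, lintegral_map (by fun_prop) measurable_snd]
  simp_rw [e1]
  rw [tsum_sum_range_eq (F := fun j i => ENNReal.ofReal γ *
    ∫⁻ x, ∫⁻ y, f (x + y) ∂(blockLaw m R v j).snd ∂(stateLaw P v i k).snd), ENNReal.tsum_comm,
    ← ENNReal.tsum_mul_left]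
  refine tsum_congr fun i => ?_
  rw [ENNReal.tsum_mul_left]
  congr 1
  rw [← lintegral_tsum fun j => (hm2 _ inferInstance).aemeasurable]
  refine lintegral_congr fun x => ?_
  rw [blockSum, lintegral_sum_measure]

/-- The factor `γ` is the probability of a success at time `n + 1`. The left side thus sums, over
`n`, the law of the walk at `n` on the event that the success number `k + 1` occurs at `n + 1`. -/
lemma smul_sum_stateLaw [IsFiniteMeasure m] [IsFiniteKernel R] [IsFiniteMeasure P]
    (h : IsRegenChain γ m R v P) (hv : Measurable v) (k : ℕ) :
    ENNReal.ofReal γ • (Measure.sum fun n => (stateLaw P v n k).snd) =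
      convPow (ENNReal.ofReal γ • blockSum m R v) (k + 1) := by
  have hsf : SFinite (blockSum m R v) := by unfold blockSum; infer_instance
  induction k with
  | zero =>
    simp only [stateLaw_zero_right h hv, convPow, Measure.conv_dirac_zero]
    rfl
  | succ k ih =>
    rw [convPow, ← ih, sum_stateLaw_succ h hv, Measure.conv_smul_left, Measure.conv_smul_right]

lemma lintegral_regen [IsFiniteKernel R] [IsProbabilityMeasure m] (h : IsRegenChain γ m R v P)
    (hv : Measurable v) (n k : ℕ) {f : Plane → ENNReal} (hf : Measurable f) :
    ∫⁻ τ, (if count τ n = k ∧ (τ (n + 1)).1 = true then f (walk v τ n) else 0) ∂P =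
      ENNReal.ofReal γ * ∫⁻ x, f x ∂(stateLaw P v n k).snd := by
  have h1 := h.step n (fun q => if q.1.1 = k ∧ q.2.1 = true then f q.1.2 else 0) (by
      refine Measurable.ite (MeasurableSet.inter ?_ ?_) (by fun_prop) measurable_const
      · exact (measurable_fst.comp measurable_fst) (measurableSet_singleton k)
      · exact (measurable_fst.comp measurable_snd) (measurableSet_singleton true))
  rw [h1, Measure.snd, lintegral_map hf measurable_snd,
    lintegral_stateLaw hv _ _ (g := fun p => f p.2) (by fun_prop), ← lintegral_const_mul]
  · refine lintegral_congr fun τ => ?_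
    by_cases hc : count τ n = k <;> simp [hc]
  · have hw := measurable_walk hv n
    exact Measurable.ite (measurableSet_count_eq n k) (by fun_prop) measurable_const

/-- The law of the walk up to the `(k+1)`-st regeneration time. -/
theorem map_regen_eq_convPow [IsProbabilityMeasure m] [IsFiniteKernel R] [IsProbabilityMeasure P]
    (h : IsRegenChain γ m R v P) (hv : Measurable v)
    (hμ : IsProbabilityMeasure (ENNReal.ofReal γ • blockSum m R v)) {k : ℕ}
    {D : (ℕ → Bool × E) → Plane} (hD : Measurable D)
    (hDw : ∀ τ n, regenTime (fun j => (τ j).1) (k + 1) = n + 1 → D τ = walk v τ n) :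
    P.map D = convPow (ENNReal.ofReal γ • blockSum m R v) (k + 1) := by
  have hprob : IsProbabilityMeasure (P.map D) := Measure.isProbabilityMeasure_map hD.aemeasurable
  -- Both sides are probability measures, so one inequality suffices. It needs no proof that
  -- infinitely many successes occur almost surely; this is contained in the mass of the block law
  -- being one.
  refine (Measure.eq_of_le_of_measure_univ_eq ?_ (by simp)).symm
  rw [← smul_sum_stateLaw h hv]
  refine Measure.le_iff.2 fun A hA => ?_
  set f : Plane → ENNReal := A.indicator 1 with hf
  have hfm : Measurable f := measurable_one.indicator hA
  have e : ∀ ν : Measure Plane, ν A = ∫⁻ x, f x ∂ν := fun ν => (lintegral_indicator_one hA).symm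
  rw [e, e, lintegral_smul_measure, lintegral_sum_measure, smul_eq_mul, ← ENNReal.tsum_mul_left]
  simp_rw [← lintegral_regen h hv _ k hfm]
  rw [lintegral_map hfm hD, ← lintegral_tsum]
  · refine lintegral_mono fun τ => ?_
    -- At most one `n` contributes, since `n + 1` must equal the regeneration time. If none does,
    -- the sum vanishes and the inequality is trivial.
    by_cases hex : ∃ n, count τ n = k ∧ (τ (n + 1)).1 = true
    · obtain ⟨n, hn1, hn2⟩ := hex
      have hT : ∀ n', count τ n' = k ∧ (τ (n' + 1)).1 = true →
          regenTime (fun j => (τ j).1) (k + 1) = n' + 1 := by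
        intro n' hn'
        have := (regenTime_successes (fun j => (τ j).1) n').2.2 hn'.2
        rwa [show successes (fun j => (τ j).1) n' = k from hn'.1] at this
      rw [tsum_eq_single n, if_pos ⟨hn1, hn2⟩, hDw τ n (hT n ⟨hn1, hn2⟩)]
      intro n' hne
      rw [if_neg]
      intro hn'
      have h1 := hT n' hn'
      have h2 := hT n ⟨hn1, hn2⟩
      omega
    · push Not at hex
      have : ∀ n, (if count τ n = k ∧ (τ (n + 1)).1 = true then f (walk v τ n) else 0) = 0 :=
        fun n => if_neg fun hn => hex n hn.1 hn.2
      simp [this]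
  · intro n
    have hw := measurable_walk hv n
    refine (Measurable.ite (MeasurableSet.inter (measurableSet_count_eq n k) ?_)
      (by fun_prop) measurable_const).aemeasurable
    exact (measurable_fst.comp (measurable_pi_apply (n + 1))) (measurableSet_singleton true)

end Chain

/-! ### Comparison of one block with Gaussian convolution powers -/

/-- The law of the walk over a block, restricted to blocks with at least one failure. -/
def blockRest {E : Type*} [MeasurableSpace E] (γ : ℝ) (m : Measure E) (R : Kernel E E)
    (v : E → Plane) : Measure Plane :=
  ENNReal.ofReal γ • Measure.sum fun n => (blockLaw m R v (n + 1)).snd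

/-- The residual kernel `R` has total mass `1 - γ`, it is comparable to `m`, and the dynamics is
symmetric under an involution that changes the sign of the increments, which are Gaussian
under `m`. -/
structure IsResidual {E : Type*} [MeasurableSpace E] (γ c₁ c₂ : ℝ) (m : Measure E) (R : Kernel E E)
    (v : E → Plane) (σ : E → E) : Prop where
  measurable_incr : Measurable v
  map_incr : m.map v = heatMeasure
  mass : ∀ z, R z Set.univ = ENNReal.ofReal (1 - γ)
  lower : ∀ z, ENNReal.ofReal c₁ • m ≤ R z
  upper : ∀ z, R z ≤ ENNReal.ofReal c₂ • m
  measurable_symm : Measurable σ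
  map_symm : m.map σ = m
  incr_symm : ∀ z, v (σ z) = -v z
  kernel_symm : ∀ z, R (σ z) = (R z).map σ

section

variable {E : Type*} [MeasurableSpace E] {γ c₁ c₂ : ℝ} {m : Measure E} {R : Kernel E E}
  {v : E → Plane} {σ : E → E}

lemma measure_le_of_lintegral {α : Type*} [MeasurableSpace α] {μ ν : Measure α}
    (h : ∀ f : α → ENNReal, Measurable f → ∫⁻ x, f x ∂μ ≤ ∫⁻ x, f x ∂ν) : μ ≤ ν :=
  Measure.le_iff.2 fun A hA => by
    simpa only [lintegral_indicator_one hA] using h (A.indicator 1) (measurable_one.indicator hA)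

lemma ennreal_tsum_ofReal_geometric {a c : ℝ} (ha : 0 ≤ a) (hc : 0 ≤ c) (hc1 : c < 1) :
    ∑' n : ℕ, ENNReal.ofReal c ^ n * ENNReal.ofReal a = ENNReal.ofReal (a / (1 - c)) := by
  have h := (hasSum_geometric_of_lt_one hc hc1).mul_right a
  rw [inv_mul_eq_div] at h
  rw [← h.tsum_eq, ENNReal.ofReal_tsum_of_nonneg (fun n => by positivity) h.summable]
  refine tsum_congr fun n => ?_
  rw [ENNReal.ofReal_mul (by positivity), ENNReal.ofReal_pow hc]

lemma blockLaw_univ [IsProbabilityMeasure m] [IsFiniteKernel R]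
    (h : IsResidual γ c₁ c₂ m R v σ) (n : ℕ) :
    blockLaw m R v n Set.univ = ENNReal.ofReal (1 - γ) ^ n := by
  have hv := h.measurable_incr
  induction n with
  | zero =>
    rw [← lintegral_one, lintegral_blockLaw_zero hv measurable_const]
    simp
  | succ n ih =>
    rw [← lintegral_one, lintegral_blockLaw_succ hv n measurable_const]
    simp [h.mass, ih, pow_succ']

lemma blockSum_prob [IsProbabilityMeasure m] [IsFiniteKernel R]
    (h : IsResidual γ c₁ c₂ m R v σ) (hγ : 0 < γ) (hγ1 : γ < 1) :
    IsProbabilityMeasure (ENNReal.ofReal γ • blockSum m R v) := by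
  constructor
  rw [Measure.smul_apply, blockSum, Measure.sum_apply _ MeasurableSet.univ]
  simp_rw [Measure.snd_univ, blockLaw_univ h]
  have := ennreal_tsum_ofReal_geometric (a := 1) (c := 1 - γ) zero_le_one (by linarith)
    (by linarith)
  simp only [ENNReal.ofReal_one, mul_one] at this
  rw [this, smul_eq_mul, ← ENNReal.ofReal_mul hγ.le]
  simp only [sub_sub_cancel, one_div]
  rw [mul_inv_cancel₀ hγ.ne', ENNReal.ofReal_one]

lemma blockLaw_snd_zero (h : IsResidual γ c₁ c₂ m R v σ) :
    (blockLaw m R v 0).snd = heatMeasure := by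
  have hv := h.measurable_incr
  rw [blockLaw, Measure.snd, Measure.map_map measurable_snd (by fun_prop), ← h.map_incr]
  rfl

/-- A block without failures is a single sample from `m`, whose increment has law `heatMeasure`.
This is the source of the Gaussian component. -/
lemma mixed_blockRest (h : IsResidual γ c₁ c₂ m R v σ) :
    mixed γ (blockRest γ m R v) = ENNReal.ofReal γ • blockSum m R v := by
  refine Measure.ext fun A hA => ?_
  rw [mixed, blockRest, blockSum, ← smul_add, Measure.smul_apply, Measure.smul_apply,
    Measure.add_apply, Measure.sum_apply _ hA, Measure.sum_apply _ hA,
    tsum_eq_zero_add' (f := fun n => (blockLaw m R v n).snd A) ENNReal.summable,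
    blockLaw_snd_zero h]

lemma blockRest_univ [IsProbabilityMeasure m] [IsFiniteKernel R]
    (h : IsResidual γ c₁ c₂ m R v σ) (hγ : 0 < γ) (hγ1 : γ < 1) :
    blockRest γ m R v Set.univ = ENNReal.ofReal (1 - γ) := by
  rw [blockRest, Measure.smul_apply, Measure.sum_apply _ MeasurableSet.univ]
  simp_rw [Measure.snd_univ, blockLaw_univ h, pow_succ]
  rw [ennreal_tsum_ofReal_geometric (by linarith) (by linarith) (by linarith), smul_eq_mul,
    ← ENNReal.ofReal_mul hγ.le]
  rw [sub_sub_cancel, mul_div_cancel₀ _ hγ.ne']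

lemma lintegral_blockLaw_snd_succ [IsProbabilityMeasure m] [IsFiniteKernel R]
    (hv : Measurable v) (n : ℕ) {f : Plane → ENNReal} (hf : Measurable f) :
    ∫⁻ x, f x ∂(blockLaw m R v (n + 1)).snd =
      ∫⁻ p, ∫⁻ w, f (p.2 + v w) ∂(R p.1) ∂(blockLaw m R v n) := by
  rw [Measure.snd, lintegral_map hf measurable_snd,
    lintegral_blockLaw_succ hv n (g := fun p => f p.2) (by fun_prop)]

lemma lintegral_conv_heat [IsProbabilityMeasure m] [IsFiniteKernel R]
    (h : IsResidual γ c₁ c₂ m R v σ) (n : ℕ) {f : Plane → ENNReal} (hf : Measurable f) :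
    ∫⁻ x, f x ∂(heatMeasure ∗ (blockLaw m R v n).snd) =
      ∫⁻ p, ∫⁻ w, f (p.2 + v w) ∂m ∂(blockLaw m R v n) := by
  have hv := h.measurable_incr
  rw [Measure.conv_comm, Measure.lintegral_conv hf, Measure.snd, lintegral_map _ measurable_snd]
  · refine lintegral_congr fun p => ?_
    rw [← h.map_incr, lintegral_map (by fun_prop) hv]
  · exact Measurable.lintegral_prod_right' (f := fun q : Plane × Plane => f (q.1 + q.2))
      (by fun_prop)

/-- Replacing the kernel by `c₂ m` at every failure removes the dependence on the current state: the
increments become independent Gaussians, at the price of one factor `c₂` per failure. -/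
lemma blockLaw_snd_le [IsProbabilityMeasure m] [IsFiniteKernel R]
    (h : IsResidual γ c₁ c₂ m R v σ) (n : ℕ) :
    (blockLaw m R v n).snd ≤ ENNReal.ofReal c₂ ^ n • convPow heatMeasure (n + 1) := by
  have hv := h.measurable_incr
  induction n with
  | zero => simp [blockLaw_snd_zero h, convPow]
  | succ n ih =>
    refine measure_le_of_lintegral fun f hf => ?_
    rw [lintegral_blockLaw_snd_succ hv n hf]
    calc _ ≤ ∫⁻ p, ENNReal.ofReal c₂ * ∫⁻ w, f (p.2 + v w) ∂m ∂(blockLaw m R v n) := by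
          refine lintegral_mono fun p => ?_
          rw [← smul_eq_mul, ← lintegral_smul_measure]
          exact lintegral_mono' (h.upper _) le_rfl
      _ = ENNReal.ofReal c₂ * ∫⁻ x, f x ∂(heatMeasure ∗ (blockLaw m R v n).snd) := by
          rw [lintegral_conv_heat h n hf, lintegral_const_mul]
          exact Measurable.lintegral_prod_right'
            (f := fun q : (E × Plane) × E => f (q.1.2 + v q.2)) (by fun_prop)
      _ ≤ ENNReal.ofReal c₂ *
          (ENNReal.ofReal c₂ ^ n * ∫⁻ x, f x ∂(convPow heatMeasure (n + 1 + 1))) := by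
          gcongr
          rw [← smul_eq_mul, ← lintegral_smul_measure, convPow]
          rw [Measure.lintegral_conv hf, lintegral_smul_measure, Measure.lintegral_conv hf,
            smul_eq_mul, ← lintegral_const_mul]
          · refine lintegral_mono fun x => ?_
            rw [← smul_eq_mul, ← lintegral_smul_measure]
            exact lintegral_mono' ih le_rfl
          · exact Measurable.lintegral_prod_right' (f := fun q : Plane × Plane => f (q.1 + q.2))
              (by fun_prop)
      _ = _ := by rw [lintegral_smul_measure, smul_eq_mul, pow_succ', mul_assoc]

lemma le_blockLaw_snd [IsProbabilityMeasure m] [IsFiniteKernel R]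
    (h : IsResidual γ c₁ c₂ m R v σ) (n : ℕ) :
    ENNReal.ofReal c₁ ^ n • convPow heatMeasure (n + 1) ≤ (blockLaw m R v n).snd := by
  have hv := h.measurable_incr
  induction n with
  | zero => simp [blockLaw_snd_zero h, convPow]
  | succ n ih =>
    refine measure_le_of_lintegral fun f hf => ?_
    rw [lintegral_blockLaw_snd_succ hv n hf]
    calc _ = ENNReal.ofReal c₁ *
          (ENNReal.ofReal c₁ ^ n * ∫⁻ x, f x ∂(convPow heatMeasure (n + 1 + 1))) := by
          rw [lintegral_smul_measure, smul_eq_mul, pow_succ', mul_assoc]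
      _ ≤ ENNReal.ofReal c₁ * ∫⁻ x, f x ∂(heatMeasure ∗ (blockLaw m R v n).snd) := by
          gcongr
          rw [← smul_eq_mul, ← lintegral_smul_measure, convPow]
          rw [Measure.lintegral_conv hf, lintegral_smul_measure, Measure.lintegral_conv hf,
            smul_eq_mul, ← lintegral_const_mul]
          · refine lintegral_mono fun x => ?_
            rw [← smul_eq_mul, ← lintegral_smul_measure]
            exact lintegral_mono' ih le_rfl
          · exact Measurable.lintegral_prod_right' (f := fun q : Plane × Plane => f (q.1 + q.2))
              (by fun_prop)
      _ = ∫⁻ p, ENNReal.ofReal c₁ * ∫⁻ w, f (p.2 + v w) ∂m ∂(blockLaw m R v n) := by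
          rw [lintegral_conv_heat h n hf, lintegral_const_mul]
          exact Measurable.lintegral_prod_right'
            (f := fun q : (E × Plane) × E => f (q.1.2 + v q.2)) (by fun_prop)
      _ ≤ _ := by
          refine lintegral_mono fun p => ?_
          rw [← smul_eq_mul, ← lintegral_smul_measure]
          exact lintegral_mono' (h.lower _) le_rfl

lemma convPow_heatMeasure_le (n : ℕ) :
    convPow heatMeasure (n + 1) ≤ ENNReal.ofReal (4 * Real.pi)⁻¹ • volume := by
  have h := withDensity_conv continuous_heat.measurable heat_nonneg heat_le
    (convPow heatMeasure n)
  rw [← heatMeasure] at h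
  rw [convPow, h, ← withDensity_const]
  refine withDensity_mono (ae_of_all _ fun x => ENNReal.ofReal_le_ofReal ?_)
  have h := norm_integral_le_of_norm_le_const (μ := convPow heatMeasure n)
    (f := fun y => heat (x - y)) (C := (4 * Real.pi)⁻¹)
    (ae_of_all _ fun y => by rw [Real.norm_eq_abs]; exact abs_heat_le _)
  simp only [probReal_univ, mul_one] at h
  exact (Real.le_norm_self _).trans h

/-- Every Gaussian convolution power has density at most $1/(4\pi)$, and
$\gamma\sum_nc_2^n=\gamma/(1-c_2)\le2$ because $1-c_2\ge\gamma/2$. -/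
lemma blockRest_le [IsProbabilityMeasure m] [IsFiniteKernel R] (h : IsResidual γ c₁ c₂ m R v σ)
    (hγ : 0 < γ) (hγ1 : γ < 1) (hc₂ : 0 ≤ c₂) (hc₂' : c₂ ≤ 1 - γ / 2) :
    blockRest γ m R v ≤ ENNReal.ofReal (2 * (4 * Real.pi)⁻¹) • volume := by
  have hpi := Real.pi_pos
  refine Measure.le_iff.2 fun A hA => ?_
  rw [blockRest, Measure.smul_apply, Measure.sum_apply _ hA, Measure.smul_apply, smul_eq_mul,
    smul_eq_mul]
  have h1 : ∀ n, (blockLaw m R v (n + 1)).snd A ≤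
      ENNReal.ofReal c₂ ^ n * ENNReal.ofReal (4 * Real.pi)⁻¹ * volume A := by
    intro n
    have h2 := blockLaw_snd_le h (n + 1) A
    have h3 := convPow_heatMeasure_le (n + 1) A
    rw [Measure.smul_apply, smul_eq_mul] at h2 h3
    refine h2.trans ?_
    rw [mul_assoc]
    refine mul_le_mul' ?_ h3
    refine pow_le_pow_right_of_le_one' ?_ (Nat.le_succ n)
    exact ENNReal.ofReal_le_one.2 (by linarith)
  refine (mul_le_mul_right (ENNReal.tsum_le_tsum h1) _).trans ?_
  rw [ENNReal.tsum_mul_right, ennreal_tsum_ofReal_geometric (by positivity) hc₂ (by linarith),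
    ← mul_assoc, ← ENNReal.ofReal_mul hγ.le]
  refine mul_le_mul' (ENNReal.ofReal_le_ofReal ?_) le_rfl
  rw [← mul_div_assoc, div_le_iff₀ (by linarith)]
  have : 0 < (4 * Real.pi)⁻¹ := by positivity
  nlinarith

/-- The initial law, the increments and the kernel all commute with `σ` up to the sign of the
increments, and so does each further step. This makes the block law even and its characteristic
function real. -/
lemma blockLaw_map_symm [IsProbabilityMeasure m] [IsFiniteKernel R]
    (h : IsResidual γ c₁ c₂ m R v σ) (n : ℕ) :
    (blockLaw m R v n).map (fun p => (σ p.1, -p.2)) = blockLaw m R v n := by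
  have hv := h.measurable_incr
  have hσ := h.measurable_symm
  induction n with
  | zero =>
    refine Measure.ext_of_lintegral _ fun g hg => ?_
    rw [lintegral_map hg (by fun_prop), lintegral_blockLaw_zero hv
      (g := fun p => g (σ p.1, -p.2)) (by fun_prop), lintegral_blockLaw_zero hv hg]
    conv_rhs => rw [← h.map_symm]
    rw [lintegral_map (by fun_prop) hσ]
    simp only [h.incr_symm]
  | succ n ih =>
    refine Measure.ext_of_lintegral _ fun g hg => ?_
    rw [lintegral_map hg (by fun_prop), lintegral_blockLaw_succ hv n
      (g := fun p => g (σ p.1, -p.2)) (by fun_prop), lintegral_blockLaw_succ hv n hg]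
    conv_rhs => rw [← ih]
    rw [lintegral_map (measurable_lintegral_kernel hv hg) (by fun_prop)]
    refine lintegral_congr fun p => ?_
    simp only
    rw [h.kernel_symm, lintegral_map (by fun_prop) hσ]
    simp only [h.incr_symm, neg_add]

lemma blockSum_map_neg [IsProbabilityMeasure m] [IsFiniteKernel R]
    (h : IsResidual γ c₁ c₂ m R v σ) :
    (ENNReal.ofReal γ • blockSum m R v).map (fun x => -x) = ENNReal.ofReal γ • blockSum m R v := by
  have hσ := h.measurable_symm
  rw [Measure.map_smul, blockSum, Measure.map_sum (by fun_prop)]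
  congr 2
  funext n
  conv_rhs => rw [← blockLaw_map_symm h n]
  rw [Measure.snd, Measure.snd, Measure.map_map (by fun_prop) (by fun_prop),
    Measure.map_map (by fun_prop) (by fun_prop)]
  rfl

lemma charFun_im_eq_zero {μ : Measure Plane} (hμ : μ.map (fun x => -x) = μ) (ξ : Plane) :
    (charFun μ ξ).im = 0 := by
  have h1 : charFun μ (-ξ) = charFun μ ξ := by
    conv_rhs => rw [← hμ]
    rw [charFun_apply, charFun_apply, integral_map (by fun_prop) (by fun_prop)]
    simp
  rw [charFun_neg] at h1
  have := congrArg Complex.im h1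
  simp only [Complex.conj_im] at this
  linarith

/-- As $1-\cos\ge0$, the deficit is a Lebesgue integral of a nonnegative function and hence monotone
in the measure; this carries the measure bounds over to characteristic functions. -/
lemma charFun_re_eq {μ : Measure Plane} [IsProbabilityMeasure μ] (ξ : Plane) :
    (charFun μ ξ).re = 1 - (∫⁻ x, ENNReal.ofReal (1 - Real.cos (inner ℝ x ξ)) ∂μ).toReal := by
  have hc : Integrable (fun x : Plane => Real.cos (inner ℝ x ξ)) μ :=
    Integrable.of_bound (by fun_prop) 1 (ae_of_all _ fun x => Real.abs_cos_le_one _)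
  rw [← integral_eq_lintegral_of_nonneg_ae
    (ae_of_all _ fun x => by simpa using Real.cos_le_one _) (by fun_prop),
    integral_sub (integrable_const _) hc, charFun_apply, ← Complex.reCLM_apply,
    ← ContinuousLinearMap.integral_comp_comm]
  · simp [Complex.exp_ofReal_mul_I_re]
  · refine Integrable.of_bound (by fun_prop) 1 (ae_of_all _ fun x => ?_)
    rw [Complex.norm_exp_ofReal_mul_I]

lemma lintegral_convPow_heat (n : ℕ) (ξ : Plane) :
    ∫⁻ x, ENNReal.ofReal (1 - Real.cos (inner ℝ x ξ)) ∂(convPow heatMeasure n) =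
      ENNReal.ofReal (1 - Real.exp (-‖ξ‖ ^ 2) ^ n) := by
  have h := charFun_re_eq (μ := convPow heatMeasure n) ξ
  rw [charFun_convPow, charFun_heatMeasure, ← Complex.ofReal_pow, Complex.ofReal_re] at h
  rw [h, sub_sub_cancel, ENNReal.ofReal_toReal]
  refine ne_top_of_le_ne_top (b := ∫⁻ _, ENNReal.ofReal 2 ∂(convPow heatMeasure n)) (by simp) ?_
  refine lintegral_mono fun x => ENNReal.ofReal_le_ofReal ?_
  linarith [Real.neg_one_le_cos (inner ℝ x ξ)]

lemma tsum_deficit {c s : ℝ} (hγ : 0 ≤ γ) (hc : 0 ≤ c) (hc1 : c < 1) (hs : 0 ≤ s) :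
    ENNReal.ofReal γ * ∑' n : ℕ, ENNReal.ofReal c ^ n *
      ENNReal.ofReal (1 - Real.exp (-s) ^ (n + 1)) = ENNReal.ofReal (deficit γ c s) := by
  have e0 := Real.exp_pos (-s)
  have e1 : Real.exp (-s) ≤ 1 := Real.exp_le_one_iff.2 (by linarith)
  have hce : c * Real.exp (-s) < 1 := by nlinarith
  have h1 := (hasSum_geometric_of_lt_one hc hc1).sub
    ((hasSum_geometric_of_lt_one (by positivity) hce).mul_right (Real.exp (-s)))
  have h2 : ∀ n : ℕ, c ^ n - (c * Real.exp (-s)) ^ n * Real.exp (-s) =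
      c ^ n * (1 - Real.exp (-s) ^ (n + 1)) := by
    intro n; rw [mul_pow, pow_succ]; ring
  simp_rw [h2] at h1
  have h3 : ∀ n : ℕ, 0 ≤ 1 - Real.exp (-s) ^ (n + 1) := fun n => by
    linarith [pow_le_one₀ (n := n + 1) e0.le e1]
  have h4 : ∀ n : ℕ, ENNReal.ofReal c ^ n * ENNReal.ofReal (1 - Real.exp (-s) ^ (n + 1)) =
      ENNReal.ofReal (c ^ n * (1 - Real.exp (-s) ^ (n + 1))) := fun n => by
    rw [ENNReal.ofReal_mul (by positivity), ENNReal.ofReal_pow hc]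
  simp_rw [h4]
  rw [← ENNReal.ofReal_tsum_of_nonneg (fun n => mul_nonneg (by positivity) (h3 n)) h1.summable,
    h1.tsum_eq, ← ENNReal.ofReal_mul hγ, deficit]
  congr 1
  have : 1 - c ≠ 0 := by linarith
  have : 1 - c * Real.exp (-s) ≠ 0 := by linarith
  field_simp
  ring

lemma deficit_nonneg {c s : ℝ} (hγ : 0 ≤ γ) (hc : 0 ≤ c) (hc1 : c < 1) (hs : 0 ≤ s) :
    0 ≤ deficit γ c s := by
  have e0 := Real.exp_pos (-s)
  have e1 : Real.exp (-s) ≤ 1 := Real.exp_le_one_iff.2 (by linarith)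
  refine div_nonneg (mul_nonneg hγ (by linarith)) (mul_nonneg (by linarith) ?_)
  nlinarith

/-- The law of one block has all the properties that the local central limit theorem needs. -/
theorem IsResidual.isSplit [IsProbabilityMeasure m] [IsFiniteKernel R]
    (h : IsResidual γ c₁ c₂ m R v σ) (hγ : 0 < γ) (hγ1 : γ < 1) (hc₁ : 0 ≤ c₁) (hc₁' : c₁ < 1)
    (hc₂ : 0 ≤ c₂) (hc₂' : c₂ ≤ 1 - γ / 2) :
    IsSplit γ (2 * (4 * Real.pi)⁻¹) c₁ c₂ (blockRest γ m R v) := by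
  have hμ := blockSum_prob h hγ hγ1
  refine ⟨⟨by rw [blockRest_univ h hγ hγ1]; exact ENNReal.ofReal_lt_top⟩, ?_,
    blockRest_le h hγ hγ1 hc₂ hc₂', fun ξ => ?_⟩
  · rw [Measure.real, blockRest_univ h hγ hγ1, ENNReal.toReal_ofReal (by linarith)]
  · rw [mixed_blockRest h]
    -- `J` is the deficit $1-\hat\mu(\xi)$. Bounding each term of the sum over failures by Gaussian
    -- powers gives the two closed forms.
    set J : ENNReal := ∫⁻ x, ENNReal.ofReal (1 - Real.cos (inner ℝ x ξ))
      ∂(ENNReal.ofReal γ • blockSum m R v) with hJ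
    have hfm : Measurable fun x : Plane => ENNReal.ofReal (1 - Real.cos (inner ℝ x ξ)) := by
      fun_prop
    have hJs : J = ENNReal.ofReal γ * ∑' n, ∫⁻ x, ENNReal.ofReal (1 - Real.cos (inner ℝ x ξ))
        ∂(blockLaw m R v n).snd := by
      rw [hJ, lintegral_smul_measure, smul_eq_mul, blockSum, lintegral_sum_measure]
    have hup : J ≤ ENNReal.ofReal (deficit γ c₂ (‖ξ‖ ^ 2)) := by
      rw [hJs, ← tsum_deficit hγ.le hc₂ (by linarith) (sq_nonneg _)]
      gcongr with n
      rw [← lintegral_convPow_heat, ← smul_eq_mul, ← lintegral_smul_measure]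
      exact lintegral_mono' (blockLaw_snd_le h n) le_rfl
    have hlow : ENNReal.ofReal (deficit γ c₁ (‖ξ‖ ^ 2)) ≤ J := by
      rw [hJs, ← tsum_deficit hγ.le hc₁ hc₁' (sq_nonneg _)]
      gcongr with n
      rw [← lintegral_convPow_heat, ← smul_eq_mul, ← lintegral_smul_measure]
      exact lintegral_mono' (le_blockLaw_snd h n) le_rfl
    have hJt : J ≠ ⊤ := ne_top_of_le_ne_top ENNReal.ofReal_ne_top hup
    refine ⟨J.toReal, ?_, ?_, ?_⟩
    · refine Complex.ext ?_ ?_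
      · rw [Complex.ofReal_re, charFun_re_eq]
      · rw [Complex.ofReal_im, charFun_im_eq_zero (blockSum_map_neg h)]
    · rwa [← ENNReal.ofReal_le_iff_le_toReal hJt]
    · exact ENNReal.toReal_le_of_le_ofReal
        (deficit_nonneg hγ.le hc₂ (by linarith) (sq_nonneg _)) hup

end

/-! ### Existence of the principal eigenfunction -/

open BoundedContinuousFunction in
/-- An integral operator whose kernel is close to `1` has a positive eigenfunction. -/
lemma exists_positive_eigenfunction {X : Type*} [TopologicalSpace X] [FirstCountableTopology X]
    [MeasurableSpace X] [BorelSpace X] [SecondCountableTopology X] [Nonempty X]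
    (μ : Measure X) [IsProbabilityMeasure μ] {k : X → X → ℝ}
    (hk : Continuous (Function.uncurry k)) (hk1 : ∀ x y, |k x y - 1| ≤ 1 / 8) :
    ∃ (ρ : ℝ) (Ψ : X → ℝ), 0 < ρ ∧ Continuous Ψ ∧ (∀ x, 1 / 2 ≤ Ψ x ∧ Ψ x ≤ 3 / 2) ∧
      ∫ x, Ψ x ∂μ = 1 ∧ ∀ x, ∫ y, k x y * Ψ y ∂μ = ρ * Ψ x := by
  have hkx : ∀ x, Continuous (k x) := fun x =>
    hk.comp (by fun_prop : Continuous fun y => (x, y))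
  have hfi : ∀ f : X →ᵇ ℝ, Integrable f μ := fun f => f.integrable μ
  have hhi : ∀ (f : X →ᵇ ℝ) x, Integrable (fun y => (k x y - 1) * f y) μ := fun f x =>
    (hfi f).bdd_mul (c := 1 / 8)
      (((hkx x).sub continuous_const).aestronglyMeasurable) (ae_of_all _ fun y => hk1 x y)
  have hhn : ∀ (f : X →ᵇ ℝ) x, ‖∫ y, (k x y - 1) * f y ∂μ‖ ≤ 1 / 8 * ‖f‖ := by
    intro f x
    have h := norm_integral_le_of_norm_le_const (μ := μ) (f := fun y => (k x y - 1) * f y)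
      (C := 1 / 8 * ‖f‖) (ae_of_all _ fun y => by
        rw [norm_mul]
        exact mul_le_mul (hk1 x y) (f.norm_coe_le_norm y) (norm_nonneg _) (by norm_num))
    simpa using h
  have hhc : ∀ f : X →ᵇ ℝ, Continuous fun x => ∫ y, (k x y - 1) * f y ∂μ := by
    intro f
    refine continuous_of_dominated (bound := fun _ => 1 / 8 * ‖f‖)
      (fun x => (hhi f x).aestronglyMeasurable) (fun x => ae_of_all _ fun y => ?_)
      (integrable_const _) (ae_of_all _ fun y => ?_)
    · rw [norm_mul]
      exact mul_le_mul (hk1 x y) (f.norm_coe_le_norm y) (norm_nonneg _) (by norm_num)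
    · exact ((hk.comp (by fun_prop : Continuous fun x => (x, y))).sub continuous_const).mul
        continuous_const
  set H : (X →ᵇ ℝ) → (X →ᵇ ℝ) := fun f =>
    BoundedContinuousFunction.ofNormedAddCommGroup _ (hhc f) (1 / 8 * ‖f‖) (hhn f) with hH
  have hHn : ∀ f, ‖H f‖ ≤ 1 / 8 * ‖f‖ := fun f =>
    BoundedContinuousFunction.norm_ofNormedAddCommGroup_le _ (by positivity) _
  have hHsub : ∀ f g, H f - H g = H (f - g) := by
    intro f g
    ext x
    simp only [hH, BoundedContinuousFunction.coe_sub, Pi.sub_apply,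
      BoundedContinuousFunction.coe_ofNormedAddCommGroup]
    rw [← integral_sub (hhi f x) (hhi g x)]
    refine integral_congr_ae (ae_of_all _ fun y => ?_)
    simp only
    ring
  set A : (X →ᵇ ℝ) → ℝ := fun f => ∫ x, f x ∂μ with hA
  have hAn : ∀ f, |A f| ≤ ‖f‖ := fun f => by
    have h := norm_integral_le_of_norm_le_const (μ := μ) (f := f)
      (C := ‖f‖) (ae_of_all _ fun y => f.norm_coe_le_norm y)
    simpa using h
  have hAsub : ∀ f g, A f - A g = A (f - g) := fun f g => by
    simp only [hA, BoundedContinuousFunction.coe_sub, Pi.sub_apply]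
    rw [integral_sub (hfi f) (hfi g)]
  -- With $k=1+(k-1)$, `H` the operator with kernel $k-1$ and `A` the mean, a normalized
  -- eigenfunction satisfies $1+Hf=\rho f$, and integration forces $\rho=1+A(Hf)$. The fixed points
  -- of `T` are the solutions of this equation.
  set T : (X →ᵇ ℝ) → (X →ᵇ ℝ) := fun f => 1 + H f - A (H f) • f with hT
  set s : Set (X →ᵇ ℝ) := Metric.closedBall 1 (1 / 2) with hs
  have hone : ‖(1 : X →ᵇ ℝ)‖ ≤ 1 := by simp
  have hsn : ∀ f ∈ s, ‖f‖ ≤ 3 / 2 := by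
    intro f hf
    have h1 : ‖f - 1‖ ≤ 1 / 2 := by simpa [hs, dist_eq_norm] using hf
    have h2 := norm_add_le (f - 1) 1
    rw [sub_add_cancel] at h2
    linarith
  have hmaps : Set.MapsTo T s s := by
    intro f hf
    have hf' := hsn f hf
    have h1 := hHn f
    have h2 := hAn (H f)
    have h3 : T f - 1 = H f - A (H f) • f := by simp only [hT]; abel
    rw [hs, Metric.mem_closedBall, dist_eq_norm, h3]
    refine (norm_sub_le _ _).trans ?_
    rw [norm_smul, Real.norm_eq_abs]
    -- On the ball $\|f\|\le3/2$, so $\|Hf\|\le3/16$, and $3/16+9/32<1/2$. The Lipschitz constant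
    -- below is $1/8+3/16+3/16=1/2$.
    have h4 : |A (H f)| * ‖f‖ ≤ 3 / 16 * (3 / 2) :=
      mul_le_mul (by linarith) hf' (norm_nonneg _) (by norm_num)
    linarith
  have hlip : ∀ f ∈ s, ∀ g ∈ s, dist (T f) (T g) ≤ 1 / 2 * dist f g := by
    intro f hf g hg
    have hf' := hsn f hf
    have hg' := hsn g hg
    have h0 : T f - T g = H (f - g) - (A (H (f - g)) • f + A (H g) • (f - g)) := by
      rw [← hHsub, ← hAsub]
      simp only [hT]
      module
    rw [dist_eq_norm, dist_eq_norm, h0]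
    have h1 := hHn (f - g)
    have h2 := hAn (H (f - g))
    have h3 := hAn (H g)
    have h4 := hHn g
    refine (norm_sub_le _ _).trans ?_
    have h5 := norm_add_le (A (H (f - g)) • f) (A (H g) • (f - g))
    rw [norm_smul, norm_smul, Real.norm_eq_abs, Real.norm_eq_abs] at h5
    have h6 : |A (H (f - g))| * ‖f‖ ≤ (1 / 8 * ‖f - g‖) * (3 / 2) :=
      mul_le_mul (by linarith) hf' (norm_nonneg _) (by positivity)
    have h7 : |A (H g)| * ‖f - g‖ ≤ 3 / 16 * ‖f - g‖ :=
      mul_le_mul_of_nonneg_right (by linarith) (norm_nonneg _)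
    have h8 := norm_nonneg (f - g)
    linarith
  have hcontr : ContractingWith (1 / 2 : ℝ≥0) (Set.MapsTo.restrict T s s hmaps) := by
    refine ⟨by rw [← NNReal.coe_lt_coe]; norm_num, LipschitzWith.of_dist_le_mul fun f g => ?_⟩
    have := hlip f.1 f.2 g.1 g.2
    simp only [NNReal.coe_div, NNReal.coe_one, NNReal.coe_ofNat]
    exact this
  obtain ⟨f, hfs, hfix, -⟩ := hcontr.exists_fixedPoint' Metric.isClosed_closedBall.isComplete hmaps
    (x := 1) (by simp [hs]) (edist_ne_top _ _)
  have hfx : ∀ x, f x = 1 + H f x - A (H f) * f x := fun x => by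
    have := congrArg (fun g : X →ᵇ ℝ => g x) hfix
    simpa [hT] using this.symm
  have hAH : |A (H f)| ≤ 3 / 16 := by
    have := hsn f hfs
    have := hHn f
    linarith [hAn (H f)]
  have hρ : 0 < 1 + A (H f) := by linarith [(abs_le.1 hAH).1]
  -- Mass one is not imposed on the ball; it follows by integrating the fixed-point equation, since
  -- $\rho=1+A(Hf)\ne0$.
  have hmass : A f = 1 := by
    have h1 : A f = 1 + A (H f) - A (H f) * A f := by
      have h2 : A f = ∫ x, (1 + H f x - A (H f) * f x) ∂μ := integral_congr_ae (ae_of_all _ hfx)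
      have h3 : Integrable (fun x => 1 + H f x) μ := (integrable_const _).add (hfi _)
      rw [integral_sub h3 ((hfi f).const_mul _), integral_add (integrable_const _) (hfi _),
        integral_const_mul] at h2
      simpa using h2
    have h2 : (1 + A (H f)) * (A f - 1) = 0 := by linarith
    rcases mul_eq_zero.1 h2 with h | h <;> linarith
  refine ⟨1 + A (H f), f, hρ, f.continuous, fun x => ?_, hmass, fun x => ?_⟩
  · have h1 : ‖f - 1‖ ≤ 1 / 2 := by simpa [hs, dist_eq_norm] using hfs
    have h2 := (f - 1).norm_coe_le_norm x
    simp only [BoundedContinuousFunction.coe_sub, BoundedContinuousFunction.coe_one, Pi.sub_apply,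
      Pi.one_apply, Real.norm_eq_abs] at h2
    have h3 := abs_le.1 (h2.trans h1)
    constructor <;> linarith [h3.1, h3.2]
  · have h1 : ∀ y, k x y * f y = f y + (k x y - 1) * f y := fun y => by ring
    simp_rw [h1]
    rw [integral_add (hfi f) (hhi f x)]
    have h2 : ∫ y, f y ∂μ = 1 := hmass
    have h3 : ∫ y, (k x y - 1) * f y ∂μ = H f x := rfl
    rw [h2, h3]
    linarith [hfx x]

/-! ### Bounds on the tilted measure and on the transition density -/

section Interaction

variable {W : Measure Path} {R : ℝ → Plane → ℝ} {a b M : ℝ}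

lemma abs_integral_integral_le {F : unitInterval → unitInterval → ℝ} (hF : ∀ s u, |F s u| ≤ M) :
    |∫ s, ∫ u, F s u| ≤ M := by
  have h1 : ∀ s, |∫ u, F s u| ≤ M := fun s => by
    have := norm_integral_le_of_norm_le_const (μ := (volume : Measure unitInterval)) (f := F s)
      (C := M) (ae_of_all _ fun u => hF s u)
    simpa using this
  have := norm_integral_le_of_norm_le_const (μ := (volume : Measure unitInterval))
    (f := fun s => ∫ u, F s u) (C := M) (ae_of_all _ h1)
  simpa using this

lemma continuous_integral_integral {X : Type*} [TopologicalSpace X] [FirstCountableTopology X]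
    {F : X → unitInterval → unitInterval → ℝ}
    (hF : Continuous fun p : X × unitInterval × unitInterval => F p.1 p.2.1 p.2.2)
    (hM : ∀ x s u, |F x s u| ≤ M) : Continuous fun x => ∫ s, ∫ u, F x s u := by
  have h1 : Continuous fun p : X × unitInterval => ∫ u, F p.1 p.2 u := by
    refine continuous_of_dominated (bound := fun _ => M)
      (fun p => (hF.comp (by fun_prop : Continuous fun u => (p.1, p.2, u))).aestronglyMeasurable)
      (fun p => ae_of_all _ fun u => hM _ _ _) (integrable_const _) (ae_of_all _ fun u => ?_)
    exact hF.comp (by fun_prop : Continuous fun p : X × unitInterval => (p.1, p.2, u))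
  refine continuous_of_dominated (bound := fun _ => M)
    (fun x => (h1.comp (by fun_prop : Continuous fun s => (x, s))).aestronglyMeasurable)
    (fun x => ae_of_all _ fun s => ?_) (integrable_const _) (ae_of_all _ fun s => ?_)
  · have := norm_integral_le_of_norm_le_const (μ := (volume : Measure unitInterval)) (f := F x s)
      (C := M) (ae_of_all _ fun u => hM x s u)
    simpa using this
  · exact h1.comp (by fun_prop : Continuous fun x : X => (x, s))

lemma continuous_path_eval : Continuous fun p : Path × unitInterval => p.1.1 p.2 :=
  continuous_eval.comp (by fun_prop : Continuous fun p : Path × unitInterval => (p.1.1, p.2))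

lemma measurable_path_eval (t : unitInterval) : Measurable fun x : Path => x.1 t :=
  (continuous_path_eval.comp (by fun_prop : Continuous fun x : Path => (x, t))).measurable

lemma continuous_selfInt (hR : Continuous (Function.uncurry R)) (hM : ∀ s y, |R s y| ≤ M) :
    Continuous (selfInt R) := by
  refine continuous_integral_integral (M := M)
    (F := fun (x : Path) s u => R ((s : ℝ) - (u : ℝ)) (x.1 s - x.1 u)) ?_ fun _ _ _ => hM _ _
  have h1 : Continuous fun p : Path × unitInterval × unitInterval => p.1.1 p.2.1 :=
    continuous_path_eval.comp
      (by fun_prop : Continuous fun p : Path × unitInterval × unitInterval => (p.1, p.2.1))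
  have h2 : Continuous fun p : Path × unitInterval × unitInterval => p.1.1 p.2.2 :=
    continuous_path_eval.comp
      (by fun_prop : Continuous fun p : Path × unitInterval × unitInterval => (p.1, p.2.2))
  exact hR.comp (f := fun p : Path × unitInterval × unitInterval =>
    ((p.2.1 : ℝ) - (p.2.2 : ℝ), p.1.1 p.2.1 - p.1.1 p.2.2)) (by fun_prop)

lemma continuous_crossInt (hR : Continuous (Function.uncurry R)) (hM : ∀ s y, |R s y| ≤ M) :
    Continuous (Function.uncurry (crossInt R a b)) := by
  refine continuous_const.mul (continuous_integral_integral (M := M)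
    (F := fun (p : Path × Path) s u => R (a + (s : ℝ) - (u : ℝ)) (p.2.1 s + p.1.1 1 - p.1.1 u)) ?_
    fun _ _ _ => hM _ _)
  have h1 : Continuous fun p : (Path × Path) × unitInterval × unitInterval => p.1.2.1 p.2.1 :=
    continuous_path_eval.comp (by fun_prop : Continuous
      fun p : (Path × Path) × unitInterval × unitInterval => (p.1.2, p.2.1))
  have h2 : Continuous fun p : (Path × Path) × unitInterval × unitInterval => p.1.1.1 p.2.2 :=
    continuous_path_eval.comp (by fun_prop : Continuous
      fun p : (Path × Path) × unitInterval × unitInterval => (p.1.1, p.2.2))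
  have h3 : Continuous fun p : (Path × Path) × unitInterval × unitInterval => p.1.1.1 1 :=
    continuous_path_eval.comp (by fun_prop : Continuous
      fun p : (Path × Path) × unitInterval × unitInterval => (p.1.1, (1 : unitInterval)))
  exact hR.comp (f := fun p : (Path × Path) × unitInterval × unitInterval =>
    (a + (p.2.1 : ℝ) - (p.2.2 : ℝ), p.1.2.1 p.2.1 + p.1.1.1 1 - p.1.1.1 p.2.2)) (by fun_prop)

lemma abs_selfInt_le (hM : ∀ s y, |R s y| ≤ M) (x : Path) : |selfInt R x| ≤ M :=
  abs_integral_integral_le fun _ _ => hM _ _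

lemma abs_crossInt_le (hM : ∀ s y, |R s y| ≤ M) (x y : Path) : |crossInt R a b x y| ≤ |b| * M := by
  rw [crossInt, abs_mul]
  exact mul_le_mul_of_nonneg_left (abs_integral_integral_le fun _ _ => hM _ _) (abs_nonneg _)

/-- The density of the tilted measure with respect to the Wiener measure. -/
def tiltDensity (W : Measure Path) (R : ℝ → Plane → ℝ) (b : ℝ) (x : Path) : ℝ :=
  Real.exp (b / 2 * selfInt R x - zeta W R b)

lemma continuous_tiltDensity (hR : Continuous (Function.uncurry R)) (hM : ∀ s y, |R s y| ≤ M) :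
    Continuous (tiltDensity W R b) := by
  have := continuous_selfInt hR hM
  unfold tiltDensity
  fun_prop

lemma exp_selfInt_bounds (hM : ∀ s y, |R s y| ≤ M) (x : Path) :
    Real.exp (-(|b| * M / 2)) ≤ Real.exp (b / 2 * selfInt R x) ∧
      Real.exp (b / 2 * selfInt R x) ≤ Real.exp (|b| * M / 2) := by
  have h1 : |b / 2 * selfInt R x| ≤ |b| * M / 2 := by
    rw [abs_mul, abs_div, abs_of_pos (zero_lt_two' ℝ)]
    have := mul_le_mul_of_nonneg_left (abs_selfInt_le hM x) (abs_nonneg b)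
    linarith
  exact ⟨Real.exp_le_exp.2 (abs_le.1 h1).1, Real.exp_le_exp.2 (abs_le.1 h1).2⟩

variable [IsProbabilityMeasure W]

lemma integrable_of_continuous_bounded {X : Type*} [TopologicalSpace X] [MeasurableSpace X]
    [OpensMeasurableSpace X] {μ : Measure X} [IsFiniteMeasure μ] {f : X → ℝ} (hf : Continuous f)
    {C : ℝ} (h : ∀ x, |f x| ≤ C) : Integrable f μ :=
  Integrable.of_bound hf.measurable.aestronglyMeasurable C (ae_of_all _ h)

lemma integrable_exp_selfInt (hR : Continuous (Function.uncurry R)) (hM : ∀ s y, |R s y| ≤ M) :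
    Integrable (fun x => Real.exp (b / 2 * selfInt R x)) W := by
  have := continuous_selfInt hR hM
  refine integrable_of_continuous_bounded (C := Real.exp (|b| * M / 2)) (by fun_prop) fun x => ?_
  rw [abs_of_nonneg (Real.exp_nonneg _)]
  exact (exp_selfInt_bounds hM x).2

lemma exp_zeta (hR : Continuous (Function.uncurry R)) (hM : ∀ s y, |R s y| ≤ M) :
    Real.exp (zeta W R b) = ∫ x, Real.exp (b / 2 * selfInt R x) ∂W ∧
      Real.exp (-(|b| * M / 2)) ≤ Real.exp (zeta W R b) ∧
      Real.exp (zeta W R b) ≤ Real.exp (|b| * M / 2) := by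
  have hi := integrable_exp_selfInt (W := W) (b := b) hR hM
  have h1 : Real.exp (-(|b| * M / 2)) ≤ ∫ x, Real.exp (b / 2 * selfInt R x) ∂W := by
    have := integral_mono (integrable_const _) hi fun x => (exp_selfInt_bounds hM x).1
    simpa using this
  have h2 : ∫ x, Real.exp (b / 2 * selfInt R x) ∂W ≤ Real.exp (|b| * M / 2) := by
    have := integral_mono hi (integrable_const _) fun x => (exp_selfInt_bounds hM x).2
    simpa using this
  have h3 : Real.exp (zeta W R b) = ∫ x, Real.exp (b / 2 * selfInt R x) ∂W := by
    rw [zeta, Real.exp_log ((Real.exp_pos _).trans_le h1)]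
  exact ⟨h3, h3 ▸ h1, h3 ▸ h2⟩

lemma tiltDensity_bounds (hR : Continuous (Function.uncurry R)) (hM : ∀ s y, |R s y| ≤ M)
    (x : Path) : Real.exp (-(|b| * M)) ≤ tiltDensity W R b x ∧
      tiltDensity W R b x ≤ Real.exp (|b| * M) := by
  obtain ⟨-, h1, h2⟩ := exp_zeta (W := W) (b := b) hR hM
  obtain ⟨h3, h4⟩ := exp_selfInt_bounds (b := b) hM x
  rw [Real.exp_le_exp] at h1 h2 h3 h4
  rw [tiltDensity, Real.exp_le_exp, Real.exp_le_exp]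
  constructor <;> linarith

lemma tiltedWiener_prob (hR : Continuous (Function.uncurry R)) (hM : ∀ s y, |R s y| ≤ M) :
    IsProbabilityMeasure (tiltedWiener W R b) := by
  constructor
  rw [tiltedWiener, withDensity_apply _ MeasurableSet.univ, Measure.restrict_univ]
  simp_rw [Real.exp_sub]
  have hi := integrable_exp_selfInt (W := W) (b := b) hR hM
  rw [← ofReal_integral_eq_lintegral_ofReal (hi.div_const _)
    (ae_of_all _ fun x => by positivity), integral_div, ← (exp_zeta (W := W) (b := b) hR hM).1,
    div_self (Real.exp_ne_zero _), ENNReal.ofReal_one]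

instance : Nonempty Path := ⟨⟨0, rfl⟩⟩

lemma exp_crossInt_bounds (hM : ∀ s y, |R s y| ≤ M) (x y : Path) :
    Real.exp (-(|b| * M)) ≤ Real.exp (crossInt R a b x y) ∧
      Real.exp (crossInt R a b x y) ≤ Real.exp (|b| * M) := by
  have h := abs_le.1 (abs_crossInt_le (a := a) (b := b) hM x y)
  exact ⟨Real.exp_le_exp.2 h.1, Real.exp_le_exp.2 h.2⟩

/-- The contraction argument gives a positive eigenfunction. Its eigenvalue is the largest by
comparison: if `s` is the least constant with $|f|\le s\Psi$, applying the positive operator gives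
$|r|\,|f|\le\rho s\Psi$, hence $|r|\le\rho$. -/
lemma exists_isPrincipalEigenpair (hR : Continuous (Function.uncurry R))
    (hM : ∀ s y, |R s y| ≤ M) (hb : |b| * M ≤ 1 / 16) :
    ∃ p : ℝ × (Path → ℝ), IsPrincipalEigenpair W R a b p.1 p.2 := by
  have hprob := tiltedWiener_prob (W := W) (b := b) hR hM
  have hc := continuous_crossInt (a := a) (b := b) hR hM
  have hcx : ∀ x, Continuous fun y => Real.exp (crossInt R a b x y) := fun x =>
    Real.continuous_exp.comp (hc.comp (by fun_prop : Continuous fun y : Path => (x, y)))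
  have hsmall : ∀ x y, |Real.exp (crossInt R a b x y) - 1| ≤ 1 / 8 := by
    intro x y
    have h1 := abs_crossInt_le (a := a) (b := b) hM x y
    -- From $|e^x-1|\le2|x|$: the hypothesis `1 / 16` yields the `1 / 8` of the contraction.
    have h2 := Real.abs_exp_sub_one_le (x := crossInt R a b x y) (by linarith)
    linarith
  obtain ⟨ρ, Ψ, hρ, hΨc, hΨb, hΨ1, hΨe⟩ := exists_positive_eigenfunction
    (tiltedWiener W R b) (k := fun x y => Real.exp (crossInt R a b x y))
    (Real.continuous_exp.comp hc) hsmall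
  refine ⟨(ρ, Ψ), hρ, hΨc.measurable, ⟨1 / 2, 3 / 2, by norm_num, hΨb⟩, hΨ1, hΨe, ?_⟩
  rintro r f hfm ⟨C, hC⟩ hf0 hfe
  have hΨpos : ∀ x, 0 < Ψ x := fun x => by linarith [(hΨb x).1]
  have hC0 : 0 ≤ C := (abs_nonneg _).trans (hC ⟨0, rfl⟩)
  have hbdd : BddAbove (Set.range fun x => |f x| / Ψ x) := by
    refine ⟨C / (1 / 2), ?_⟩
    rintro _ ⟨x, rfl⟩
    exact div_le_div₀ hC0 (hC x) (by norm_num) (hΨb x).1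
  set s := ⨆ x, |f x| / Ψ x with hs
  have hle : ∀ x, |f x| ≤ s * Ψ x := fun x => by
    rw [← div_le_iff₀ (hΨpos x)]
    exact le_ciSup hbdd x
  have hs0 : 0 < s := by
    by_contra hneg
    refine hf0 (funext fun x => ?_)
    have := hle x
    have h2 : s * Ψ x ≤ 0 := mul_nonpos_of_nonpos_of_nonneg (not_lt.1 hneg) (hΨpos x).le
    exact abs_nonpos_iff.1 (this.trans h2)
  have hint : ∀ {g : Path → ℝ} {D : ℝ}, Measurable g → (∀ x, |g x| ≤ D) → ∀ x,
      Integrable (fun y => Real.exp (crossInt R a b x y) * g y) (tiltedWiener W R b) := by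
    intro g D hg hD x
    refine (Integrable.of_bound hg.aestronglyMeasurable D (ae_of_all _ hD)).bdd_mul
      (c := Real.exp (|b| * M)) (hcx x).measurable.aestronglyMeasurable (ae_of_all _ fun y => ?_)
    rw [Real.norm_of_nonneg (Real.exp_nonneg _)]
    exact (exp_crossInt_bounds hM x y).2
  have hΨi := hint (g := Ψ) (D := 3 / 2) hΨc.measurable
    fun x => by rw [abs_of_pos (hΨpos x)]; exact (hΨb x).2
  have hkey : ∀ x, |r| * (|f x| / Ψ x) ≤ ρ * s := by
    intro x
    have h1 : |r * f x| ≤ ∫ y, Real.exp (crossInt R a b x y) * |f y| ∂(tiltedWiener W R b) := by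
      rw [← hfe x, ← Real.norm_eq_abs]
      refine (norm_integral_le_integral_norm _).trans (le_of_eq ?_)
      refine integral_congr_ae (ae_of_all _ fun y => ?_)
      simp
    have h2 : ∫ y, Real.exp (crossInt R a b x y) * |f y| ∂(tiltedWiener W R b) ≤
        ∫ y, s * (Real.exp (crossInt R a b x y) * Ψ y) ∂(tiltedWiener W R b) := by
      refine integral_mono (hint (g := fun y => |f y|) (D := C) (by fun_prop)
        (fun y => by rw [abs_abs]; exact hC y) x) ((hΨi x).const_mul s) fun y => ?_
      have := mul_le_mul_of_nonneg_left (hle y) (Real.exp_nonneg (crossInt R a b x y))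
      simp only
      linarith
    rw [integral_const_mul, hΨe x] at h2
    rw [abs_mul] at h1
    rw [← mul_div_assoc, div_le_iff₀ (hΨpos x)]
    linarith
  have h3 : |r| * s ≤ ρ * s := by
    rw [hs, Real.mul_iSup_of_nonneg (abs_nonneg r)]
    exact ciSup_le hkey
  exact (le_abs_self r).trans (le_of_mul_le_mul_right h3 hs0)

/-- Existence alone justifies the choice made in `eigenpair`. All later bounds hold for any
principal eigenpair, so uniqueness plays no role. -/
lemma eigenpair_spec (hR : Continuous (Function.uncurry R)) (hM : ∀ s y, |R s y| ≤ M)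
    (hb : |b| * M ≤ 1 / 16) :
    IsPrincipalEigenpair W R a b (eigenpair W R a b).1 (eigenpair W R a b).2 :=
  Classical.epsilon_spec (p := fun p : ℝ × (Path → ℝ) => IsPrincipalEigenpair W R a b p.1 p.2)
    (exists_isPrincipalEigenpair hR hM hb)

/-- The density of the transition probability with respect to the Wiener measure. -/
def transDensity (W : Measure Path) (R : ℝ → Plane → ℝ) (a b : ℝ) (x y : Path) : ℝ :=
  tiltDensity W R b y * (Real.exp (crossInt R a b x y) * (eigenpair W R a b).2 y /
      ((eigenpair W R a b).1 * (eigenpair W R a b).2 x))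

lemma measurable_transDensity (hR : Continuous (Function.uncurry R)) (hM : ∀ s y, |R s y| ≤ M)
    (hb : |b| * M ≤ 1 / 16) : Measurable (Function.uncurry (transDensity W R a b)) := by
  have h1 := (eigenpair_spec (W := W) (a := a) hR hM hb).measurable
  have h2 : Measurable (Function.uncurry (crossInt R a b)) := (continuous_crossInt hR hM).measurable
  have h3 : Measurable (tiltDensity W R b) := (continuous_tiltDensity hR hM).measurable
  unfold transDensity Function.uncurry
  have h4 : Measurable fun p : Path × Path => crossInt R a b p.1 p.2 := h2
  fun_prop

lemma transition_eq (hR : Continuous (Function.uncurry R)) (hM : ∀ s y, |R s y| ≤ M)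
    (hb : |b| * M ≤ 1 / 16) (x : Path) :
    transition W R a b x = W.withDensity fun y => ENNReal.ofReal (transDensity W R a b x y) := by
  have h1 := (eigenpair_spec (W := W) (a := a) hR hM hb).measurable
  have h2 : Measurable fun y => crossInt R a b x y :=
    ((continuous_crossInt hR hM).comp (by fun_prop : Continuous fun y : Path => (x, y))).measurable
  have h3 : Measurable (tiltDensity W R b) := (continuous_tiltDensity hR hM).measurable
  have h4 : Measurable fun y => Real.exp (b / 2 * selfInt R y - zeta W R b) := h3
  rw [transition, tiltedWiener, ← withDensity_mul _ (by fun_prop) (by fun_prop)]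
  congr 1
  funext y
  rw [Pi.mul_apply, ← ENNReal.ofReal_mul (Real.exp_nonneg _)]
  rfl

/-- Since $\Psi$ has mass one, $\rho\Psi(x)=\int e^{I(x,y)}\Psi(y)\,\hat{\mathbb P}(dy)$ lies
between the extreme values allowed for $e^I$. Integrating in $x$ gives the same bounds for $\rho$.
-/
lemma eigen_bounds (hR : Continuous (Function.uncurry R)) (hM : ∀ s y, |R s y| ≤ M)
    (hb : |b| * M ≤ 1 / 16) :
    (Real.exp (-(|b| * M)) ≤ (eigenpair W R a b).1 ∧ (eigenpair W R a b).1 ≤ Real.exp (|b| * M)) ∧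
    ∀ x, Real.exp (-(|b| * M)) ≤ (eigenpair W R a b).1 * (eigenpair W R a b).2 x ∧
      (eigenpair W R a b).1 * (eigenpair W R a b).2 x ≤ Real.exp (|b| * M) := by
  have h := eigenpair_spec (W := W) (a := a) hR hM hb
  have hprob := tiltedWiener_prob (W := W) (b := b) hR hM
  set ρ := (eigenpair W R a b).1
  set Ψ := (eigenpair W R a b).2
  obtain ⟨c, C, hc, hΨ⟩ := h.bounds
  have hΨ0 : ∀ x, 0 < Ψ x := fun x => hc.trans_le (hΨ x).1
  have hΨi : Integrable Ψ (tiltedWiener W R b) :=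
    Integrable.of_bound h.measurable.aestronglyMeasurable C
      (ae_of_all _ fun x => by rw [Real.norm_of_nonneg (hΨ0 x).le]; exact (hΨ x).2)
  have hcx : ∀ x, Continuous fun y => Real.exp (crossInt R a b x y) := fun x =>
    Real.continuous_exp.comp ((continuous_crossInt hR hM).comp
      (by fun_prop : Continuous fun y : Path => (x, y)))
  have hki : ∀ x, Integrable (fun y => Real.exp (crossInt R a b x y) * Ψ y)
      (tiltedWiener W R b) := fun x =>
    hΨi.bdd_mul (c := Real.exp (|b| * M)) (hcx x).measurable.aestronglyMeasurable
      (ae_of_all _ fun y => by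
        rw [Real.norm_of_nonneg (Real.exp_nonneg _)]
        exact (exp_crossInt_bounds hM x y).2)
  have h2 : ∀ x, Real.exp (-(|b| * M)) ≤ ρ * Ψ x ∧ ρ * Ψ x ≤ Real.exp (|b| * M) := by
    intro x
    rw [← h.eigen x]
    have hl := integral_mono (hΨi.const_mul (Real.exp (-(|b| * M)))) (hki x) fun y =>
      mul_le_mul_of_nonneg_right (exp_crossInt_bounds (a := a) hM x y).1 (hΨ0 y).le
    have hu := integral_mono (hki x) (hΨi.const_mul (Real.exp (|b| * M))) fun y =>
      mul_le_mul_of_nonneg_right (exp_crossInt_bounds (a := a) hM x y).2 (hΨ0 y).le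
    rw [integral_const_mul, h.mass_one, mul_one] at hl hu
    exact ⟨hl, hu⟩
  have hl := integral_mono (integrable_const _) (hΨi.const_mul ρ) fun x => (h2 x).1
  have hu := integral_mono (hΨi.const_mul ρ) (integrable_const _) fun x => (h2 x).2
  rw [integral_const_mul, h.mass_one, mul_one] at hl hu
  simp only [integral_const, probReal_univ, one_smul] at hl hu
  exact ⟨⟨hl, hu⟩, h2⟩

lemma transDensity_bounds (hR : Continuous (Function.uncurry R)) (hM : ∀ s y, |R s y| ≤ M)
    (hb : |b| * M ≤ 1 / 16) (x y : Path) :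
    Real.exp (-(5 * (|b| * M))) ≤ transDensity W R a b x y ∧
      transDensity W R a b x y ≤ Real.exp (5 * (|b| * M)) := by
  set θ := |b| * M with hθ
  obtain ⟨⟨r1, r2⟩, hρΨ⟩ := eigen_bounds (W := W) (a := a) hR hM hb
  obtain ⟨x1, x2⟩ := hρΨ x
  obtain ⟨y1, y2⟩ := hρΨ y
  obtain ⟨t1, t2⟩ := tiltDensity_bounds (W := W) (b := b) hR hM y
  obtain ⟨k1, k2⟩ := exp_crossInt_bounds (a := a) (b := b) hM x y
  rw [← hθ] at *
  have inv : ∀ u : ℝ, Real.exp (-θ) ≤ u → u ≤ Real.exp θ →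
      Real.exp (-θ) ≤ u⁻¹ ∧ u⁻¹ ≤ Real.exp θ := by
    intro u h1 h2
    have h0 : 0 < u := (Real.exp_pos _).trans_le h1
    constructor
    · rw [Real.exp_neg]; exact inv_anti₀ h0 h2
    · rw [← neg_neg θ, Real.exp_neg]; exact inv_anti₀ (Real.exp_pos _) h1
  obtain ⟨ri1, ri2⟩ := inv _ r1 r2
  obtain ⟨xi1, xi2⟩ := inv _ x1 x2
  have hρ : (eigenpair W R a b).1 ≠ 0 := ((Real.exp_pos _).trans_le r1).ne'
  -- Inserting $\rho/\rho$ writes the density as five factors, each between $e^{-\theta}$ and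
  -- $e^\theta$.
  have e : transDensity W R a b x y = tiltDensity W R b y * Real.exp (crossInt R a b x y) *
      ((eigenpair W R a b).1 * (eigenpair W R a b).2 y) * ((eigenpair W R a b).1)⁻¹ *
      ((eigenpair W R a b).1 * (eigenpair W R a b).2 x)⁻¹ := by
    rw [transDensity]
    field_simp
  have e1 : Real.exp (-(5 * θ)) = Real.exp (-θ) * Real.exp (-θ) * Real.exp (-θ) *
      Real.exp (-θ) * Real.exp (-θ) := by
    simp only [← Real.exp_add]; ring_nf
  have e2 : Real.exp (5 * θ) = Real.exp θ * Real.exp θ * Real.exp θ *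
      Real.exp θ * Real.exp θ := by
    simp only [← Real.exp_add]; ring_nf
  have p0 := Real.exp_pos (-θ)
  rw [e, e1, e2]
  have t0 := p0.trans_le t1
  have y0 := p0.trans_le y1
  have x0 := p0.trans_le xi1
  have r0 := p0.trans_le ri1
  constructor <;> gcongr

lemma lintegral_transDensity (hR : Continuous (Function.uncurry R)) (hM : ∀ s y, |R s y| ≤ M)
    (hb : |b| * M ≤ 1 / 16) (x : Path) :
    ∫⁻ y, ENNReal.ofReal (transDensity W R a b x y) ∂W = 1 := by
  have h := eigenpair_spec (W := W) (a := a) hR hM hb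
  have hprob := tiltedWiener_prob (W := W) (b := b) hR hM
  have h1 := h.eigen x
  obtain ⟨c, C, hc, hΨ⟩ := h.bounds
  have hΨ0 : ∀ x, 0 < (eigenpair W R a b).2 x := fun x => hc.trans_le (hΨ x).1
  have hρ := h.eigenvalue_pos
  have h2 : transition W R a b x Set.univ =
      ∫⁻ y, ENNReal.ofReal (transDensity W R a b x y) ∂W := by
    rw [transition_eq hR hM hb, withDensity_apply _ MeasurableSet.univ, Measure.restrict_univ]
  have hcx : Continuous fun y => Real.exp (crossInt R a b x y) :=
    Real.continuous_exp.comp ((continuous_crossInt hR hM).comp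
      (by fun_prop : Continuous fun y : Path => (x, y)))
  have hki : Integrable (fun y => Real.exp (crossInt R a b x y) * (eigenpair W R a b).2 y)
      (tiltedWiener W R b) :=
    (Integrable.of_bound h.measurable.aestronglyMeasurable C
      (ae_of_all _ fun x => by rw [Real.norm_of_nonneg (hΨ0 x).le]; exact (hΨ x).2)).bdd_mul
      (c := Real.exp (|b| * M)) hcx.measurable.aestronglyMeasurable
      (ae_of_all _ fun y => by
        rw [Real.norm_of_nonneg (Real.exp_nonneg _)]
        exact (exp_crossInt_bounds hM x y).2)
  rw [← h2, transition, withDensity_apply _ MeasurableSet.univ, Measure.restrict_univ,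
    ← ofReal_integral_eq_lintegral_ofReal (hki.div_const _) (ae_of_all _ fun y => by
      have := hΨ0 y
      have := hΨ0 x
      positivity), integral_div, h1, div_self (mul_pos hρ (hΨ0 x)).ne', ENNReal.ofReal_one]

end Interaction

/-! ### Increments of a pair and measurability of the observed vector -/

/-- The difference of the displacements of two paths. -/
def incr (p : Path × Path) : Plane := p.1.1 1 - p.2.1 1

lemma measurable_incr : Measurable incr :=
  ((measurable_path_eval 1).comp measurable_fst).sub ((measurable_path_eval 1).comp measurable_snd)

lemma charFun_gaussian (c : ℝ) (hc : 0 ≤ c) (ξ : Plane) :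
    charFun (multivariateGaussian 0 (c • (1 : Matrix (Fin 2) (Fin 2) ℝ)) : Measure Plane) ξ =
      (Real.exp (-(c * ‖ξ‖ ^ 2) / 2) : ℝ) := by
  have hS : (c • (1 : Matrix (Fin 2) (Fin 2) ℝ)).PosSemidef := Matrix.PosSemidef.one.smul hc
  rw [charFun_multivariateGaussian hS, EuclideanSpace.norm_sq_eq]
  simp only [inner_zero_right, Complex.ofReal_zero, zero_mul, zero_sub, Matrix.smul_mulVec,
    Matrix.one_mulVec, Complex.ofReal_exp]
  congr 1
  simp [dotProduct, Fin.sum_univ_two]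
  ring

/-- The endpoints are independent standard Gaussian vectors, and the product of their characteristic
functions is $e^{-|\xi|^2}$. -/
lemma map_incr_eq {W : Measure Path} [IsProbabilityMeasure W] (hW : IsWienerMeasure W) :
    (W.prod W).map incr = heatMeasure := by
  have hprob : IsProbabilityMeasure ((W.prod W).map incr) :=
    Measure.isProbabilityMeasure_map measurable_incr.aemeasurable
  have hX := measurable_path_eval 1
  have hlaw : W.map (fun x : Path => x.1 1) =
      multivariateGaussian 0 ((1 : ℝ) • (1 : Matrix (Fin 2) (Fin 2) ℝ)) := by
    have h := (hW.law_increment 0 1 zero_le_one).map_eq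
    have e : (fun x : Path => x.1 1 - x.1 0) = fun x : Path => x.1 1 := by
      funext x; rw [x.2, sub_zero]
    rw [e] at h
    simpa using h
  have hchar : ∀ ξ, ∫ x : Path, Complex.exp ((inner ℝ (x.1 1) ξ : ℝ) * Complex.I) ∂W =
      (Real.exp (-(‖ξ‖ ^ 2) / 2) : ℝ) := by
    intro ξ
    have h := charFun_gaussian 1 zero_le_one ξ
    rw [← hlaw, charFun_apply, integral_map hX.aemeasurable (by fun_prop), one_mul] at h
    exact h
  refine eq_heatMeasure fun ξ => ?_
  rw [charFun_apply, integral_map measurable_incr.aemeasurable (by fun_prop)]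
  have e : ∀ p : Path × Path, Complex.exp ((inner ℝ (incr p) ξ : ℝ) * Complex.I) =
      Complex.exp ((inner ℝ (p.1.1 1) ξ : ℝ) * Complex.I) *
      Complex.exp ((inner ℝ (p.2.1 1) (-ξ) : ℝ) * Complex.I) := by
    intro p
    rw [← Complex.exp_add, incr, inner_sub_left, inner_neg_right]
    congr 1
    push_cast
    ring
  simp_rw [e]
  rw [integral_prod_mul (fun x : Path => Complex.exp ((inner ℝ (x.1 1) ξ : ℝ) * Complex.I))
    (fun x : Path => Complex.exp ((inner ℝ (x.1 1) (-ξ) : ℝ) * Complex.I)), hchar, hchar, norm_neg,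
    ← Complex.ofReal_mul, ← Real.exp_add]
  congr 2
  ring

lemma gluedPath_natCast (x : ℕ → Path) (n : ℕ) :
    gluedPath x (n : ℝ≥0) = ∑ j ∈ Finset.range n, (x j).1 1 := by
  rw [gluedPath, Nat.floor_natCast]
  have h : (⟨Int.fract (((n : ℝ≥0) : ℝ)), Int.fract_nonneg _, (Int.fract_lt_one _).le⟩ :
      unitInterval) = 0 := by
    ext; simp
  rw [h, (x n).2, add_zero]

lemma regenDiff_eq_sum (k : ℕ) (τ : ℕ → State) :
    regenDiff k τ = ∑ j ∈ Finset.range (regenTime (fun j => (τ j).1) k), incr (τ j).2 := by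
  rw [regenDiff, gluedPath_natCast, gluedPath_natCast, ← Finset.sum_sub_distrib]
  rfl

lemma measurable_sInf_nat {α : Type*} [MeasurableSpace α] {S : α → Set ℕ}
    (h : ∀ m, MeasurableSet {x | m ∈ S x}) : Measurable fun x => sInf (S x) := by
  refine measurable_to_countable' fun n => ?_
  -- The second set accounts for `sInf ∅ = 0`.
  have e : (fun x => sInf (S x)) ⁻¹' {n} = ({x | n ∈ S x} ∩ ⋂ m, ⋂ (_ : m < n), {x | m ∈ S x}ᶜ) ∪
      ({_x | n = 0} ∩ ⋂ m, {x | m ∈ S x}ᶜ) := by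
    ext x
    simp only [Set.mem_preimage, Set.mem_singleton_iff, Set.mem_union, Set.mem_inter_iff,
      Set.mem_ofPred_eq, Set.mem_iInter, Set.mem_compl_iff]
    constructor
    · rintro rfl
      rcases (S x).eq_empty_or_nonempty with h0 | h0
      · right; simp [h0]
      · left; exact ⟨Nat.sInf_mem h0, fun m hm => Nat.notMem_of_lt_sInf hm⟩
    · rintro (⟨h1, h2⟩ | ⟨rfl, h2⟩)
      · refine le_antisymm (Nat.sInf_le h1) (not_lt.1 fun hlt => ?_)
        exact h2 _ hlt (Nat.sInf_mem ⟨n, h1⟩)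
      · rw [Set.eq_empty_iff_forall_notMem.2 h2, Nat.sInf_empty]
  rw [e]
  exact ((h n).inter (MeasurableSet.iInter fun m => MeasurableSet.iInter fun _ => (h m).compl)).union
    ((MeasurableSet.const _).inter (MeasurableSet.iInter fun m => (h m).compl))

lemma measurable_regenTime (k : ℕ) : Measurable fun η : ℕ → Bool => regenTime η k := by
  induction k with
  | zero => exact measurable_const
  | succ k ih =>
    simp only [regenTime]
    refine measurable_sInf_nat fun m => MeasurableSet.inter ?_ ?_
    · exact ih (measurableSet_Iio (a := m))
    · exact measurableSet_eq_fun (measurable_pi_apply m) measurable_const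

lemma measurable_regenDiff (k : ℕ) : Measurable (regenDiff k) := by
  have h1 : Measurable fun τ : ℕ → State => regenTime (fun j => (τ j).1) k :=
    (measurable_regenTime k).comp (by fun_prop)
  have h2 : Measurable fun p : ℕ × (ℕ → State) => ∑ j ∈ Finset.range p.1, incr (p.2 j).2 := by
    refine measurable_from_prod_countable_right fun n => ?_
    have h : ∀ j, Measurable fun τ : ℕ → State => incr (τ j).2 := fun j =>
      measurable_incr.comp (measurable_snd.comp (measurable_pi_apply (X := fun _ : ℕ => State) j))
    exact Finset.measurable_sum (Finset.range n) fun j _ => h j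
  have e : regenDiff k = (fun p : ℕ × (ℕ → State) => ∑ j ∈ Finset.range p.1, incr (p.2 j).2) ∘
      fun τ => (regenTime (fun j => (τ j).1) k, τ) := funext fun τ => regenDiff_eq_sum k τ
  rw [e]
  exact h2.comp (h1.prodMk measurable_id)

/-! ### Continuity and boundedness of the noise correlation -/

section Noise

variable {φ : ℝ → ℝ} {ψ : Plane → ℝ}

lemma noiseCorr_spec (hφ_smooth : ContDiff ℝ ∞ φ) (hφ_supp : Function.support φ ⊆ Set.Icc 0 1)
    (hψ_smooth : ContDiff ℝ ∞ ψ) (hψ_supp : Function.support ψ ⊆ Metric.closedBall 0 (1 / 2)) :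
    Continuous (Function.uncurry (noiseCorr φ ψ)) ∧ ∃ M, ∀ s y, |noiseCorr φ ψ s y| ≤ M := by
  have hφc := hφ_smooth.continuous
  have hψc := hψ_smooth.continuous
  have hφs : HasCompactSupport φ := HasCompactSupport.of_support_subset_isCompact isCompact_Icc hφ_supp
  have hψs : HasCompactSupport ψ :=
    HasCompactSupport.of_support_subset_isCompact (isCompact_closedBall _ _) hψ_supp
  have hφnc : Continuous fun u => φ (-u) := by fun_prop
  have hφns : HasCompactSupport fun u => φ (-u) := hφs.comp_homeomorph (Homeomorph.neg ℝ)
  have h1 : Continuous (convolution φ (fun u => φ (-u)) (ContinuousLinearMap.mul ℝ ℝ) volume) :=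
    HasCompactSupport.continuous_convolution_left (μ := volume) (ContinuousLinearMap.mul ℝ ℝ)
      hφs hφc hφnc.locallyIntegrable
  have h2 : Continuous (convolution ψ ψ (ContinuousLinearMap.mul ℝ ℝ) volume) :=
    HasCompactSupport.continuous_convolution_left (μ := volume) (ContinuousLinearMap.mul ℝ ℝ)
      hψs hψc hψc.locallyIntegrable
  obtain ⟨C₁, hC₁⟩ := h1.bounded_above_of_compact_support (hφs.convolution _ hφns)
  obtain ⟨C₂, hC₂⟩ := h2.bounded_above_of_compact_support (hψs.convolution _ hψs)
  refine ⟨(h1.comp continuous_fst).mul (h2.comp continuous_snd), C₁ * C₂, fun s y => ?_⟩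
  rw [noiseCorr, abs_mul]
  exact mul_le_mul (hC₁ s) (hC₂ y) (abs_nonneg _) ((norm_nonneg _).trans (hC₁ s))

end Noise

/-! ### The residual kernel of the pair chain -/

section Residual

variable {W : Measure Path} [IsProbabilityMeasure W] {R : ℝ → Plane → ℝ} {a b γ M : ℝ}

/-- The density of the transition probability of a pair of paths. -/
def pairDensity (W : Measure Path) (R : ℝ → Plane → ℝ) (a b : ℝ) (z w : Path × Path) : ℝ :=
  transDensity W R a b z.1 w.1 * transDensity W R a b z.2 w.2

/-- The residual kernel `π̂ × π̂ - γ W × W`. -/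
def residualKernel (W : Measure Path) [IsProbabilityMeasure W] (R : ℝ → Plane → ℝ) (a b γ : ℝ) :
    Kernel (Path × Path) (Path × Path) :=
  (Kernel.const (Path × Path) (W.prod W)).withDensity
    fun z w => ENNReal.ofReal (pairDensity W R a b z w - γ)

lemma measurable_pairDensity (hR : Continuous (Function.uncurry R)) (hM : ∀ s y, |R s y| ≤ M)
    (hb : |b| * M ≤ 1 / 16) : Measurable (Function.uncurry (pairDensity W R a b)) := by
  have h := measurable_transDensity (W := W) (a := a) hR hM hb
  have h1 : Measurable fun p : (Path × Path) × Path × Path => transDensity W R a b p.1.1 p.2.1 :=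
    h.comp (g := Function.uncurry (transDensity W R a b))
      (f := fun p : (Path × Path) × Path × Path => (p.1.1, p.2.1)) (by fun_prop)
  have h2 : Measurable fun p : (Path × Path) × Path × Path => transDensity W R a b p.1.2 p.2.2 :=
    h.comp (g := Function.uncurry (transDensity W R a b))
      (f := fun p : (Path × Path) × Path × Path => (p.1.2, p.2.2)) (by fun_prop)
  exact h1.mul h2

lemma pairDensity_bounds (hR : Continuous (Function.uncurry R)) (hM : ∀ s y, |R s y| ≤ M)
    (hb : |b| * M ≤ 1 / 16) (z w : Path × Path) :
    Real.exp (-(10 * (|b| * M))) ≤ pairDensity W R a b z w ∧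
      pairDensity W R a b z w ≤ Real.exp (10 * (|b| * M)) := by
  obtain ⟨h1, h2⟩ := transDensity_bounds (W := W) (a := a) hR hM hb z.1 w.1
  obtain ⟨h3, h4⟩ := transDensity_bounds (W := W) (a := a) hR hM hb z.2 w.2
  have e1 : Real.exp (-(10 * (|b| * M))) =
      Real.exp (-(5 * (|b| * M))) * Real.exp (-(5 * (|b| * M))) := by
    rw [← Real.exp_add]; ring_nf
  have e2 : Real.exp (10 * (|b| * M)) = Real.exp (5 * (|b| * M)) * Real.exp (5 * (|b| * M)) := by
    rw [← Real.exp_add]; ring_nf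
  have p0 := Real.exp_pos (-(5 * (|b| * M)))
  have p1 := p0.trans_le h1
  have p3 := p0.trans_le h3
  rw [e1, e2, pairDensity]
  constructor <;> gcongr

lemma residualKernel_apply (hR : Continuous (Function.uncurry R)) (hM : ∀ s y, |R s y| ≤ M)
    (hb : |b| * M ≤ 1 / 16) (z : Path × Path) :
    residualKernel W R a b γ z =
      (W.prod W).withDensity fun w => ENNReal.ofReal (pairDensity W R a b z w - γ) := by
  have h := measurable_pairDensity (W := W) (a := a) hR hM hb
  rw [residualKernel, Kernel.withDensity_apply _ ((h.sub_const γ).ennreal_ofReal),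
    Kernel.const_apply]

lemma pairTransition_eq (hR : Continuous (Function.uncurry R)) (hM : ∀ s y, |R s y| ≤ M)
    (hb : |b| * M ≤ 1 / 16) (z : Path × Path) :
    pairTransition W R a b z =
      (W.prod W).withDensity fun w => ENNReal.ofReal (pairDensity W R a b z w) := by
  have h := measurable_transDensity (W := W) (a := a) hR hM hb
  have h1 : ∀ x, Measurable (transDensity W R a b x) := fun x =>
    h.comp (g := Function.uncurry (transDensity W R a b)) (f := fun y : Path => (x, y))
      (by fun_prop)
  have := transition_eq (W := W) (a := a) hR hM hb z.2
  rw [pairTransition, transition_eq hR hM hb, this,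
    prod_withDensity (h1 _).ennreal_ofReal (h1 _).ennreal_ofReal]
  congr 1
  funext w
  rw [pairDensity, ENNReal.ofReal_mul]
  exact (Real.exp_pos _).le.trans (transDensity_bounds hR hM hb _ _).1

/-- The density of the pair is at least `γ` at every point, so `ENNReal.ofReal` truncates nothing
and the subtraction of $\gamma\,W\times W$ is exact. -/
lemma pairTransition_eq_add (hR : Continuous (Function.uncurry R)) (hM : ∀ s y, |R s y| ≤ M)
    (hb : |b| * M ≤ 1 / 16) (hγ : 0 ≤ γ) (hlow : γ ≤ Real.exp (-(10 * (|b| * M))))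
    (z : Path × Path) :
    pairTransition W R a b z = residualKernel W R a b γ z + ENNReal.ofReal γ • W.prod W := by
  have h := measurable_pairDensity (W := W) (a := a) hR hM hb
  have h1 : Measurable (pairDensity W R a b z) :=
    h.comp (g := Function.uncurry (pairDensity W R a b)) (f := fun w : Path × Path => (z, w))
      (by fun_prop)
  rw [pairTransition_eq hR hM hb, residualKernel_apply hR hM hb, ← withDensity_const,
    ← withDensity_add_right _ measurable_const]
  congr 1
  funext w
  rw [Pi.add_apply, ← ENNReal.ofReal_add _ hγ, sub_add_cancel]
  linarith [(pairDensity_bounds (W := W) (a := a) hR hM hb z w).1]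

lemma pairTransition_univ (hR : Continuous (Function.uncurry R)) (hM : ∀ s y, |R s y| ≤ M)
    (hb : |b| * M ≤ 1 / 16) (z : Path × Path) : pairTransition W R a b z Set.univ = 1 := by
  have h1 : ∀ x, transition W R a b x Set.univ = 1 := fun x => by
    rw [transition_eq hR hM hb, withDensity_apply _ MeasurableSet.univ, Measure.restrict_univ,
      lintegral_transDensity hR hM hb]
  have hp : ∀ x, IsProbabilityMeasure (transition W R a b x) := fun x => ⟨h1 x⟩
  rw [pairTransition]
  simp

lemma residualKernel_univ (hR : Continuous (Function.uncurry R)) (hM : ∀ s y, |R s y| ≤ M)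
    (hb : |b| * M ≤ 1 / 16) (hγ : 0 ≤ γ) (hlow : γ ≤ Real.exp (-(10 * (|b| * M))))
    (z : Path × Path) : residualKernel W R a b γ z Set.univ = ENNReal.ofReal (1 - γ) := by
  have h1 := pairTransition_univ (W := W) (a := a) hR hM hb z
  rw [pairTransition_eq_add hR hM hb hγ hlow] at h1
  simp only [Measure.add_apply, Measure.smul_apply, measure_univ, smul_eq_mul, mul_one] at h1
  rw [ENNReal.ofReal_sub _ hγ, ENNReal.ofReal_one, ← h1,
    ENNReal.add_sub_cancel_right ENNReal.ofReal_ne_top]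

lemma isFiniteKernel_residualKernel (hR : Continuous (Function.uncurry R))
    (hM : ∀ s y, |R s y| ≤ M) (hb : |b| * M ≤ 1 / 16) (hγ : 0 ≤ γ)
    (hlow : γ ≤ Real.exp (-(10 * (|b| * M)))) : IsFiniteKernel (residualKernel W R a b γ) :=
  ⟨ENNReal.ofReal (1 - γ), ENNReal.ofReal_lt_top,
    fun z => (residualKernel_univ hR hM hb hγ hlow z).le⟩

lemma isResidual_residualKernel (hW : IsWienerMeasure W) (hR : Continuous (Function.uncurry R))
    (hM : ∀ s y, |R s y| ≤ M) (hb : |b| * M ≤ 1 / 16) (hγ : 0 ≤ γ)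
    (hlow : γ ≤ Real.exp (-(10 * (|b| * M)))) :
    IsResidual γ (Real.exp (-(10 * (|b| * M))) - γ) (Real.exp (10 * (|b| * M)) - γ) (W.prod W)
      (residualKernel W R a b γ) incr Prod.swap where
  measurable_incr := measurable_incr
  map_incr := map_incr_eq hW
  mass := residualKernel_univ hR hM hb hγ hlow
  lower z := by
    rw [residualKernel_apply hR hM hb, ← withDensity_const]
    refine withDensity_mono (ae_of_all _ fun w => ENNReal.ofReal_le_ofReal ?_)
    linarith [(pairDensity_bounds (W := W) (a := a) hR hM hb z w).1]
  upper z := by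
    rw [residualKernel_apply hR hM hb, ← withDensity_const]
    refine withDensity_mono (ae_of_all _ fun w => ENNReal.ofReal_le_ofReal ?_)
    linarith [(pairDensity_bounds (W := W) (a := a) hR hM hb z w).2]
  measurable_symm := measurable_swap
  map_symm := Measure.prod_swap
  incr_symm z := by simp [incr]
  -- Both components use the same transition density, so exchanging them in the old and the new
  -- state leaves the product unchanged.
  kernel_symm z := by
    have h := measurable_pairDensity (W := W) (a := a) hR hM hb
    have h1 : ∀ z, Measurable fun w => ENNReal.ofReal (pairDensity W R a b z w - γ) := fun z =>
      ((h.comp (g := Function.uncurry (pairDensity W R a b)) (f := fun w : Path × Path => (z, w))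
      (by fun_prop)).sub_const γ).ennreal_ofReal
    refine Measure.ext_of_lintegral _ fun g hg => ?_
    rw [lintegral_map hg measurable_swap, residualKernel_apply hR hM hb,
      residualKernel_apply hR hM hb, lintegral_withDensity_eq_lintegral_mul _ (h1 _) hg,
      lintegral_withDensity_eq_lintegral_mul (W.prod W) (h1 z)
        (g := fun w => g w.swap) (hg.comp measurable_swap)]
    conv_lhs => rw [← Measure.prod_swap]
    rw [lintegral_map ((h1 _).mul hg) measurable_swap]
    refine lintegral_congr fun w => ?_
    simp only [Pi.mul_apply, pairDensity, Prod.fst_swap, Prod.snd_swap]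
    rw [mul_comm (transDensity W R a b z.2 w.2)]

/-- The probability `1 - γ` of a failure cancels the normalization of `residual`, which leaves the
kernel of mass `1 - γ` that the block analysis uses. -/
lemma stepLaw_eq (hR : Continuous (Function.uncurry R)) (hM : ∀ s y, |R s y| ≤ M)
    (hb : |b| * M ≤ 1 / 16) (hγ : 0 ≤ γ) (hγ1 : γ < 1) (hlow : γ ≤ Real.exp (-(10 * (|b| * M))))
    (z : State) :
    stepLaw W R a b γ z = ENNReal.ofReal γ • (Measure.dirac true).prod (W.prod W) +
      (Measure.dirac false).prod (residualKernel W R a b γ z.2) := by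
  have hfin := isFiniteKernel_residualKernel (W := W) (a := a) hR hM hb hγ hlow
  have hγf : IsFiniteMeasure (ENNReal.ofReal γ • W.prod W) :=
    Measure.smul_finite _ ENNReal.ofReal_ne_top
  have h0 : ENNReal.ofReal (1 - γ) ≠ 0 := by
    rw [ne_eq, ENNReal.ofReal_eq_zero]; linarith
  rw [stepLaw, residual, pairTransition_eq_add hR hM hb hγ hlow, Measure.add_sub_cancel,
    Measure.prod_smul_right, smul_smul, ENNReal.mul_inv_cancel h0 ENNReal.ofReal_ne_top, one_smul]

lemma isTransitionProbability (hR : Continuous (Function.uncurry R)) (hM : ∀ s y, |R s y| ≤ M)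
    (hb : |b| * M ≤ 1 / 16) (hγ : 0 ≤ γ) (hγ1 : γ < 1)
    (hlow : γ ≤ Real.exp (-(10 * (|b| * M)))) : IsTransitionProbability W R a b γ where
  measurable := by
    set κ : Kernel State State :=
      Kernel.const State (ENNReal.ofReal γ • (Measure.dirac true).prod (W.prod W)) +
        ((residualKernel W R a b γ).comap Prod.snd measurable_snd).map (Prod.mk false) with hκ
    have e : stepLaw W R a b γ = κ := by
      funext z
      have hfin := isFiniteKernel_residualKernel (W := W) (a := a) hR hM hb hγ hlow
      rw [stepLaw_eq hR hM hb hγ hγ1 hlow, hκ, FunLike.coe_add, Pi.add_apply, Kernel.const_apply,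
        Kernel.map_apply _ (by fun_prop), Kernel.comap_apply, Measure.dirac_prod,
        Measure.dirac_prod]
    rw [e]
    exact κ.measurable
  isProbabilityMeasure z := by
    have hfin := isFiniteKernel_residualKernel (W := W) (a := a) hR hM hb hγ hlow
    constructor
    rw [stepLaw_eq hR hM hb hγ hγ1 hlow, ← Set.univ_prod_univ]
    simp only [Measure.add_apply, Measure.smul_apply, Measure.prod_prod, measure_univ,
      residualKernel_univ hR hM hb hγ hlow, smul_eq_mul, one_mul, mul_one]
    rw [← ENNReal.ofReal_add hγ (by linarith)]
    simp

end Residual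

/-! ### The trajectory measure as a regenerative chain -/

/-- The extension of a finite history to a trajectory that stays at the last state. -/
def freeze (n : ℕ) (h : (i : Finset.Iic n) → (fun _ : ℕ => State) i) : ℕ → State :=
  fun i => h ⟨min i n, Finset.mem_Iic.2 (min_le_right i n)⟩

lemma measurable_freeze (n : ℕ) : Measurable (freeze n) :=
  measurable_pi_lambda _ fun _ => measurable_pi_apply _

lemma freeze_frestrictLe (n : ℕ) (τ : ℕ → State) {i : ℕ} (hi : i ≤ n) :
    freeze n (Preorder.frestrictLe n τ) i = τ i := by
  simp [freeze, min_eq_left hi]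

lemma successes_congr {η η' : ℕ → Bool} {n : ℕ} (h : ∀ i ≤ n, η i = η' i) :
    successes η n = successes η' n := by
  induction n with
  | zero => rfl
  | succ n ih => rw [successes, successes, ih fun i hi => h i (by omega), h (n + 1) le_rfl]

lemma count_freeze (n : ℕ) (τ : ℕ → State) :
    count (freeze n (Preorder.frestrictLe n τ)) n = count τ n :=
  successes_congr fun i hi => by rw [freeze_frestrictLe n τ hi]

lemma walk_freeze (v : Path × Path → Plane) (n : ℕ) (τ : ℕ → State) :
    walk v (freeze n (Preorder.frestrictLe n τ)) n = walk v τ n :=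
  Finset.sum_congr rfl fun i hi => by
    rw [freeze_frestrictLe n τ (Nat.lt_succ_iff.1 (Finset.mem_range.1 hi))]

section Chain

variable {W : Measure Path} [IsProbabilityMeasure W] {R : ℝ → Plane → ℝ} {a b γ M : ℝ}

lemma chainLaw_map_zero (h : IsTransitionProbability W R a b γ) :
    (chainLaw W R a b γ).map (fun τ => τ 0) = initLaw W := by
  have hk : ∀ n, IsMarkovKernel (stepKernel W R a b γ h.measurable n) :=
    fun _ => ⟨fun _ => h.isProbabilityMeasure _⟩
  have h1 : (Kernel.trajMeasure (X := fun _ : ℕ => State) (initLaw W)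
      (stepKernel W R a b γ h.measurable)).map (Preorder.frestrictLe 0) =
      (initLaw W).map (MeasurableEquiv.piUnique _).symm := by
    rw [Kernel.trajMeasure, Measure.map_comp _ _ (by fun_prop), Kernel.traj_map_frestrictLe,
      Kernel.partialTraj_self, Measure.id_comp]
  rw [chainLaw, dif_pos h]
  have e : (fun τ : ℕ → State => τ 0) =
      (fun q : (i : Finset.Iic 0) → (fun _ : ℕ => State) i => q ⟨0, Finset.mem_Iic.2 le_rfl⟩) ∘
        Preorder.frestrictLe 0 := rfl
  rw [e, ← Measure.map_map (measurable_pi_apply _) (by fun_prop), h1,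
    Measure.map_map (measurable_pi_apply _) (by fun_prop)]
  exact Measure.map_id

lemma lintegral_chainLaw_step (h : IsTransitionProbability W R a b γ) (n : ℕ)
    {g : ((i : Finset.Iic n) → (fun _ : ℕ => State) i) × State → ENNReal} (hg : Measurable g) :
    ∫⁻ τ, g (Preorder.frestrictLe n τ, τ (n + 1)) ∂(chainLaw W R a b γ) =
      ∫⁻ τ, ∫⁻ s, g (Preorder.frestrictLe n τ, s) ∂(stepLaw W R a b γ (τ n))
        ∂(chainLaw W R a b γ) := by
  have hk : ∀ n, IsMarkovKernel (stepKernel W R a b γ h.measurable n) :=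
    fun _ => ⟨fun _ => h.isProbabilityMeasure _⟩
  rw [chainLaw, dif_pos h]
  have h1 := Kernel.map_frestrictLe_trajMeasure_compProd_eq_map_trajMeasure
    (X := fun _ : ℕ => State) (μ₀ := initLaw W) (κ := stepKernel W R a b γ h.measurable) (a := n)
  have h2 := lintegral_map (μ := Kernel.trajMeasure (X := fun _ : ℕ => State) (initLaw W)
    (stepKernel W R a b γ h.measurable)) hg
    (g := fun τ : ℕ → State => (Preorder.frestrictLe (π := fun _ : ℕ => State) n τ, τ (n + 1)))
    (by fun_prop)
  rw [← h2, ← h1, Measure.lintegral_compProd hg, lintegral_map _ (by fun_prop)]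
  · rfl
  · exact hg.lintegral_kernel_prod_right'

lemma isRegenChain_chainLaw (hR : Continuous (Function.uncurry R)) (hM : ∀ s y, |R s y| ≤ M)
    (hb : |b| * M ≤ 1 / 16) (hγ : 0 ≤ γ) (hγ1 : γ < 1) (hlow : γ ≤ Real.exp (-(10 * (|b| * M)))) :
    IsRegenChain γ (W.prod W) (residualKernel W R a b γ) incr (chainLaw W R a b γ) where
  init := by
    have h := isTransitionProbability (W := W) (a := a) hR hM hb hγ hγ1 hlow
    have h1 := congrArg (fun m : Measure State => m.map Prod.snd) (chainLaw_map_zero h)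
    rw [Measure.map_map measurable_snd (measurable_pi_apply _)] at h1
    refine h1.trans ?_
    rw [initLaw, Measure.map_snd_prod]
    simp
  step n g hg := by
    have h := isTransitionProbability (W := W) (a := a) hR hM hb hγ hγ1 hlow
    have hfin := isFiniteKernel_residualKernel (W := W) (a := a) hR hM hb hγ hlow
    -- The one-step identity tests functions of the finite history, whereas `count` and `walk` take
    -- whole trajectories; freezing the history after `n` changes neither of them at time `n`.
    have hc : Measurable fun q : (i : Finset.Iic n) → (fun _ : ℕ => State) i =>
        count (freeze n q) n := (measurable_count n).comp (measurable_freeze n)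
    have hw : Measurable fun q : (i : Finset.Iic n) → (fun _ : ℕ => State) i =>
        walk incr (freeze n q) n := (measurable_walk measurable_incr n).comp (measurable_freeze n)
    have h1 := lintegral_chainLaw_step h n
      (g := fun p => g ((count (freeze n p.1) n, walk incr (freeze n p.1) n), p.2))
      (hg.comp (((hc.comp measurable_fst).prodMk (hw.comp measurable_fst)).prodMk measurable_snd))
    simp only [count_freeze, walk_freeze] at h1
    rw [h1]
    refine lintegral_congr fun τ => ?_
    have hgm : ∀ q, Measurable fun s => g (q, s) := fun q => hg.comp (by fun_prop)
    rw [stepLaw_eq hR hM hb hγ hγ1 hlow, lintegral_add_measure, lintegral_smul_measure,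
      Measure.dirac_prod, Measure.dirac_prod, lintegral_map (hgm _) (by fun_prop),
      lintegral_map (hgm _) (by fun_prop), smul_eq_mul]

/-- The law of the walk at the regeneration times. -/
lemma map_regenDiff_eq_convPow (hW : IsWienerMeasure W) (hR : Continuous (Function.uncurry R))
    (hM : ∀ s y, |R s y| ≤ M) (hb : |b| * M ≤ 1 / 16) (hγ : 0 < γ) (hγ1 : γ < 1)
    (hlow : γ ≤ Real.exp (-(10 * (|b| * M)))) {k : ℕ} (hk : 1 ≤ k) :
    (chainLaw W R a b γ).map (regenDiff k) =
      convPow (mixed γ (blockRest γ (W.prod W) (residualKernel W R a b γ) incr)) k := by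
  have hfin := isFiniteKernel_residualKernel (W := W) (a := a) hR hM hb hγ.le hlow
  have hres := isResidual_residualKernel (a := a) hW hR hM hb hγ.le hlow
  obtain ⟨j, rfl⟩ := Nat.exists_eq_add_of_le' hk
  rw [mixed_blockRest hres]
  refine map_regen_eq_convPow (isRegenChain_chainLaw hR hM hb hγ.le hγ1 hlow) measurable_incr
    (blockSum_prob hres hγ hγ1) (measurable_regenDiff _) fun τ n hn => ?_
  -- At a regeneration time `n + 1` the sum stops at the segment `n`: the fresh sample drawn at `n +
  -- 1` belongs to the next block.
  rw [regenDiff_eq_sum, hn]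
  rfl

end Chain

/-! ### Weak coupling and convergence in distribution -/

lemma tendsto_coupling (βhat : ℝ) :
    Tendsto (fun ε : ℝ => βhat ^ 2 / Real.log (1 / ε)) (𝓝[>] 0) (𝓝 0) := by
  have h : Tendsto (fun ε : ℝ => Real.log (1 / ε)) (𝓝[>] 0) atTop := by
    simp only [one_div]
    exact Real.tendsto_log_atTop.comp tendsto_inv_nhdsGT_zero
  exact h.const_div_atTop _

/-- The chains at small `ε` satisfy the hypotheses of the local central limit theorem. -/
lemma exists_eventually_isSplit {φ : ℝ → ℝ} {ψ : Plane → ℝ}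
    (hφ_smooth : ContDiff ℝ ∞ φ) (hφ_supp : Function.support φ ⊆ Set.Icc 0 1)
    (hψ_smooth : ContDiff ℝ ∞ ψ) (hψ_supp : Function.support ψ ⊆ Metric.closedBall 0 (1 / 2))
    (βhat a γ : ℝ) (hγ_pos : 0 < γ) (hγ_lt_one : γ < 1)
    (W : Measure Path) [IsProbabilityMeasure W] (hW : IsWienerMeasure W) :
    ∃ (r : ℝ → Measure Plane) (c₁ c₂ : ℝ → ℝ) (K : ℝ),
      Tendsto c₁ (𝓝[>] 0) (𝓝 (1 - γ)) ∧ Tendsto c₂ (𝓝[>] 0) (𝓝 (1 - γ)) ∧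
      ∀ᶠ ε in 𝓝[>] (0 : ℝ), IsSplit γ K (c₁ ε) (c₂ ε) (r ε) ∧
        ∀ k, 1 ≤ k → (chainLawEps W φ ψ βhat a γ ε).map (regenDiff k) =
          convPow (mixed γ (r ε)) k := by
  obtain ⟨hR, M, hM⟩ := noiseCorr_spec hφ_smooth hφ_supp hψ_smooth hψ_supp
  set b : ℝ → ℝ := fun ε => βhat ^ 2 / Real.log (1 / ε) with hb
  have hθ : Tendsto (fun ε => |b ε| * M) (𝓝[>] 0) (𝓝 0) := by
    have := (tendsto_coupling βhat).abs.mul_const M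
    rwa [abs_zero, zero_mul] at this
  have hc₁ : Tendsto (fun ε => Real.exp (-(10 * (|b ε| * M))) - γ) (𝓝[>] 0) (𝓝 (1 - γ)) := by
    have := ((Real.continuous_exp.tendsto _).comp (hθ.const_mul 10).neg).sub_const γ
    simpa [Function.comp_def] using this
  have hc₂ : Tendsto (fun ε => Real.exp (10 * (|b ε| * M)) - γ) (𝓝[>] 0) (𝓝 (1 - γ)) := by
    have := ((Real.continuous_exp.tendsto _).comp (hθ.const_mul 10)).sub_const γ
    simpa [Function.comp_def] using this
  refine ⟨fun ε => blockRest γ (W.prod W) (residualKernel W (noiseCorr φ ψ) a (b ε) γ) incr,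
    _, _, 2 * (4 * Real.pi)⁻¹, hc₁, hc₂, ?_⟩
  -- The smallness of $\theta$ provides the eigenpair; $c_1\ge0$ is the minorization by
  -- $\gamma\,W\times W$; $c_1<1$ and $c_2\le1-\gamma/2$ make the geometric series converge, the
  -- latter with a bound that does not depend on ε.
  filter_upwards [hθ.eventually_le_const (show (0 : ℝ) < 1 / 16 by norm_num),
    hc₁.eventually_const_le (show 0 < 1 - γ by linarith),
    hc₁.eventually_lt_const (show 1 - γ < 1 by linarith),
    hc₂.eventually_const_le (show 0 < 1 - γ by linarith),
    hc₂.eventually_le_const (show 1 - γ < 1 - γ / 2 by linarith)] with ε h1 h2 h3 h4 h5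
  have hlow : γ ≤ Real.exp (-(10 * (|b ε| * M))) := by linarith
  have hfin := isFiniteKernel_residualKernel (W := W) (a := a) hR hM h1 hγ_pos.le hlow
  exact ⟨(isResidual_residualKernel hW hR hM h1 hγ_pos.le hlow).isSplit hγ_pos hγ_lt_one h2 h3 h4 h5,
    fun k hk => map_regenDiff_eq_convPow hW hR hM h1 hγ_pos hγ_lt_one hlow hk⟩

/-- Lévy's theorem for sequences suffices, because convergence along a countably generated filter is
tested on sequences. -/
lemma tendsto_probabilityMeasure_of_tendsto_charFun {ι : Type*} {l : Filter ι}
    [l.IsCountablyGenerated] {μ : ι → ProbabilityMeasure Plane} {μ₀ : ProbabilityMeasure Plane}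
    (h : ∀ t : Plane, Tendsto (fun i => charFun (μ i : Measure Plane) t) l
      (𝓝 (charFun (μ₀ : Measure Plane) t))) : Tendsto μ l (𝓝 μ₀) :=
  tendsto_of_seq_tendsto fun _ hx =>
    ProbabilityMeasure.tendsto_of_tendsto_charFun fun t => (h t).comp hx

end SHE

end

theorem propositionA2
    (φ : ℝ → ℝ) (ψ : SHE.Plane → ℝ)
    (hφ_smooth : ContDiff ℝ ∞ φ) (hφ_nonneg : ∀ s, 0 ≤ φ s)
    (hφ_supp : Function.support φ ⊆ Set.Icc 0 1)
    (hψ_smooth : ContDiff ℝ ∞ ψ) (hψ_nonneg : ∀ y, 0 ≤ ψ y)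
    (hψ_symm : ∀ y, ψ (-y) = ψ y)
    (hψ_supp : Function.support ψ ⊆ Metric.closedBall 0 (1 / 2))
    (βhat a γ : ℝ) (hγ_pos : 0 < γ) (hγ_lt_one : γ < 1)
    (W : Measure SHE.Path) [IsProbabilityMeasure W] (hW : SHE.IsWienerMeasure W) :
    TendstoInDistribution
      (fun (p : ℕ × ℝ) (τ : ℕ → SHE.State) => (√(p.1 : ℝ))⁻¹ • SHE.regenDiff p.1 τ)
      (atTop ×ˢ 𝓝[>] (0 : ℝ))
      (id : SHE.Plane → SHE.Plane)
      (fun p => SHE.chainLawEps W φ ψ βhat a γ p.2)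
      (multivariateGaussian 0 ((2 / γ) • (1 : Matrix (Fin 2) (Fin 2) ℝ))) ∧
    ∃ F : ℕ → ℝ → SHE.Plane → ℝ,
      (∀ᶠ ε in 𝓝[>] (0 : ℝ), ∀ k : ℕ, 1 ≤ k →
        Measurable (F k ε) ∧ (∀ x, 0 ≤ F k ε x) ∧ (2 ≤ k → Continuous (F k ε)) ∧
        (SHE.chainLawEps W φ ψ βhat a γ ε).map (SHE.regenDiff k) =
          volume.withDensity (fun x => ENNReal.ofReal (F k ε x))) ∧
      Tendsto
        (fun p : ℕ × ℝ => ⨆ x : SHE.Plane, ENNReal.ofReal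
          |(p.1 : ℝ) * F p.1 p.2 x -
            γ / (4 * Real.pi) * Real.exp (-γ * ‖x‖ ^ 2 / (4 * (p.1 : ℝ)))|)
        (atTop ×ˢ 𝓝[>] (0 : ℝ)) (𝓝 0) := by

  obtain ⟨r, c₁, c₂, K, hc₁, hc₂, h⟩ := SHE.exists_eventually_isSplit hφ_smooth hφ_supp hψ_smooth
    hψ_supp βhat a γ hγ_pos hγ_lt_one W hW
  have hsplit : ∀ᶠ ε in 𝓝[>] (0 : ℝ), SHE.IsSplit γ K (c₁ ε) (c₂ ε) (r ε) := h.mono fun _ h => h.1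
  refine ⟨⟨fun p => ((SHE.measurable_regenDiff p.1).const_smul (√(p.1 : ℝ))⁻¹).aemeasurable,
    measurable_id.aemeasurable, ?_⟩, ?_⟩
  · refine SHE.tendsto_probabilityMeasure_of_tendsto_charFun fun η => ?_
    have hlim := SHE.tendsto_charFun_pow hγ_pos hc₁ hc₂ hsplit η
    have htarget : charFun ((multivariateGaussian 0
        ((2 / γ) • (1 : Matrix (Fin 2) (Fin 2) ℝ)) : Measure SHE.Plane).map id) η =
        ((Real.exp (-‖η‖ ^ 2 / γ) : ℝ) : ℂ) := by
      rw [Measure.map_id, SHE.charFun_gaussian _ (by positivity)]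
      congr 2
      field_simp
    simp only [ProbabilityMeasure.coe_mk]
    rw [htarget]
    refine hlim.congr' ?_
    have h' := (tendsto_snd (f := (atTop : Filter ℕ)) (g := 𝓝[>] (0 : ℝ))).eventually h
    have hk : ∀ᶠ p : ℕ × ℝ in atTop ×ˢ 𝓝[>] (0 : ℝ), 1 ≤ p.1 :=
      tendsto_fst.eventually (eventually_ge_atTop 1)
    filter_upwards [h', hk] with p hp hpk
    have := hp.1.finite
    have e : (SHE.chainLawEps W φ ψ βhat a γ p.2).map
        (fun τ : ℕ → SHE.State => (√(p.1 : ℝ))⁻¹ • SHE.regenDiff p.1 τ) =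
        ((SHE.chainLawEps W φ ψ βhat a γ p.2).map (SHE.regenDiff p.1)).map
          (fun x => (√(p.1 : ℝ))⁻¹ • x) := by
      rw [Measure.map_map (by fun_prop) (SHE.measurable_regenDiff _)]
      rfl
    -- Scaling the vector by $k^{-1/2}$ scales the frequency, so the characteristic function is the
    -- $k$-th power at $\eta/\sqrt k$ whose limit is `hlim`.
    rw [e, charFun_map_smul, hp.2 _ hpk, SHE.charFun_convPow]
  · obtain ⟨F, hF, hFlim⟩ := SHE.exists_density_tendsto hγ_pos hγ_lt_one hc₁ hc₂ hsplit
    refine ⟨F, ?_, hFlim⟩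
    filter_upwards [hF, h] with ε hε hε' k hk
    obtain ⟨h1, h2, h3, h4⟩ := hε k hk
    exact ⟨h1, h2, h3, (hε'.2 k hk).trans h4⟩
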